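/- Let $F\ge 6$ be even. The pseudo-double wheel $\mathrm{pdw}_F$ is the map consisting of a cycle $v_0v_1\cdots v_{F-1}$ (indices modulo $F$), a vertex $N$ joined to all $v_{2i}$ and a vertex $S$ joined to all $v_{2i+1}$; the counterclockwise cyclic orders are $\ldots,v_{2i},v_{2i+2},\ldots$ at $N$; $\ldots,v_{2i+1},v_{2i-1},\ldots$ at $S$; $(v_{2i-1},v_{2i+1},N)$ at $v_{2i}$; and $(v_{2i+2},v_{2i},S)$ at $v_{2i+1}$. The edges at $N$ or $S$ are called meridian. A spherical quadrangle (possibly concave) is a closed region bounded by a simple closed curve made of four great-circle arcs shorter than $\pi$; its edge-lengths are, in cyclic order, $c,a,a,b$, with $a=c\ne b$ for type 2 and $a,b,c$ mutually distinct for type 4. A chart of a tiling consists of its map, with the set of angles $\angle uvw$ (pairs of consecutive neighbours $u,w$ of $v$ in the counterclockwise order), the lengths of its edges, and an assignment of variables $\alpha,\beta,\gamma,\delta$ to its angles such that, for suitable values of these variables, every inner angle of a tile is the value of its variable; the values around every vertex then add up to $2\pi$. The mirror image of a chart reverses all the cyclic orders and keeps the lengths and the variables. The chart $\mathcal P_F$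 with edge-lengths $a,b,c$ has map $\mathrm{pdw}_F$; its meridian edges have length $a$, the edges $v_{2i}v_{2i+1}$ length $b$, the edges $v_{2i+1}v_{2i+2}$ length $c$; and $$\angle v_{2i}Nv_{2i+2}=\angle v_{2i+1}Sv_{2i-1}=\gamma,\quad \angle v_{2i-1}v_{2i}v_{2i+1}=\angle v_{2i+2}v_{2i+1}v_{2i}=\alpha,$$ $$\angle v_{2i+1}v_{2i}N=\angle v_{2i}v_{2i+1}S=\delta,\quad \angle Nv_{2i}v_{2i-1}=\angle Sv_{2i+1}v_{2i+2}=\beta .$$ For $F$ divisible by $4$, the type-2 chart $\mathcal Q_F$ (with $a=c\neq b$) has the same map and lengths, and is obtained from the angles of $\mathcal P_F$ by swapping $\alpha\leftrightarrow\delta$ and $\beta\leftrightarrow\gamma$ in the faces $N v_{2i}v_{2i+1}v_{2i+2}$ with $i$ odd and in the faces $S v_{2i-1}v_{2i}v_{2i+1}$ with $i$ even. Theorem. Take an edge-to-edge tiling of the sphere by $F\ge 6$ congruent (mirror images allowed), possibly concave quadrangles of type 2 or 4 with edge-lengths $a,b,c$ as above, whose map is $\mathrm{pdw}_F$ ($F$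 even) and in which every edge of length $b$ is non-meridian. Then, up to isomorphism of maps, $\mathcal P_F$ (with these $a,b,c$) or its mirror image is a chart of the tiling. In particular, if $4\mid F$, neither $\mathcal Q_F$ (for any lengths $a=c\ne b$) nor its mirror image is a chart of the tiling, whether the tile is convex or concave. -/

import Mathlib

open Filter Topology

noncomputable section

/-! ### Spherical quadrangles -/

/-- Euclidean 3-space. -/
abbrev Space3 : Type := EuclideanSpace ℝ (Fin 3)

/-- The unit sphere, with its subspace topology. -/
abbrev Sphere2 : Type := Metric.sphere (0 : Space3) 1

/-- The cross product on Euclidean 3-space. -/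
def cross3 (u v : Space3) : Space3 :=
  WithLp.toLp 2 (crossProduct (WithLp.ofLp u) (WithLp.ofLp v))

/-- Spherical distance: the length of the minor great-circle arc from `p` to `q`. -/
def sphDist (p q : Sphere2) : ℝ := InnerProductGeometry.angle (p : Space3) (q : Space3)

/-- The closed minor great-circle arc joining `p` and `q` (for `q ≠ -p`). -/
def sphArc (p q : Sphere2) : Set Sphere2 :=
  {x | ∃ s t : ℝ, 0 ≤ s ∧ 0 ≤ t ∧ (x : Space3) = s • (p : Space3) + t • (q : Space3)}

/-- The angle in `[0, 2π)` swept when the direction at `p` towards `q` is turned counterclockwise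
(seen from outside the sphere) to the direction at `p` towards `r`.
The tangential parts of `q` and `r` at `p` have inner product `⟪q, r⟫ - ⟪p, q⟫ ⟪p, r⟫`, and their
oriented area is `⟪p, q × r⟫`. -/
def ccwAngle (p q r : Sphere2) : ℝ :=
  let z : ℂ :=
    ⟨inner ℝ (q : Space3) (r : Space3) -
        inner ℝ (p : Space3) (q : Space3) * inner ℝ (p : Space3) (r : Space3),
      inner ℝ (p : Space3) (cross3 q r)⟩
  if 0 ≤ z.arg then z.arg else z.arg + 2 * Real.pi

/-- A (possibly concave) spherical quadrangle: a closed region of the sphere whose interior is one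
of the two sides of a simple closed curve made of four great-circle arcs shorter than `π`.
The corners are listed counterclockwise, that is, with the region on the left. -/
structure SphQuadrangle where
  /-- the corners, indexed cyclically -/
  corner : Fin 4 → Sphere2
  /-- the closed region -/
  region : Set Sphere2
  corner_injective : Function.Injective corner
  not_antipodal : ∀ k, (corner (k + 1) : Space3) ≠ -(corner k : Space3)
  edge_inter_next : ∀ k,
    sphArc (corner k) (corner (k + 1)) ∩ sphArc (corner (k + 1)) (corner (k + 2)) =
      {corner (k + 1)}
  edge_inter_opposite : ∀ k,
    Disjoint (sphArc (corner k) (corner (k + 1))) (sphArc (corner (k + 2)) (corner (k + 3)))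
  closure_interior : closure (interior region) = region
  interior_connected : IsConnected (interior region)
  frontier_eq : frontier region = ⋃ k, sphArc (corner k) (corner (k + 1))
  /-- immediately to the left of each point of each open edge lies the interior -/
  interior_left : ∀ (k : Fin 4) (s t : ℝ), 0 < s → 0 < t →
    ∀ᶠ ε : ℝ in 𝓝[>] 0, ∃ x ∈ interior region,
      SameRay ℝ (x : Space3)
        (s • (corner k : Space3) + t • (corner (k + 1) : Space3) +
          ε • cross3 (corner k) (corner (k + 1)))

namespace SphQuadrangle

/-- The edge from the `k`-th corner to the next one. -/
def edge (Q : SphQuadrangle) (k : Fin 4) : Set Sphere2 := sphArc (Q.corner k) (Q.corner (k + 1))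

/-- The inner angle at the `k`-th corner (in radians). As the region is on the left, it is swept
counterclockwise from the next corner to the previous one. -/
def innerAngle (Q : SphQuadrangle) (k : Fin 4) : ℝ :=
  ccwAngle (Q.corner k) (Q.corner (k + 1)) (Q.corner (k - 1))

/-- Two quadrangles are congruent if an isometry of the sphere (an element of `O(3)`) carries one
region to the other and consecutive corners to consecutive corners. The cyclic order of the corners
is kept (`ε = 1`) or reversed (`ε = -1`). -/
def Congruent (Q Q' : SphQuadrangle) : Prop :=
  ∃ g : Space3 ≃ₗᵢ[ℝ] Space3,
    (∃ k₀ ε : Fin 4, (ε = 1 ∨ ε = -1) ∧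
      ∀ j, g (Q.corner j) = (Q'.corner (k₀ + ε * j) : Space3)) ∧
    ∀ x y : Sphere2, g x = (y : Space3) → (x ∈ Q.region ↔ y ∈ Q'.region)

end SphQuadrangle

/-- The two types of tiles under consideration. -/
inductive TileType
  | two
  | four

/-- Three positive edge-lengths `a`, `b`, `c`. -/
structure SideLengths where
  a : ℝ
  b : ℝ
  c : ℝ
  a_pos : 0 < a
  b_pos : 0 < b
  c_pos : 0 < c

/-- For type 2, `a = c ≠ b`; for type 4, the lengths `a`, `b`, `c` are mutually distinct. -/
def SideLengths.OfType (ℓ : SideLengths) : TileType → Prop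
  | .two => ℓ.a = ℓ.c ∧ ℓ.a ≠ ℓ.b
  | .four => ℓ.a ≠ ℓ.b ∧ ℓ.a ≠ ℓ.c ∧ ℓ.b ≠ ℓ.c

/-- The quadrangle has, in one of the two directions around its boundary, edges of lengths
`c, a, a, b`. -/
def SphQuadrangle.HasSides (Q : SphQuadrangle) (ℓ : SideLengths) : Prop :=
  ∃ k₀ ε : Fin 4, (ε = 1 ∨ ε = -1) ∧ ∀ j : Fin 4,
    sphDist (Q.corner (k₀ + ε * j)) (Q.corner (k₀ + ε * (j + 1))) = ![ℓ.c, ℓ.a, ℓ.a, ℓ.b] j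

/-- A quadrangle of type `t` with edge-lengths `ℓ`. -/
def SphQuadrangle.IsOfType (Q : SphQuadrangle) (t : TileType) (ℓ : SideLengths) : Prop :=
  ℓ.OfType t ∧ Q.HasSides ℓ

/-! ### Tilings -/

/-- An edge-to-edge tiling of the sphere by `F` quadrangles. -/
structure QuadTiling (F : ℕ) where
  tile : Fin F → SphQuadrangle
  cover : ⋃ i, (tile i).region = Set.univ
  interior_disjoint : ∀ i j, i ≠ j →
    Disjoint (interior (tile i).region) (interior (tile j).region)
  /-- distinct tiles meet only in common vertices and common edges -/
  edge_to_edge : ∀ i j, i ≠ j → ∀ x, x ∈ (tile i).region → x ∈ (tile j).region →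
    (∃ k l, x = (tile i).corner k ∧ x = (tile j).corner l) ∨
    (∃ k l, (tile i).edge k = (tile j).edge l ∧ x ∈ (tile i).edge k)

/-- All the tiles are congruent. -/
def QuadTiling.Monohedral {F : ℕ} (T : QuadTiling F) : Prop :=
  ∀ i j, (T.tile i).Congruent (T.tile j)

/-! ### Maps and charts -/

/-- A map: a graph together with the set of angles `(u, v, w)` around each vertex `v`. The angles
around `v` are the pairs of cyclically consecutive neighbours of `v`. -/
structure SphMap (V : Type) where
  graph : SimpleGraph V
  angle : V → V → V → Prop
  cyclic : ∀ v, ∃ (m : ℕ) (l : ZMod m → V), 0 < m ∧ Function.Injective l ∧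
    (∀ u, graph.Adj v u ↔ ∃ i, l i = u) ∧
    ∀ u w, angle u v w ↔ ∃ i, l i = u ∧ l (i + 1) = w

/-- The types of angles. -/
inductive AngleType
  | alpha
  | beta
  | gamma
  | delta

/-- A chart: a map with a length-assignment (only the values on edges are relevant) and an
angle-assignment (only the values on angles of the map are relevant). The relation that the angles
around each vertex add up to `2π` is imposed on the values of the variables `α, β, γ, δ`,
see `Chart.VertexRelations`. -/
structure Chart (V : Type) extends SphMap V where
  len : V → V → ℝ
  ang : V → V → V → AngleType
  len_symm : ∀ u v, graph.Adj u v → len u v = len v u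
  len_pos : ∀ u v, graph.Adj u v → 0 < len u v

/-- The mirror image of a map: the cyclic orders are reversed. -/
def SphMap.mirror {V : Type} (M : SphMap V) : SphMap V where
  graph := M.graph
  angle u v w := M.angle w v u
  cyclic v := by
    obtain ⟨m, l, hm, hl, hadj, hang⟩ := M.cyclic v
    refine ⟨m, fun i => l (-i), hm, fun i j h => neg_injective (hl h), fun u => ?_, fun u w => ?_⟩
    · rw [hadj]
      exact ⟨fun ⟨i, h⟩ => ⟨-i, by simpa using h⟩, fun ⟨i, h⟩ => ⟨-i, h⟩⟩
    · rw [hang]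
      constructor
      · rintro ⟨i, h1, h2⟩
        exact ⟨-(i + 1), by simpa using h2, by simpa using h1⟩
      · rintro ⟨i, h1, h2⟩
        exact ⟨-(i + 1), h2, by simpa using h1⟩

/-- The mirror image of a chart. -/
def Chart.mirror {V : Type} (C : Chart V) : Chart V where
  toSphMap := C.toSphMap.mirror
  len := C.len
  ang u v w := C.ang w v u
  len_symm := C.len_symm
  len_pos := C.len_pos

/-- The angles around each vertex add up to `2π`, for the values `val` of the variables. -/
def Chart.VertexRelations {V : Type} (C : Chart V) (val : AngleType → ℝ) : Prop :=
  ∀ v, ∑ᶠ p ∈ {p : V × V | C.angle p.1 v p.2}, val (C.ang p.1 v p.2) = 2 * Real.pi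

/-- The map of the tiling `T` is `M`, the vertex `v` of `M` being located at `pos v`: vertices,
edges and (counterclockwise) angles of `M` are those of the tiling. -/
structure IsMapOf {V : Type} {F : ℕ} (M : SphMap V) (T : QuadTiling F) (pos : V → Sphere2) :
    Prop where
  pos_injective : Function.Injective pos
  vertex_iff : ∀ x, (∃ v, pos v = x) ↔ ∃ i k, (T.tile i).corner k = x
  adj_iff : ∀ u v, M.graph.Adj u v ↔ ∃ i k,
    ((T.tile i).corner k = pos u ∧ (T.tile i).corner (k + 1) = pos v) ∨
    ((T.tile i).corner k = pos v ∧ (T.tile i).corner (k + 1) = pos u)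
  angle_iff : ∀ u v w, M.angle u v w ↔ ∃ i k,
    (T.tile i).corner (k + 1) = pos u ∧ (T.tile i).corner k = pos v ∧
      (T.tile i).corner (k - 1) = pos w

/-- `C` is a chart of the tiling `T`, where `pos` locates the vertices and `val` gives the values
of the variables `α, β, γ, δ`: the map of `T` is that of `C`, and edge-lengths and inner angles of
the tiles are those which `C` assigns. -/
structure IsChartOf {V : Type} {F : ℕ} (C : Chart V) (T : QuadTiling F) (pos : V → Sphere2)
    (val : AngleType → ℝ) : Prop where
  isMapOf : IsMapOf C.toSphMap T pos
  len_eq : ∀ u v, C.graph.Adj u v → sphDist (pos u) (pos v) = C.len u v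
  ang_eq : ∀ u v w i k, (T.tile i).corner (k + 1) = pos u → (T.tile i).corner k = pos v →
    (T.tile i).corner (k - 1) = pos w → (T.tile i).innerAngle k = val (C.ang u v w)
  vertexRelations : C.VertexRelations val

/-- `C` is a chart of `T`, for some location of the vertices and some values of the angles. -/
def QuadTiling.HasChart {V : Type} {F : ℕ} (T : QuadTiling F) (C : Chart V) : Prop :=
  ∃ pos val, IsChartOf C T pos val

/-! ### Pseudo-double wheels -/

/-- The vertices of the pseudo-double wheel with `F` faces (`F` even): the poles `N`, `S`, and
`ev i = v_{2i}`, `od i = v_{2i+1}`, where `i` is taken modulo `F / 2`. -/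
inductive PdwVertex (F : ℕ)
  | N
  | S
  | ev (i : ZMod (F / 2))
  | od (i : ZMod (F / 2))

open PdwVertex AngleType

/-- Adjacency: the cycle `v_0 v_1 ⋯ v_{F-1}`, with `N` joined to the `v_{2i}` and `S` to the
`v_{2i+1}`. -/
def pdwAdj {F : ℕ} : PdwVertex F → PdwVertex F → Prop
  | N, ev _ => True
  | ev _, N => True
  | S, od _ => True
  | od _, S => True
  | ev i, od j => j = i ∨ j = i - 1
  | od j, ev i => j = i ∨ j = i - 1
  | _, _ => False

/-- The angles. Cyclic order at `N`: `v_{2i}`, `v_{2i+2}`; at `S`: `v_{2i+1}`, `v_{2i-1}`;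
at `v_{2i}`: `v_{2i-1}`, `v_{2i+1}`, `N`; at `v_{2i+1}`: `v_{2i+2}`, `v_{2i}`, `S`. -/
def pdwAngle {F : ℕ} : PdwVertex F → PdwVertex F → PdwVertex F → Prop
  | ev i, N, ev j => j = i + 1
  | od i, S, od j => j = i - 1
  | od i, ev k, od j => i = k - 1 ∧ j = k
  | od i, ev k, N => i = k
  | N, ev k, od j => j = k - 1
  | ev i, od k, ev j => i = k + 1 ∧ j = k
  | ev i, od k, S => i = k
  | S, od k, ev j => j = k + 1
  | _, _, _ => False

/-- A cyclic list of three elements. -/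
def triple {V : Type} (x y z : V) : ZMod 3 → V := (![x, y, z] : Fin 3 → V)

/-- Cyclically consecutive pairs in a list of three. -/
theorem exists_cyclic_three {V : Type} (x y z : V) (P : V → V → Prop) :
    (∃ i : ZMod 3, P (triple x y z i) (triple x y z (i + 1))) ↔
      P x y ∨ P y z ∨ P z x := by
  constructor
  · rintro ⟨i, h⟩
    change Fin 3 at i
    fin_cases i
    · exact Or.inl h
    · exact Or.inr (Or.inl h)
    · exact Or.inr (Or.inr h)
  · rintro (h | h | h)
    · exact ⟨(0 : Fin 3), h⟩
    · exact ⟨(1 : Fin 3), h⟩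
    · exact ⟨(2 : Fin 3), h⟩

/-- A list of three distinct elements has no repetition. -/
theorem injective_three {V : Type} {x y z : V} (h1 : x ≠ y) (h2 : y ≠ z) (h3 : x ≠ z) :
    Function.Injective (triple x y z) := by
  change Function.Injective (![x, y, z] : Fin 3 → V)
  intro i j
  fin_cases i <;> fin_cases j <;> simp [h1, h2, h3, h1.symm, h2.symm, h3.symm]

/-- The pseudo-double wheel with `F` faces, for even `F ≥ 6`. -/
def pdw (F : ℕ) (hF : 6 ≤ F) : SphMap (PdwVertex F) where
  graph :=
    { Adj := pdwAdj
      symm := ⟨by rintro (_ | _ | i | i) (_ | _ | j | j) <;> simp [pdwAdj]⟩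
      loopless := ⟨by rintro (_ | _ | i | i) <;> simp [pdwAdj]⟩ }
  angle := pdwAngle
  cyclic v := by
    have h2 : 3 ≤ F / 2 := by omega
    have : Fact (1 < F / 2) := ⟨by omega⟩
    rcases v with _ | _ | k | k
    · refine ⟨F / 2, ev, by omega, fun i j h => by simpa using h, ?_, ?_⟩
      · rintro (_ | _ | i | i) <;> simp [pdwAdj]
      · rintro (_ | _ | i | i) (_ | _ | j | j) <;> simp [pdwAngle, eq_comm]
    · refine ⟨F / 2, fun i => od (-i), by omega, fun i j h => by simpa using h, ?_, ?_⟩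
      · rintro (_ | _ | i | i) <;> simp [pdwAdj]
        exact ⟨-i, by simp⟩
      · rintro (_ | _ | i | i) (_ | _ | j | j) <;> simp [pdwAngle]
        constructor
        · rintro rfl
          exact ⟨-i, by simp, by ring⟩
        · rintro ⟨a, rfl, rfl⟩
          ring
    · refine ⟨3, triple (od (k - 1)) (od k) N, by omega,
        injective_three (by simp) (by simp) (by simp), fun u => ?_, fun u w => ?_⟩
      · refine Iff.trans ?_ (exists_cyclic_three _ _ _ (fun a _ => a = u)).symm
        rcases u with _ | _ | i | i <;> simp [pdwAdj, eq_comm, or_comm]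
      · refine Iff.trans ?_ (exists_cyclic_three _ _ _ (fun a b => a = u ∧ b = w)).symm
        rcases u with _ | _ | i | i <;> rcases w with _ | _ | j | j <;>
          simp [pdwAngle, eq_comm]
    · refine ⟨3, triple (ev (k + 1)) (ev k) S, by omega,
        injective_three (by simp) (by simp) (by simp), fun u => ?_, fun u w => ?_⟩
      · refine Iff.trans ?_ (exists_cyclic_three _ _ _ (fun a _ => a = u)).symm
        rcases u with _ | _ | i | i <;> simp [pdwAdj, eq_comm, or_comm]
        rw [eq_sub_iff_add_eq, eq_comm (a := i)]
      · refine Iff.trans ?_ (exists_cyclic_three _ _ _ (fun a b => a = u ∧ b = w)).symm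
        rcases u with _ | _ | i | i <;> rcases w with _ | _ | j | j <;>
          simp [pdwAngle, eq_comm]

/-- The northern and southern edges, i.e. those at a pole. -/
def IsMeridian {F : ℕ} : PdwVertex F → PdwVertex F → Prop
  | N, _ => True
  | S, _ => True
  | _, N => True
  | _, S => True
  | _, _ => False

/-- The length-assignment of the charts below: the edges at the poles have length `a`, the edges
`v_{2i} v_{2i+1}` have length `b`, and the edges `v_{2i+1} v_{2i+2}` have length `c`. -/
def pdwLen {F : ℕ} (ℓ : SideLengths) : PdwVertex F → PdwVertex F → ℝ
  | ev i, od j => if j = i then ℓ.b else ℓ.c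
  | od j, ev i => if j = i then ℓ.b else ℓ.c
  | _, _ => ℓ.a

/-- The angle-assignment of the chart `P_F`: all angles at the poles have type `γ`, and in every
face the opposite angle has type `α`, the other end of the edge of length `b` has type `δ`, and the
remaining angle has type `β`. -/
def pAng {F : ℕ} : PdwVertex F → PdwVertex F → PdwVertex F → AngleType
  | od _, ev _, od _ => alpha
  | od _, ev _, N => delta
  | N, ev _, od _ => beta
  | ev _, od _, ev _ => alpha
  | ev _, od _, S => delta
  | S, od _, ev _ => beta
  | _, _, _ => gamma

/-- The angle-assignment of the chart `Q_F` (`F` divisible by `4`): the angle `v_{2i} N v_{2i+2}`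
is `γ` for even `i` and `β` for odd `i`; the angle `v_{2i+1} S v_{2i-1}` is `β` for even `i` and
`γ` for odd `i`; the other angles follow, as the edges `v_{2i} v_{2i+1}` join angles of types `α`
and `δ`. -/
def qAng {F : ℕ} : PdwVertex F → PdwVertex F → PdwVertex F → AngleType
  | ev i, N, ev _ => if Even i.val then gamma else beta
  | od i, S, od _ => if Even i.val then beta else gamma
  | od _, ev i, od _ => if Even i.val then delta else alpha
  | od _, ev i, N => if Even i.val then delta else alpha
  | N, ev i, od _ => if Even i.val then gamma else beta
  | ev _, od i, ev _ => if Even i.val then alpha else delta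
  | ev _, od i, S => if Even i.val then alpha else delta
  | S, od i, ev _ => if Even i.val then beta else gamma
  | _, _, _ => gamma

/-- The chart `P_F` with edge-lengths `ℓ`. -/
def chartP (F : ℕ) (hF : 6 ≤ F) (ℓ : SideLengths) : Chart (PdwVertex F) where
  toSphMap := pdw F hF
  len := pdwLen ℓ
  ang := pAng
  len_symm := by rintro (_ | _ | i | i) (_ | _ | j | j) _ <;> simp [pdwLen]
  len_pos := by
    have := ℓ.a_pos
    have := ℓ.b_pos
    have := ℓ.c_pos
    rintro (_ | _ | i | i) (_ | _ | j | j) _ <;> simp only [pdwLen] <;> (try split_ifs) <;>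
      assumption

/-- The chart `Q_F` with edge-lengths `ℓ`, obtained from `P_F` by swapping `α` with `δ` and `β`
with `γ` in `F / 2` of the faces. It is of type 2, and it is used for `F` divisible by `4`. -/
def chartQ (F : ℕ) (hF : 6 ≤ F) (ℓ : SideLengths) : Chart (PdwVertex F) where
  toSphMap := pdw F hF
  len := pdwLen ℓ
  ang := qAng
  len_symm := (chartP F hF ℓ).len_symm
  len_pos := (chartP F hF ℓ).len_pos

end

noncomputable section

/-! No meridian edge has length `b`, so each tile carries its side `b` on one of its two edges on
the cycle `v_0 v_1 ⋯`. Only one side of a tile has length `b`, and each edge of the cycle is shared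
by a northern and a southern tile. Hence the sides `b` alternate along the cycle: they occupy all
edges `v_{2i} v_{2i+1}` or all edges `v_{2i+1} v_{2i+2}`. The reflection `v_j ↦ v_{-j}` carries the
second case to the first and accounts for the mirror image (`left_or_right`, `reflect`).

With the sides `b` fixed, a tile has two possible positions: its angle at the pole is `γ` (`Placed`)
or `β` (`Flipped`). If `a ≠ c`, a flipped tile would put a side `c` on a meridian that the
neighbouring tile shows to have length `a`. If `a = c`, the positions form two sequences of bits,
constrained by the angle sums at the vertices (`orientations_coherent`). Either `β = γ`, and then
the tile is symmetric with `α = δ`, so that flipping changes nothing; or all bits agree, which gives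
`P_F` up to renaming the angles; or the bits alternate as in `Q_F`. The last case forces `2α + β =
2δ + γ = 2π` and `β + γ ≤ π`.

No quadrangle with three equal sides satisfies these relations (`false_of_angle_relations`). Let the
corners be `A, B, C, D`, let `x = cos AB = cos BC = cos CD`, `y = cos AD`, `p = cos AC`, `q = cos
BD`. The two equations become `(q + x)(1 + x) = (p + x)(y + q)` and the same with `p, q` exchanged.
Subtraction gives `p = q`, so the quadrangle is symmetric, and `p = -x` or `y = 1 + x - p`.
Positivity of the triple products gives `p < x`. This makes `y > 1` in the second case; in the first
it contradicts `p ≥ x ^ 2`, which holds because one of `β, γ` is at most `π / 2`. The argument does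
not assume convexity, and it excludes the charts `Q_F` as well.

Two facts about possibly concave tiles come from topology: the inner angles at a vertex add up to
`2π` exactly, not to a higher multiple (`QuadTiling.sum_ccwAngle`), and congruent tiles have equal
inner angles (`SphQuadrangle.Congruent.exists_corner_map`). Both rest on
`SphQuadrangle.exists_sector`: near a corner, the interior of a tile fills the sector of its inner
angle and misses the complementary one. -/

/-! ### Cross products and frames of the tangent planes -/

theorem inner_space3 (x y : Space3) : inner ℝ x y = x 0 * y 0 + x 1 * y 1 + x 2 * y 2 := by
  simp [PiLp.inner_apply, Fin.sum_univ_three]; ring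

@[simp] theorem cross3_zero (u v : Space3) : cross3 u v 0 = u 1 * v 2 - u 2 * v 1 := by
  simp [cross3, cross_apply]

@[simp] theorem cross3_one (u v : Space3) : cross3 u v 1 = u 2 * v 0 - u 0 * v 2 := by
  simp [cross3, cross_apply]

@[simp] theorem cross3_two (u v : Space3) : cross3 u v 2 = u 0 * v 1 - u 1 * v 0 := by
  simp [cross3, cross_apply]

theorem space3_ext {x y : Space3} (h0 : x 0 = y 0) (h1 : x 1 = y 1) (h2 : x 2 = y 2) : x = y := by
  ext i; fin_cases i <;> assumption

theorem Sphere2.inner_self (p : Sphere2) : inner ℝ (p : Space3) (p : Space3) = 1 := by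
  rw [real_inner_self_eq_norm_sq]; simp

/-- An oriented orthonormal frame of the tangent plane at `p`. -/
structure TangentFrame (p : Space3) where
  e : Space3
  f : Space3
  inner_e_e : inner ℝ e e = 1
  inner_f_f : inner ℝ f f = 1
  inner_e_f : inner ℝ e f = 0
  cross_e_f : cross3 e f = p

/-- The complex number whose argument defines `ccwAngle`. -/
def tangentProd (p q r : Space3) : ℂ :=
  ⟨inner ℝ q r - inner ℝ p q * inner ℝ p r, inner ℝ p (cross3 q r)⟩

namespace TangentFrame

variable {p : Space3} (B : TangentFrame p)

/-- The complex coordinate of the tangential part of a vector. -/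
def coord (x : Space3) : ℂ := ⟨inner ℝ B.e x, inner ℝ B.f x⟩

theorem coord_add (x y : Space3) : B.coord (x + y) = B.coord x + B.coord y := by
  apply Complex.ext <;> simp [coord, inner_add_right]

theorem coord_smul (c : ℝ) (x : Space3) : B.coord (c • x) = c * B.coord x := by
  apply Complex.ext <;> simp [coord, inner_smul_right]

theorem coord_base : B.coord p = 0 := by
  obtain ⟨e, f, h1, h2, h3, rfl⟩ := B
  apply Complex.ext <;> simp [coord, inner_space3] <;> ring

theorem cross_e : cross3 p B.e = B.f := by
  obtain ⟨e, f, h1, h2, h3, rfl⟩ := B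
  rw [inner_space3] at h1 h3
  apply space3_ext <;> simp only [cross3_zero, cross3_one, cross3_two]
  · linear_combination h1 * f 0 - h3 * e 0
  · linear_combination h1 * f 1 - h3 * e 1
  · linear_combination h1 * f 2 - h3 * e 2

theorem cross_f : cross3 p B.f = -B.e := by
  obtain ⟨e, f, h1, h2, h3, rfl⟩ := B
  rw [inner_space3] at h2 h3
  apply space3_ext <;> simp only [cross3_zero, cross3_one, cross3_two, PiLp.neg_apply]
  · linear_combination -h2 * e 0 + h3 * f 0
  · linear_combination -h2 * e 1 + h3 * f 1
  · linear_combination -h2 * e 2 + h3 * f 2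

theorem expand (x : Space3) :
    x = inner ℝ p x • p + ((B.coord x).re • B.e + (B.coord x).im • B.f) := by
  obtain ⟨e, f, h1, h2, h3, rfl⟩ := B
  -- Expansion in the basis `e, f, e × f` for arbitrary `e, f`, with denominators cleared by their
  -- Gram determinant; orthonormality enters only afterwards, so that the identity is polynomial.
  have key : (inner ℝ e e * inner ℝ f f - inner ℝ e f ^ 2) • x =
      inner ℝ (cross3 e f) x • cross3 e f +
        ((inner ℝ f f * inner ℝ e x - inner ℝ e f * inner ℝ f x) • e +
          (inner ℝ e e * inner ℝ f x - inner ℝ e f * inner ℝ e x) • f) := by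
    simp only [inner_space3]
    apply space3_ext <;>
      simp only [PiLp.add_apply, PiLp.smul_apply, smul_eq_mul, cross3_zero, cross3_one,
        cross3_two] <;> ring
  rw [h1, h2, h3] at key
  simpa [coord] using key

/-- In the complex coordinate of the tangent plane, the argument of `conj z * w` is the angle from
`z` to `w`; this makes `ccwAngle` a difference of directions. -/
theorem tangentProd_eq (q r : Space3) :
    tangentProd p q r = (starRingEnd ℂ) (B.coord q) * B.coord r := by
  have hq := B.expand q
  have h1 : inner ℝ q r = inner ℝ p q * inner ℝ p r +
      (inner ℝ B.e q * inner ℝ B.e r + inner ℝ B.f q * inner ℝ B.f r) := by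
    conv_lhs => rw [hq]
    simp only [inner_add_left, inner_smul_left, coord]
    simp
  have h2 : inner ℝ p (cross3 q r) =
      inner ℝ B.e q * inner ℝ B.f r - inner ℝ B.f q * inner ℝ B.e r := by
    obtain ⟨e, f, h1, h2, h3, rfl⟩ := B
    simp only [inner_space3, cross3_zero, cross3_one, cross3_two]
    ring
  apply Complex.ext
  · simp [tangentProd, coord, h1]
  · simp [tangentProd, coord, h2]; ring

theorem normSq_coord (x : Space3) :
    Complex.normSq (B.coord x) = inner ℝ x x - inner ℝ p x ^ 2 := by
  have h := congrArg Complex.re (B.tangentProd_eq x x)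
  simp only [tangentProd, Complex.mul_re, Complex.conj_re, Complex.conj_im] at h
  rw [Complex.normSq_apply]; linarith

theorem coord_e : B.coord B.e = 1 := by
  apply Complex.ext <;> simp only [coord, Complex.one_re, Complex.one_im]
  · exact B.inner_e_e
  · rw [real_inner_comm]; exact B.inner_e_f

theorem coord_f : B.coord B.f = Complex.I := by
  apply Complex.ext <;> simp only [coord, Complex.I_re, Complex.I_im]
  · exact B.inner_e_f
  · exact B.inner_f_f

theorem inner_base_e : inner ℝ p B.e = 0 := by
  have := congrArg Complex.re B.coord_base
  rw [real_inner_comm]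
  simpa [coord] using this

theorem inner_base_f : inner ℝ p B.f = 0 := by
  have := congrArg Complex.im B.coord_base
  rw [real_inner_comm]
  simpa [coord] using this

end TangentFrame

theorem cross3_add_right (u v w : Space3) : cross3 u (v + w) = cross3 u v + cross3 u w := by
  apply space3_ext <;> simp <;> ring

theorem cross3_smul_right (c : ℝ) (u v : Space3) : cross3 u (c • v) = c • cross3 u v := by
  apply space3_ext <;> simp <;> ring

theorem cross3_self (u : Space3) : cross3 u u = 0 := by
  apply space3_ext <;> simp <;> ring

theorem exists_tangentFrame {p : Space3} (hp : inner ℝ p p = 1) : Nonempty (TangentFrame p) := by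
  obtain ⟨w, hw, hw0⟩ : ∃ w : Space3, inner ℝ p w = 0 ∧ w ≠ 0 := by
    by_cases h : p 0 = 0
    · refine ⟨!₂[1, 0, 0], by simp [inner_space3, h], fun h0 => ?_⟩
      simpa using congrArg (fun v : Space3 => v 0) h0
    · refine ⟨!₂[-p 1, p 0, 0], by simp [inner_space3]; ring, fun h0 => h ?_⟩
      simpa using congrArg (fun v : Space3 => v 1) h0
  set e : Space3 := ‖w‖⁻¹ • w with he
  have hee : inner ℝ e e = 1 := by
    rw [he, inner_smul_left, inner_smul_right, real_inner_self_eq_norm_sq]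
    simp; field_simp
  have hpe : inner ℝ p e = 0 := by rw [he, inner_smul_right, hw, mul_zero]
  refine ⟨⟨e, cross3 p e, hee, ?_, ?_, ?_⟩⟩
  · simp only [inner_space3, cross3_zero, cross3_one, cross3_two] at *
    linear_combination hp * (e 0 * e 0 + e 1 * e 1 + e 2 * e 2) + hee -
      hpe * (p 0 * e 0 + p 1 * e 1 + p 2 * e 2)
  · simp only [inner_space3, cross3_zero, cross3_one, cross3_two]; ring
  · simp only [inner_space3] at hee hpe
    apply space3_ext <;> simp only [cross3_zero, cross3_one, cross3_two]
    · linear_combination hee * p 0 - hpe * e 0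
    · linear_combination hee * p 1 - hpe * e 1
    · linear_combination hee * p 2 - hpe * e 2

/-! ### Arguments in `[0, 2π)` and oriented angles -/

theorem tangentProd_swap (p q r : Space3) :
    tangentProd p r q = (starRingEnd ℂ) (tangentProd p q r) := by
  apply Complex.ext
  · simp [tangentProd, real_inner_comm]; ring
  · simp [tangentProd, inner_space3]; ring

/-- The argument, normalised to `[0, 2π)`. -/
def posArg (z : ℂ) : ℝ := if 0 ≤ z.arg then z.arg else z.arg + 2 * Real.pi

theorem ccwAngle_eq (p q r : Sphere2) : ccwAngle p q r = posArg (tangentProd p q r) := rfl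

theorem posArg_nonneg (z : ℂ) : 0 ≤ posArg z := by
  unfold posArg
  have := Complex.neg_pi_lt_arg z
  have := Real.pi_pos
  split_ifs <;> linarith

theorem posArg_lt (z : ℂ) : posArg z < 2 * Real.pi := by
  unfold posArg
  have := Complex.arg_le_pi z
  have := Real.pi_pos
  split_ifs <;> linarith

theorem norm_mul_exp_posArg (z : ℂ) : (‖z‖ : ℂ) * Complex.exp (posArg z * Complex.I) = z := by
  have h : Complex.exp (posArg z * Complex.I) = Complex.exp (z.arg * Complex.I) := by
    unfold posArg
    split_ifs
    · rfl
    · rw [Complex.exp_eq_exp_iff_exists_int]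
      exact ⟨1, by push_cast; ring⟩
  rw [h, Complex.norm_mul_exp_arg_mul_I]

theorem eq_of_exp_eq {x y : ℝ}
    (h : Complex.exp (x * Complex.I) = Complex.exp (y * Complex.I)) (h1 : x < y + 2 * Real.pi)
    (h2 : y < x + 2 * Real.pi) : x = y := by
  rw [Complex.exp_eq_exp_iff_exists_int] at h
  obtain ⟨n, hn⟩ := h
  have hn' : x = y + n * (2 * Real.pi) := by
    have := congrArg Complex.im hn
    simpa using this
  have h3 : (n : ℝ) < 1 := by nlinarith
  have h4 : (-1 : ℝ) < n := by nlinarith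
  have h5 : n < 1 := by exact_mod_cast h3
  have h6 : -1 < n := by exact_mod_cast h4
  obtain rfl : n = 0 := by omega
  simpa using hn'

theorem exp_eq_of_mul_exp_eq {a b : ℝ} {x y : ℝ} (ha : 0 < a) (hb : 0 < b)
    (h : (a : ℂ) * Complex.exp (x * Complex.I) = b * Complex.exp (y * Complex.I)) :
    a = b ∧ Complex.exp (x * Complex.I) = Complex.exp (y * Complex.I) := by
  have hab : a = b := by
    have := congrArg norm h
    simpa [Complex.norm_exp_ofReal_mul_I, abs_of_pos ha, abs_of_pos hb] using this
  refine ⟨hab, ?_⟩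
  subst hab
  exact mul_left_cancel₀ (by exact_mod_cast ha.ne') h

theorem posArg_mul_exp {a θ : ℝ} (ha : 0 < a) (h0 : 0 ≤ θ) (h1 : θ < 2 * Real.pi) :
    posArg (a * Complex.exp (θ * Complex.I)) = θ := by
  set z := (a : ℂ) * Complex.exp (θ * Complex.I) with hz
  have hz0 : 0 < ‖z‖ := by simp [hz, Complex.norm_exp_ofReal_mul_I, ha.ne']
  have h := (exp_eq_of_mul_exp_eq hz0 ha (norm_mul_exp_posArg z)).2
  have := posArg_lt z
  have := posArg_nonneg z
  exact eq_of_exp_eq h (by linarith) (by linarith)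

theorem TangentFrame.coord_ne_zero {p q : Sphere2} (B : TangentFrame (p : Space3)) (h : q ≠ p)
    (h' : (q : Space3) ≠ -p) : B.coord q ≠ 0 := by
  intro h0
  have hx := B.expand q
  rw [h0] at hx
  simp only [Complex.zero_re, Complex.zero_im, zero_smul, add_zero] at hx
  have hn := B.normSq_coord q
  rw [h0, Sphere2.inner_self] at hn
  simp only [map_zero] at hn
  have : inner ℝ (p : Space3) (q : Space3) = 1 ∨ inner ℝ (p : Space3) (q : Space3) = -1 :=
    sq_eq_one_iff.mp (by linarith)
  rcases this with h1 | h1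
  · rw [h1, one_smul] at hx
    exact h (Subtype.ext hx)
  · rw [h1, neg_one_smul] at hx
    exact h' hx

/-- The direction of the third point from those of the second point and the angle. -/
theorem TangentFrame.coord_of_ccwAngle {p q r : Sphere2} (B : TangentFrame (p : Space3))
    {ρ φ : ℝ} (hρ : 0 < ρ) (hq : B.coord q = ρ * Complex.exp (φ * Complex.I)) :
    B.coord r = ‖B.coord r‖ * Complex.exp ((φ + ccwAngle p q r : ℝ) * Complex.I) := by
  have h := norm_mul_exp_posArg (tangentProd p q r)
  rw [← ccwAngle_eq, B.tangentProd_eq, hq] at h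
  have hn : ‖(starRingEnd ℂ) ((ρ : ℂ) * Complex.exp (φ * Complex.I)) * B.coord r‖ =
      ρ * ‖B.coord r‖ := by
    rw [norm_mul, RCLike.norm_conj, norm_mul, Complex.norm_exp_ofReal_mul_I, Complex.norm_real,
      Real.norm_of_nonneg hρ.le, mul_one]
  rw [hn] at h
  simp only [map_mul, Complex.conj_ofReal, ← Complex.exp_conj, Complex.conj_I] at h
  have h1 : Complex.exp ((φ + ccwAngle p q r : ℝ) * Complex.I) =
      Complex.exp (φ * Complex.I) * Complex.exp (ccwAngle p q r * Complex.I) := by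
    rw [← Complex.exp_add]; push_cast; ring_nf
  have h2 : Complex.exp (φ * -Complex.I) * Complex.exp (φ * Complex.I) = 1 := by
    rw [← Complex.exp_add]; simp
  have hρ' : (ρ : ℂ) ≠ 0 := by exact_mod_cast hρ.ne'
  rw [h1]
  apply mul_left_cancel₀ hρ'
  push_cast at h
  linear_combination -(Complex.exp (φ * Complex.I)) * h - ρ * B.coord r * h2

/-- Converse of `coord_of_ccwAngle`: a difference of directions determines the angle once it is
known to lie in `[0, 2π)`. -/
theorem TangentFrame.ccwAngle_of_coord {p q r : Sphere2} (B : TangentFrame (p : Space3))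
    {ρ φ ρ' θ : ℝ} (hρ : 0 < ρ) (hq : B.coord q = ρ * Complex.exp (φ * Complex.I))
    (hρ' : 0 < ρ') (hr : B.coord r = ρ' * Complex.exp ((φ + θ : ℝ) * Complex.I))
    (h0 : 0 ≤ θ) (h1 : θ < 2 * Real.pi) : ccwAngle p q r = θ := by
  rw [ccwAngle_eq, ← posArg_mul_exp (mul_pos hρ hρ') h0 h1, B.tangentProd_eq, hq, hr]
  congr 1
  simp only [map_mul, Complex.conj_ofReal, ← Complex.exp_conj, Complex.conj_I]
  have : Complex.exp ((φ + θ : ℝ) * Complex.I) =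
      Complex.exp (φ * Complex.I) * Complex.exp (θ * Complex.I) := by
    rw [← Complex.exp_add]; push_cast; ring_nf
  rw [this]
  have h2 : Complex.exp (φ * -Complex.I) * Complex.exp (φ * Complex.I) = 1 := by
    rw [← Complex.exp_add]; simp
  push_cast
  linear_combination (ρ * ρ' * Complex.exp (θ * Complex.I) : ℂ) * h2

/-! ### Great-circle arcs -/

theorem sphArc_symm (p q : Sphere2) : sphArc p q = sphArc q p := by
  ext x
  constructor <;> rintro ⟨s, t, hs, ht, h⟩ <;> exact ⟨t, s, ht, hs, by rw [h, add_comm]⟩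

theorem left_mem_sphArc (p q : Sphere2) : p ∈ sphArc p q := ⟨1, 0, by simp, le_rfl, by simp⟩

theorem cross3_ne_zero {p q : Sphere2} (h : q ≠ p) (h' : (q : Space3) ≠ -p) :
    cross3 p q ≠ 0 := by
  intro h0
  obtain ⟨B⟩ := exists_tangentFrame p.inner_self
  have hx := B.coord_ne_zero h h'
  have h2 := B.normSq_coord q
  have h3 : inner ℝ (cross3 p q) (cross3 p q) =
      inner ℝ (p : Space3) (p : Space3) * inner ℝ (q : Space3) (q : Space3) -
        inner ℝ (p : Space3) (q : Space3) ^ 2 := by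
    simp only [inner_space3, cross3_zero, cross3_one, cross3_two]; ring
  rw [h0, inner_zero_left, p.inner_self, one_mul, ← h2] at h3
  exact hx (Complex.normSq_eq_zero.mp h3.symm)

theorem continuous_inner_sphere (v : Space3) :
    Continuous fun x : Sphere2 => inner ℝ v (x : Space3) :=
  continuous_const.inner continuous_subtype_val

/-- With `n = p × q`, the arc is cut out of the great circle orthogonal to `n` by two closed
half-spaces, since by Cramer's rule the coefficients of `p` and `q` are linear functions of the
point. -/
theorem isClosed_sphArc {p q : Sphere2} (h : q ≠ p) (h' : (q : Space3) ≠ -p) :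
    IsClosed (sphArc p q) := by
  set n := cross3 p q with hn
  have hn0 : 0 < inner ℝ n n := real_inner_self_pos.mpr (cross3_ne_zero h h')
  have key : ∀ x : Space3, inner ℝ n n • x = inner ℝ (cross3 q n) x • (p : Space3) +
      inner ℝ (cross3 n p) x • (q : Space3) + inner ℝ n x • n := by
    intro x
    simp only [inner_space3, hn]
    apply space3_ext <;>
      simp only [PiLp.add_apply, PiLp.smul_apply, smul_eq_mul, cross3_zero, cross3_one,
        cross3_two] <;> ring
  have : sphArc p q = {x : Sphere2 | inner ℝ n (x : Space3) = 0} ∩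
      {x : Sphere2 | 0 ≤ inner ℝ (cross3 q n) (x : Space3)} ∩
      {x : Sphere2 | 0 ≤ inner ℝ (cross3 n p) (x : Space3)} := by
    ext x
    constructor
    · rintro ⟨s, t, hs, ht, hx⟩
      have e1 : inner ℝ n (x : Space3) = 0 := by
        simp only [hx, hn, inner_space3, cross3_zero, cross3_one, cross3_two, PiLp.add_apply,
          PiLp.smul_apply, smul_eq_mul]
        ring
      have e2 : inner ℝ (cross3 q n) (x : Space3) = s * inner ℝ n n := by
        simp only [hx, hn, inner_space3, cross3_zero, cross3_one, cross3_two, PiLp.add_apply,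
          PiLp.smul_apply, smul_eq_mul]
        ring
      have e3 : inner ℝ (cross3 n p) (x : Space3) = t * inner ℝ n n := by
        simp only [hx, hn, inner_space3, cross3_zero, cross3_one, cross3_two, PiLp.add_apply,
          PiLp.smul_apply, smul_eq_mul]
        ring
      refine ⟨⟨e1, ?_⟩, ?_⟩
      · rw [Set.mem_ofPred_eq, e2]; positivity
      · rw [Set.mem_ofPred_eq, e3]; positivity
    · rintro ⟨⟨e1, e2⟩, e3⟩
      simp only [Set.mem_ofPred_eq] at e1 e2 e3
      refine ⟨inner ℝ (cross3 q n) (x : Space3) / inner ℝ n n,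
        inner ℝ (cross3 n p) (x : Space3) / inner ℝ n n, by positivity, by positivity, ?_⟩
      have hk := key x
      rw [e1, zero_smul, add_zero] at hk
      have h2 := congrArg (fun v => (inner ℝ n n)⁻¹ • v) hk
      simp only [smul_smul, smul_add, inv_mul_cancel₀ hn0.ne', one_smul] at h2
      rwa [← div_eq_inv_mul, ← div_eq_inv_mul] at h2
  rw [this]
  exact ((isClosed_eq (continuous_inner_sphere _) continuous_const).inter
    (isClosed_le continuous_const (continuous_inner_sphere _))).inter
    (isClosed_le continuous_const (continuous_inner_sphere _))

/-! ### Polar coordinates around a point of the sphere -/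

/-- The point at distance `r` from `p` in direction `φ`. -/
def TangentFrame.polarPoint {p : Sphere2} (B : TangentFrame (p : Space3)) (r φ : ℝ) : Sphere2 :=
  ⟨Real.cos r • (p : Space3) + Real.sin r • (Real.cos φ • B.e + Real.sin φ • B.f), by
    have hpe := B.inner_base_e
    have hpf := B.inner_base_f
    have hep := hpe
    have hfp := hpf
    have hfe := B.inner_e_f
    rw [real_inner_comm] at hep hfp hfe
    have h : inner ℝ (Real.cos r • (p : Space3) + Real.sin r • (Real.cos φ • B.e + Real.sin φ • B.f))
        (Real.cos r • (p : Space3) + Real.sin r • (Real.cos φ • B.e + Real.sin φ • B.f)) =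
        (1 : ℝ) := by
      simp only [inner_add_left, inner_add_right, real_inner_smul_left, real_inner_smul_right, hpe, hpf,
        hep, hfp, hfe, B.inner_e_f, B.inner_e_e, B.inner_f_f, p.inner_self]
      have h1 := Real.sin_sq_add_cos_sq r
      have h2 := Real.sin_sq_add_cos_sq φ
      linear_combination h1 + Real.sin r ^ 2 * h2
    rw [real_inner_self_eq_norm_sq] at h
    rw [mem_sphere_zero_iff_norm]
    nlinarith [norm_nonneg (Real.cos r • (p : Space3) +
      Real.sin r • (Real.cos φ • B.e + Real.sin φ • B.f))]⟩

namespace TangentFrame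

variable {p : Sphere2} (B : TangentFrame (p : Space3))

theorem coe_polarPoint (r φ : ℝ) : (B.polarPoint r φ : Space3) =
    Real.cos r • (p : Space3) + Real.sin r • (Real.cos φ • B.e + Real.sin φ • B.f) := rfl

theorem coord_polarPoint (r φ : ℝ) :
    B.coord (B.polarPoint r φ) = Real.sin r * Complex.exp (φ * Complex.I) := by
  rw [coe_polarPoint, coord_add, coord_smul, coord_smul, coord_add, coord_smul, coord_smul,
    B.coord_base, B.coord_e, B.coord_f, Complex.exp_mul_I]
  push_cast; ring

theorem inner_polarPoint (r φ : ℝ) : inner ℝ (p : Space3) (B.polarPoint r φ) = Real.cos r := by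
  rw [coe_polarPoint]
  simp only [inner_add_right, real_inner_smul_right, B.inner_base_e, B.inner_base_f, p.inner_self]
  ring

theorem eq_polarPoint {x : Sphere2} {r φ : ℝ} (h : inner ℝ (p : Space3) x = Real.cos r)
    (h' : B.coord x = Real.sin r * Complex.exp (φ * Complex.I)) : x = B.polarPoint r φ := by
  apply Subtype.ext
  rw [B.expand x, B.expand (B.polarPoint r φ), h, h', B.inner_polarPoint, B.coord_polarPoint]

theorem continuous_polarPoint : Continuous fun y : ℝ × ℝ => B.polarPoint y.1 y.2 := by
  unfold polarPoint
  fun_prop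

theorem dist_polarPoint_le (r φ : ℝ) (hr : 0 ≤ r) : dist (B.polarPoint r φ) p ≤ r := by
  rw [Subtype.dist_eq, dist_eq_norm]
  apply abs_le_of_sq_le_sq' _ hr |>.2
  rw [← real_inner_self_eq_norm_sq, inner_sub_left, inner_sub_right, inner_sub_right,
    Sphere2.inner_self, Sphere2.inner_self, real_inner_comm, B.inner_polarPoint]
  -- The squared chord is `2 - 2 cos r`, which is at most `r ^ 2`.
  have := Real.one_sub_sq_div_two_le_cos (x := r)
  linarith

theorem polarPoint_congr (r : ℝ) {φ ψ : ℝ}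
    (h : Complex.exp (φ * Complex.I) = Complex.exp (ψ * Complex.I)) :
    B.polarPoint r φ = B.polarPoint r ψ :=
  B.eq_polarPoint (B.inner_polarPoint r φ) (by rw [coord_polarPoint, h])

/-- Every point has polar coordinates. -/
theorem exists_polarPoint (x : Sphere2) (φ₀ : ℝ) :
    ∃ φ, φ₀ ≤ φ ∧ φ < φ₀ + 2 * Real.pi ∧
      x = B.polarPoint (Real.arccos (inner ℝ (p : Space3) x)) φ := by
  have hpi : 0 < 2 * Real.pi := by positivity
  refine ⟨toIcoMod hpi φ₀ (B.coord x).arg, left_le_toIcoMod _ _ _, toIcoMod_lt_right _ _ _, ?_⟩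
  have hab := abs_real_inner_le_norm (p : Space3) (x : Space3)
  simp only [norm_eq_of_mem_sphere, mul_one, abs_le] at hab
  apply B.eq_polarPoint (Real.cos_arccos hab.1 hab.2).symm
  rw [Real.sin_arccos]
  have hn := B.normSq_coord x
  rw [Sphere2.inner_self, ← Complex.sq_norm] at hn
  rw [← hn, Real.sqrt_sq (norm_nonneg _)]
  conv_lhs => rw [← Complex.norm_mul_exp_arg_mul_I (B.coord x)]
  congr 1
  rw [Complex.exp_eq_exp_iff_exists_int]
  refine ⟨toIcoDiv hpi φ₀ (B.coord x).arg, ?_⟩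
  have := congrArg (fun y : ℝ => (y : ℂ)) (toIcoMod_add_toIcoDiv_zsmul hpi φ₀ (B.coord x).arg)
  simp only [zsmul_eq_mul] at this
  push_cast at this
  linear_combination -Complex.I * this

/-- A point on the arc from `p` to `q` other than `p` has the direction of `q`. -/
theorem exp_eq_of_mem_sphArc {q : Sphere2} {ρ φ r ψ : ℝ} (hρ : 0 < ρ)
    (hq : B.coord q = ρ * Complex.exp (φ * Complex.I)) (hr : 0 < r) (hr' : r < Real.pi)
    (h : B.polarPoint r ψ ∈ sphArc p q) :
    Complex.exp (ψ * Complex.I) = Complex.exp (φ * Complex.I) := by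
  obtain ⟨s, t, hs, ht, hx⟩ := h
  have h1 := congrArg B.coord hx
  rw [coord_polarPoint, coord_add, coord_smul, coord_smul, B.coord_base, hq, mul_zero, zero_add,
    ← mul_assoc] at h1
  have hsin := Real.sin_pos_of_pos_of_lt_pi hr hr'
  rcases ht.eq_or_lt with rfl | ht
  · simp at h1
    norm_cast at h1
    exact absurd h1 hsin.ne'
  · exact (exp_eq_of_mul_exp_eq hsin (mul_pos ht hρ) (by push_cast; exact_mod_cast h1)).2

/-- The points near `p` in the direction of `q` are on the arc from `p` to `q`. -/
theorem eventually_mem_sphArc {q : Sphere2} {ρ φ : ℝ} (hρ : 0 < ρ)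
    (hq : B.coord q = ρ * Complex.exp (φ * Complex.I)) :
    ∀ᶠ r : ℝ in 𝓝[>] 0, B.polarPoint r φ ∈ sphArc p q := by
  -- Writing the polar point as a combination of `p` and `q`, the coefficient of `q` is `sin r / ρ`
  -- and that of `p` is the quantity below, equal to `1` at `r = 0`.
  have h1 : ∀ᶠ r : ℝ in 𝓝 0, 0 < Real.cos r - Real.sin r / ρ * inner ℝ (p : Space3) (q : Space3) := by
    have hc : Continuous fun r : ℝ =>
        Real.cos r - Real.sin r / ρ * inner ℝ (p : Space3) (q : Space3) := by fun_prop
    apply hc.continuousAt.eventually (lt_mem_nhds ?_)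
    simp
  have h2 : ∀ᶠ r : ℝ in 𝓝[>] 0, r ∈ Set.Ioo 0 Real.pi := Ioo_mem_nhdsGT Real.pi_pos
  filter_upwards [h1.filter_mono nhdsWithin_le_nhds, h2] with r hr hr2
  refine ⟨_, Real.sin r / ρ, hr.le, div_nonneg (Real.sin_pos_of_pos_of_lt_pi hr2.1 hr2.2).le hρ.le, ?_⟩
  have e := B.expand q
  have hre : (B.coord q).re = ρ * Real.cos φ := by rw [hq]; simp [Complex.exp_ofReal_mul_I_re]
  have him : (B.coord q).im = ρ * Real.sin φ := by rw [hq]; simp [Complex.exp_ofReal_mul_I_im]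
  rw [hre, him] at e
  rw [coe_polarPoint]
  generalize inner ℝ (p : Space3) (q : Space3) = c at *
  rw [e]
  match_scalars
  · ring
  · field_simp
  · field_simp

end TangentFrame

/-- Off its frontier, the space is the union of two disjoint open sets, the interior of `R` and the
complement of `R`. -/
theorem IsPreconnected.subset_interior_of_disjoint_frontier {X : Type*} [TopologicalSpace X]
    {s R : Set X} (hs : IsPreconnected s) (hR : IsClosed R) (h : Disjoint s (frontier R))
    (hi : (s ∩ interior R).Nonempty) : s ⊆ interior R := by
  refine IsPreconnected.subset_left_of_subset_union isOpen_interior hR.isOpen_compl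
    (Set.disjoint_left.mpr fun x hx hx' => hx' (interior_subset hx)) (fun x hx => ?_) hi hs
  by_cases hxR : x ∈ R
  · left
    by_contra hxi
    exact Set.disjoint_left.mp h hx (by rw [hR.frontier_eq]; exact ⟨hxR, hxi⟩)
  · exact Or.inr hxR

namespace TangentFrame

variable {p : Sphere2} (B : TangentFrame (p : Space3))

theorem eq_polarPoint_arccos {x : Sphere2} {φ : ℝ}
    (h : B.coord x = ‖B.coord x‖ * Complex.exp (φ * Complex.I)) :
    x = B.polarPoint (Real.arccos (inner ℝ (p : Space3) x)) φ := by
  have hab := abs_real_inner_le_norm (p : Space3) (x : Space3)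
  simp only [norm_eq_of_mem_sphere, mul_one, abs_le] at hab
  apply B.eq_polarPoint (Real.cos_arccos hab.1 hab.2).symm
  rw [Real.sin_arccos]
  have hn := B.normSq_coord x
  rw [Sphere2.inner_self, ← Complex.sq_norm] at hn
  rwa [← hn, Real.sqrt_sq (norm_nonneg _)]

theorem continuous_polarPoint_right (r : ℝ) : Continuous fun φ : ℝ => B.polarPoint r φ := by
  unfold polarPoint
  fun_prop

/-- Taking the cross product with `p` is a quarter turn in the tangent plane; this is how the
leftward displacement in `SphQuadrangle.interior_left` becomes a change of direction. -/
theorem coord_cross (q : Space3) : B.coord (cross3 p q) = Complex.I * B.coord q := by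
  rw [B.expand q, cross3_add_right, cross3_add_right, cross3_smul_right, cross3_smul_right,
    cross3_smul_right, cross3_self, B.cross_e, B.cross_f]
  simp only [coord_add, coord_smul, B.coord_base, B.coord_e, B.coord_f, ← neg_one_smul ℝ B.e]
  push_cast
  simp only [zero_add, mul_zero]
  rw [show B.coord 0 = 0 by simpa using B.coord_smul 0 0]
  linear_combination (-(B.coord q).im : ℂ) * Complex.I_sq

end TangentFrame

/-! ### The shape of a quadrangle near a corner -/

namespace SphQuadrangle

variable (Q : SphQuadrangle) (k : Fin 4)

theorem isClosed_region : IsClosed Q.region := by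
  rw [← Q.closure_interior]; exact isClosed_closure

theorem corner_next_ne : Q.corner (k + 1) ≠ Q.corner k := by
  intro h
  exact ((by decide : ∀ j : Fin 4, j + 1 ≠ j) k) (Q.corner_injective h)

theorem corner_prev_ne : Q.corner (k - 1) ≠ Q.corner k := by
  intro h
  exact ((by decide : ∀ j : Fin 4, j - 1 ≠ j) k) (Q.corner_injective h)

theorem prev_not_antipodal : (Q.corner (k - 1) : Space3) ≠ -(Q.corner k : Space3) := by
  have := Q.not_antipodal (k - 1)
  rw [sub_add_cancel] at this
  intro h
  exact this (by rw [h, neg_neg])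

theorem isClosed_edge : IsClosed (Q.edge k) :=
  isClosed_sphArc (Q.corner_next_ne k) (Q.not_antipodal k)

theorem frontier_eq_edges : frontier Q.region =
    (Q.edge k ∪ sphArc (Q.corner k) (Q.corner (k - 1))) ∪ (Q.edge (k + 1) ∪ Q.edge (k + 2)) := by
  rw [Q.frontier_eq, sphArc_symm (Q.corner k)]
  have h : sphArc (Q.corner (k - 1)) (Q.corner k) = Q.edge (k - 1) := by
    rw [edge, sub_add_cancel]
  rw [h]
  have hall : ∀ j : Fin 4, j = k ∨ j = k - 1 ∨ j = k + 1 ∨ j = k + 2 := by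
    clear h; revert k; decide
  ext x
  simp only [Set.mem_iUnion, Set.mem_union]
  constructor
  · rintro ⟨j, hj⟩
    change x ∈ Q.edge j at hj
    rcases hall j with rfl | rfl | rfl | rfl <;> tauto
  · rintro ((h | h) | (h | h)) <;> exact ⟨_, h⟩

theorem corner_notMem_far_edges : Q.corner k ∉ Q.edge (k + 1) ∪ Q.edge (k + 2) := by
  rintro (h | h)
  · have h1 : Q.corner k ∈ sphArc (Q.corner k) (Q.corner (k + 1)) ∩
        sphArc (Q.corner (k + 1)) (Q.corner (k + 2)) :=
      ⟨left_mem_sphArc _ _, by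
        have e := (by decide : ∀ j : Fin 4, j + 2 = j + 1 + 1) k
        rw [e]; exact h⟩
    rw [Q.edge_inter_next k] at h1
    exact Q.corner_next_ne k (Set.mem_singleton_iff.mp h1).symm
  · refine Set.disjoint_left.mp (Q.edge_inter_opposite k) (left_mem_sphArc _ _) ?_
    have e := (by decide : ∀ j : Fin 4, j + 3 = j + 2 + 1) k
    rw [e]; exact h

theorem corner_mem_frontier : Q.corner k ∈ frontier Q.region := by
  rw [Q.frontier_eq]
  exact Set.mem_iUnion.mpr ⟨k, left_mem_sphArc _ _⟩

variable {Q k} (B : TangentFrame (Q.corner k : Space3)) {ρ φ : ℝ}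

theorem coord_prev (hρ : 0 < ρ)
    (hq : B.coord (Q.corner (k + 1)) = ρ * Complex.exp (φ * Complex.I)) :
    ∃ ρ' : ℝ, 0 < ρ' ∧ B.coord (Q.corner (k - 1)) =
      ρ' * Complex.exp ((φ + Q.innerAngle k : ℝ) * Complex.I) :=
  ⟨_, norm_pos_iff.mpr (B.coord_ne_zero (Q.corner_prev_ne k) (Q.prev_not_antipodal k)),
    B.coord_of_ccwAngle hρ hq⟩

theorem coord_next : ∃ ρ φ : ℝ, 0 < ρ ∧
    B.coord (Q.corner (k + 1)) = ρ * Complex.exp (φ * Complex.I) :=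
  ⟨_, _, norm_pos_iff.mpr (B.coord_ne_zero (Q.corner_next_ne k) (Q.not_antipodal k)),
    (Complex.norm_mul_exp_arg_mul_I _).symm⟩

/-- The two edges away from the corner form a closed set that misses it, so close to the corner the
frontier consists only of points in the directions of the two adjacent edges. -/
theorem exists_radius (hρ : 0 < ρ)
    (hq : B.coord (Q.corner (k + 1)) = ρ * Complex.exp (φ * Complex.I)) :
    ∃ r₀ : ℝ, 0 < r₀ ∧ r₀ < Real.pi ∧ ∀ r ψ, 0 < r → r < r₀ →
      B.polarPoint r ψ ∈ frontier Q.region →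
      Complex.exp (ψ * Complex.I) = Complex.exp (φ * Complex.I) ∨
      Complex.exp (ψ * Complex.I) = Complex.exp ((φ + Q.innerAngle k : ℝ) * Complex.I) := by
  have hclosed : IsClosed (Q.edge (k + 1) ∪ Q.edge (k + 2)) :=
    (Q.isClosed_edge _).union (Q.isClosed_edge _)
  obtain ⟨δ, hδ, hball⟩ := Metric.isOpen_iff.mp hclosed.isOpen_compl _ (Q.corner_notMem_far_edges k)
  obtain ⟨ρ', hρ', hw⟩ := coord_prev B hρ hq
  -- The bound `3 < π` keeps `sin r` positive, so that a polar point determines its direction.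
  refine ⟨min δ 3, by positivity, (min_le_right _ _).trans_lt Real.pi_gt_three,
    fun r ψ hr hr' h => ?_⟩
  have hrpi : r < Real.pi := hr'.trans ((min_le_right _ _).trans_lt Real.pi_gt_three)
  have hfar : B.polarPoint r ψ ∉ Q.edge (k + 1) ∪ Q.edge (k + 2) :=
    hball (Metric.mem_ball.mpr
      ((B.dist_polarPoint_le r ψ hr.le).trans_lt (hr'.trans_le (min_le_left _ _))))
  rw [Q.frontier_eq_edges k] at h
  rcases h with (h | h) | h
  · exact Or.inl (B.exp_eq_of_mem_sphArc hρ hq hr hrpi h)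
  · exact Or.inr (B.exp_eq_of_mem_sphArc hρ' hw hr hrpi h)
  · exact absurd h hfar

theorem innerAngle_nonneg (Q : SphQuadrangle) (k : Fin 4) : 0 ≤ Q.innerAngle k :=
  posArg_nonneg _

theorem innerAngle_lt (Q : SphQuadrangle) (k : Fin 4) : Q.innerAngle k < 2 * Real.pi :=
  posArg_lt _

/-- For angle zero the two adjacent edges would leave the corner in the same direction and share
further points, whereas they meet only at the corner. -/
theorem innerAngle_pos (Q : SphQuadrangle) (k : Fin 4) : 0 < Q.innerAngle k := by
  refine lt_of_le_of_ne (Q.innerAngle_nonneg k) fun h0 => ?_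
  obtain ⟨B⟩ := exists_tangentFrame (Q.corner k).inner_self
  obtain ⟨ρ, φ, hρ, hq⟩ := coord_next B
  obtain ⟨ρ', hρ', hw⟩ := coord_prev B hρ hq
  rw [← h0, add_zero] at hw
  have h2 : ∀ᶠ r : ℝ in 𝓝[>] 0, r ∈ Set.Ioo 0 Real.pi := Ioo_mem_nhdsGT Real.pi_pos
  obtain ⟨r, h3, h4, hr, hr'⟩ :=
    ((B.eventually_mem_sphArc hρ hq).and ((B.eventually_mem_sphArc hρ' hw).and h2)).exists
  have h5 := Q.edge_inter_next (k - 1)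
  rw [sub_add_cancel, ((by decide : ∀ j : Fin 4, j - 1 + 2 = j + 1) k)] at h5
  have h6 : B.polarPoint r φ ∈ ({Q.corner k} : Set Sphere2) := by
    rw [← h5]
    exact ⟨by rwa [sphArc_symm], h3⟩
  have h7 := B.coord_polarPoint r φ
  rw [Set.mem_singleton_iff.mp h6, B.coord_base] at h7
  have := Real.sin_pos_of_pos_of_lt_pi hr hr'
  simp at h7
  norm_cast at h7
  exact this.ne' h7

/-- The vector `p + t q + ε (p × q)` has tangential coordinate `(t + ε i)` times that of `q`, hence
direction `φ + arg (t + ε i)`. A small `t` brings it within distance `r₀` of `p`, and then a small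
`ε` makes the added angle less than `θ`. -/
theorem exists_polarPoint_mem_interior {p q : Sphere2} (B : TangentFrame (p : Space3))
    (hp : Q.corner k = p) (hqc : Q.corner (k + 1) = q) (hρ : 0 < ρ)
    (hq : B.coord q = ρ * Complex.exp (φ * Complex.I)) {r₀ θ : ℝ} (hr₀ : 0 < r₀)
    (hr₀' : r₀ < Real.pi) (hθ : 0 < θ) :
    ∃ r ψ, 0 < r ∧ r < r₀ ∧ φ < ψ ∧ ψ < φ + θ ∧ B.polarPoint r ψ ∈ interior Q.region := by
  have hleft := Q.interior_left k
  rw [hp, hqc] at hleft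
  let V : ℝ → ℝ → Space3 := fun t ε => (1 : ℝ) • (p : Space3) + t • (q : Space3) + ε • cross3 p q
  -- Positivity of `h t ε` says that the normalised vector is at distance less than `r₀` from `p`.
  let h : ℝ → ℝ → ℝ := fun t ε => inner ℝ (p : Space3) (V t ε) - Real.cos r₀ * ‖V t ε‖
  have hcos : Real.cos r₀ < 1 := by
    rw [← Real.cos_zero]
    exact Real.cos_lt_cos_of_nonneg_of_le_pi le_rfl hr₀'.le hr₀
  have h1 : ∀ᶠ t : ℝ in 𝓝 0, 0 < h t 0 := by
    have hc : Continuous fun t => h t 0 := by fun_prop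
    apply hc.continuousAt.eventually (lt_mem_nhds ?_)
    simp [h, V, hcos]
  have h1' : ∀ᶠ t : ℝ in 𝓝[>] 0, 0 < t := eventually_mem_nhdsWithin
  obtain ⟨t, ht1, ht⟩ := ((h1.filter_mono nhdsWithin_le_nhds).and h1').exists
  have h2 : ∀ᶠ ε : ℝ in 𝓝 0, 0 < h t ε := by
    have hc : Continuous fun ε => h t ε := by fun_prop
    exact hc.continuousAt.eventually (lt_mem_nhds ht1)
  have h3 : ∀ᶠ ε : ℝ in 𝓝 0, Complex.arg ⟨t, ε⟩ < θ := by
    have hc : ContinuousAt (fun ε : ℝ => Complex.arg ⟨t, ε⟩) 0 := by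
      have : (fun ε : ℝ => Complex.arg ⟨t, ε⟩) =
          Complex.arg ∘ fun ε : ℝ => (t : ℂ) + ε * Complex.I := by
        funext ε
        simp [Complex.mk_eq_add_mul_I]
      rw [this]
      refine ContinuousAt.comp (Complex.continuousAt_arg ?_) (by fun_prop)
      simp [Complex.mem_slitPlane_iff, ht]
    apply hc.eventually (gt_mem_nhds ?_)
    have : (⟨t, 0⟩ : ℂ) = (t : ℂ) := rfl
    change Complex.arg ⟨t, 0⟩ < θ
    rw [this, Complex.arg_ofReal_of_nonneg ht.le]
    exact hθ
  have h4 : ∀ᶠ ε : ℝ in 𝓝[>] 0, 0 < ε := eventually_mem_nhdsWithin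
  obtain ⟨ε, ⟨x, hx, hray⟩, hε1, hε2, hε⟩ := ((hleft 1 t one_pos ht).and
    ((h2.filter_mono nhdsWithin_le_nhds).and ((h3.filter_mono nhdsWithin_le_nhds).and
      h4))).exists
  change SameRay ℝ (x : Space3) (V t ε) at hray
  set w : ℂ := ⟨t, ε⟩ with hw
  have hw0 : 0 < ‖w‖ := norm_pos_iff.mpr fun h0 => ht.ne' (congrArg Complex.re h0)
  have hCV : B.coord (V t ε) =
      (‖w‖ * ρ : ℝ) * Complex.exp ((φ + w.arg : ℝ) * Complex.I) := by
    have e1 : w = t + ε * Complex.I := by rw [hw, Complex.mk_eq_add_mul_I]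
    have e2 : B.coord (V t ε) = w * B.coord q := by
      simp only [V, B.coord_add, B.coord_smul, B.coord_base, B.coord_cross]
      rw [e1]; ring
    have e3 : Complex.exp ((φ + w.arg : ℝ) * Complex.I) =
        Complex.exp (φ * Complex.I) * Complex.exp (w.arg * Complex.I) := by
      rw [← Complex.exp_add]; push_cast; ring_nf
    rw [e2, hq, e3]
    conv_lhs => rw [← Complex.norm_mul_exp_arg_mul_I w]
    push_cast; ring
  have hV0 : V t ε ≠ 0 := by
    intro h0
    have : (0 : ℝ) < h t ε := hε1
    simp [h, h0] at this
  have hxV : (x : Space3) = ‖V t ε‖⁻¹ • V t ε := by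
    have := sameRay_iff_norm_smul_eq.mp hray
    rw [norm_eq_of_mem_sphere, one_smul] at this
    rw [eq_inv_smul_iff₀ (norm_ne_zero_iff.mpr hV0), ← this]
  have hVn : 0 < ‖V t ε‖ := norm_pos_iff.mpr hV0
  have hCx : B.coord x = ((‖V t ε‖⁻¹ * (‖w‖ * ρ) : ℝ) : ℂ) *
      Complex.exp ((φ + w.arg : ℝ) * Complex.I) := by
    rw [hxV, B.coord_smul, hCV]; push_cast; ring
  have hnorm : ‖B.coord x‖ = ‖V t ε‖⁻¹ * (‖w‖ * ρ) := by
    rw [hCx, norm_mul, Complex.norm_exp_ofReal_mul_I, mul_one, Complex.norm_real,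
      Real.norm_of_nonneg (by positivity)]
  have hxP := B.eq_polarPoint_arccos (x := x) (φ := φ + w.arg) (by rw [hnorm]; exact hCx)
  have hinner : inner ℝ (p : Space3) x = ‖V t ε‖⁻¹ * inner ℝ (p : Space3) (V t ε) := by
    rw [hxV, real_inner_smul_right]
  have hlt : Real.cos r₀ < inner ℝ (p : Space3) x := by
    rw [hinner, ← div_eq_inv_mul, lt_div_iff₀ hVn]
    have : 0 < h t ε := hε1
    simp only [h] at this
    linarith
  have hlt1 : inner ℝ (p : Space3) (x : Space3) < 1 := by
    have hn := B.normSq_coord x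
    rw [Sphere2.inner_self, ← Complex.sq_norm, hnorm] at hn
    have : 0 < (‖V t ε‖⁻¹ * (‖w‖ * ρ)) ^ 2 := by positivity
    nlinarith
  refine ⟨Real.arccos (inner ℝ (p : Space3) x), φ + w.arg, Real.arccos_pos.mpr hlt1, ?_, ?_, ?_, ?_⟩
  · have hc1 : -1 ≤ Real.cos r₀ := Real.neg_one_le_cos r₀
    have := Real.arccos_lt_arccos hc1 hlt hlt1.le
    rwa [Real.arccos_cos hr₀.le hr₀'.le] at this
  · have a0 : 0 ≤ w.arg := Complex.arg_nonneg_iff.mpr (le_of_lt hε)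
    have a1 : w.arg ≠ 0 := fun h0 => by
      have := (Complex.arg_eq_zero_iff.mp h0).2
      exact (ne_of_gt hε) this
    have := lt_of_le_of_ne a0 a1.symm
    linarith
  · linarith
  · rw [← hxP]; exact hx

theorem isPreconnected_sector {p : Sphere2} (B : TangentFrame (p : Space3)) (r₀ φ ψ : ℝ) :
    IsPreconnected ((fun y : ℝ × ℝ => B.polarPoint y.1 y.2) '' (Set.Ioo 0 r₀ ×ˢ Set.Ioo φ ψ)) :=
  (isPreconnected_Ioo.prod isPreconnected_Ioo).image _ B.continuous_polarPoint.continuousOn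

/-- Near a corner, the sector swept by the inner angle lies in the interior, and the complementary
sector does not. -/
theorem exists_sector (hρ : 0 < ρ)
    (hq : B.coord (Q.corner (k + 1)) = ρ * Complex.exp (φ * Complex.I)) :
    ∃ r₀ : ℝ, 0 < r₀ ∧
      (∀ r ψ, 0 < r → r < r₀ → φ < ψ → ψ < φ + Q.innerAngle k →
        B.polarPoint r ψ ∈ interior Q.region) ∧
      ∀ r ψ, 0 < r → r < r₀ → φ + Q.innerAngle k - 2 * Real.pi < ψ → ψ < φ →
        B.polarPoint r ψ ∉ interior Q.region := by
  obtain ⟨r₀, hr₀, hr₀', hfr⟩ := exists_radius B hρ hq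
  have hθ := Q.innerAngle_pos k
  have hθ' := Q.innerAngle_lt k
  set θ := Q.innerAngle k
  -- A sector that contains neither edge direction is connected and misses the frontier; a single
  -- interior point then makes all of it interior.
  have sector : ∀ φ₁ φ₂ : ℝ, (∀ ψ : ℝ, φ₁ < ψ → ψ < φ₂ →
      (Complex.exp (ψ * Complex.I) ≠ Complex.exp (φ * Complex.I) ∧
        Complex.exp (ψ * Complex.I) ≠ Complex.exp ((φ + θ : ℝ) * Complex.I))) →
      (∃ r ψ, 0 < r ∧ r < r₀ ∧ φ₁ < ψ ∧ ψ < φ₂ ∧ B.polarPoint r ψ ∈ interior Q.region) →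
      ∀ r ψ, 0 < r → r < r₀ → φ₁ < ψ → ψ < φ₂ → B.polarPoint r ψ ∈ interior Q.region := by
    rintro φ₁ φ₂ hne ⟨r₁, ψ₁, a1, a2, a3, a4, a5⟩ r ψ b1 b2 b3 b4
    refine (isPreconnected_sector B r₀ φ₁ φ₂).subset_interior_of_disjoint_frontier
      Q.isClosed_region ?_ ⟨_, ⟨(r₁, ψ₁), ⟨⟨a1, a2⟩, a3, a4⟩, rfl⟩, a5⟩
      ⟨(r, ψ), ⟨⟨b1, b2⟩, b3, b4⟩, rfl⟩
    rw [Set.disjoint_left]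
    rintro _ ⟨⟨s, χ⟩, ⟨⟨c1, c2⟩, c3, c4⟩, rfl⟩ hmem
    rcases hfr s χ c1 c2 hmem with h | h
    · exact (hne χ c3 c4).1 h
    · exact (hne χ c3 c4).2 h
  have hin : ∀ r ψ, 0 < r → r < r₀ → φ < ψ → ψ < φ + θ →
      B.polarPoint r ψ ∈ interior Q.region := by
    refine sector φ (φ + θ) (fun ψ h1 h2 => ⟨fun h => ?_, fun h => ?_⟩)
      (exists_polarPoint_mem_interior B rfl rfl hρ hq hr₀ hr₀' hθ)
    · exact h1.ne' (eq_of_exp_eq h (by linarith) (by linarith))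
    · exact h2.ne (eq_of_exp_eq h (by linarith) (by linarith))
  refine ⟨r₀, hr₀, hin, fun r ψ h1 h2 h3 h4 h5 => ?_⟩
  -- If the complementary sector contained one interior point, it would be interior throughout.
  -- Closedness would add the two bounding rays, and the region would be a neighbourhood of a point
  -- of its own frontier.
  have hout : ∀ r ψ, 0 < r → r < r₀ → φ + θ - 2 * Real.pi < ψ → ψ < φ →
      B.polarPoint r ψ ∈ interior Q.region := by
    refine sector (φ + θ - 2 * Real.pi) φ (fun ψ h1 h2 => ⟨fun h => ?_, fun h => ?_⟩)
      ⟨r, ψ, h1, h2, h3, h4, h5⟩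
    · exact h2.ne (eq_of_exp_eq h (by linarith) (by linarith))
    · have e : Complex.exp ((φ + θ : ℝ) * Complex.I) =
          Complex.exp ((φ + θ - 2 * Real.pi : ℝ) * Complex.I) := by
        rw [Complex.exp_eq_exp_iff_exists_int]
        exact ⟨1, by push_cast; ring⟩
      rw [e] at h
      exact h1.ne' (eq_of_exp_eq h (by linarith) (by linarith))
  have hall : ∀ s χ, 0 < s → s < r₀ → φ + θ - 2 * Real.pi ≤ χ → χ < φ + θ →
      B.polarPoint s χ ∈ Q.region := by
    intro s χ c1 c2 c3 c4
    have hlim : Tendsto (fun χ' => B.polarPoint s χ') (𝓝[>] χ) (𝓝 (B.polarPoint s χ)) := by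
      exact ((B.continuous_polarPoint_right s).tendsto χ).mono_left nhdsWithin_le_nhds
    refine Q.isClosed_region.mem_of_tendsto hlim ?_
    rcases lt_or_ge χ φ with hχ | hχ
    · filter_upwards [Ioo_mem_nhdsGT hχ] with χ' hχ'
      exact interior_subset (hout s χ' c1 c2 (by linarith [hχ'.1]) hχ'.2)
    · filter_upwards [Ioo_mem_nhdsGT c4] with χ' hχ'
      exact interior_subset (hin s χ' c1 c2 (by linarith [hχ'.1]) hχ'.2)
  have hnhds : Q.region ∈ 𝓝 (Q.corner k) := by
    have hc : ∀ᶠ x : Sphere2 in 𝓝 (Q.corner k),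
        Real.arccos (inner ℝ (Q.corner k : Space3) x) < r₀ := by
      have hc : Continuous fun x : Sphere2 => Real.arccos (inner ℝ (Q.corner k : Space3) x) :=
        Real.continuous_arccos.comp (continuous_inner_sphere _)
      apply hc.continuousAt.eventually (gt_mem_nhds ?_)
      beta_reduce
      rw [Sphere2.inner_self, Real.arccos_one]
      exact hr₀
    filter_upwards [hc] with x hx
    obtain ⟨χ, c1, c2, c3⟩ := B.exists_polarPoint x (φ + θ - 2 * Real.pi)
    rcases (Real.arccos_nonneg (inner ℝ (Q.corner k : Space3) x)).eq_or_lt with h0 | h0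
    · rw [← h0] at c3
      have : x = Q.corner k := by
        rw [c3]; apply Subtype.ext; rw [B.coe_polarPoint]; simp
      rw [this]
      exact Q.isClosed_region.frontier_subset (Q.corner_mem_frontier k)
    · rw [c3]
      exact hall _ _ h0 hx c1 (by linarith)
  exact (Q.corner_mem_frontier k).2 (mem_interior_iff_mem_nhds.mpr hnhds)

theorem exists_sector_at {p q : Sphere2} (B : TangentFrame (p : Space3)) (hp : Q.corner k = p)
    (hqc : Q.corner (k + 1) = q) (hρ : 0 < ρ)
    (hq : B.coord q = ρ * Complex.exp (φ * Complex.I)) :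
    ∃ r₀ : ℝ, 0 < r₀ ∧
      (∀ r ψ, 0 < r → r < r₀ → φ < ψ → ψ < φ + Q.innerAngle k →
        B.polarPoint r ψ ∈ interior Q.region) ∧
      ∀ r ψ, 0 < r → r < r₀ → φ + Q.innerAngle k - 2 * Real.pi < ψ → ψ < φ →
        B.polarPoint r ψ ∉ interior Q.region := by
  subst hp hqc
  exact exists_sector B hρ hq

end SphQuadrangle

/-! ### The angle sum at a vertex -/

/-- If the angles around a point are angles of tiles, they add up to `2π`. -/
theorem QuadTiling.sum_ccwAngle {F : ℕ} (T : QuadTiling F) (p : Sphere2) (m : ℕ) (hm : 0 < m)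
    (u : ℕ → Sphere2) (hu : u m = u 0) (hinj : ∀ j < m, u 0 = u j → j = 0)
    (htile : ∀ j < m, ∃ i k, (T.tile i).corner k = p ∧ (T.tile i).corner (k + 1) = u j ∧
      (T.tile i).corner (k - 1) = u (j + 1)) :
    ∑ j ∈ Finset.range m, ccwAngle p (u j) (u (j + 1)) = 2 * Real.pi := by
  have hpi := Real.pi_pos
  obtain ⟨B⟩ := exists_tangentFrame p.inner_self
  obtain ⟨i₀, -⟩ := htile 0 hm
  have : Nonempty (Fin F) := ⟨i₀⟩
  choose! i k hp hnext hprev using htile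
  set a : ℕ → ℝ := fun j => ccwAngle p (u j) (u (j + 1)) with ha
  have ha_eq : ∀ j < m, (T.tile (i j)).innerAngle (k j) = a j := fun j hj => by
    rw [SphQuadrangle.innerAngle, hp j hj, hnext j hj, hprev j hj]
  have ha_pos : ∀ j < m, 0 < a j := fun j hj => by
    rw [← ha_eq j hj]; exact SphQuadrangle.innerAngle_pos _ _
  have ha_lt : ∀ j < m, a j < 2 * Real.pi := fun j hj => by
    rw [← ha_eq j hj]; exact SphQuadrangle.innerAngle_lt _ _
  have hne : ∀ j < m, B.coord (u j) ≠ 0 := fun j hj => by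
    apply B.coord_ne_zero
    · rw [← hp j hj, ← hnext j hj]; exact SphQuadrangle.corner_next_ne _ _
    · rw [← hp j hj, ← hnext j hj]; exact SphQuadrangle.not_antipodal _ _
  have hne' : ∀ j ≤ m, B.coord (u j) ≠ 0 := fun j hj => by
    rcases hj.eq_or_lt with rfl | h
    · rw [hu]; exact hne 0 hm
    · exact hne j h
  set φ := (B.coord (u 0)).arg
  set s : ℕ → ℝ := fun j => ∑ l ∈ Finset.range j, a l with hs
  have hs_succ : ∀ j, s (j + 1) = s j + a j := fun j => Finset.sum_range_succ _ _
  have hs0 : s 0 = 0 := Finset.sum_range_zero _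
  have hdir : ∀ j, j ≤ m →
      B.coord (u j) = ‖B.coord (u j)‖ * Complex.exp ((φ + s j : ℝ) * Complex.I) := by
    intro j
    induction j with
    | zero =>
      intro _
      rw [hs0, add_zero]
      exact (Complex.norm_mul_exp_arg_mul_I _).symm
    | succ j ih =>
      intro hj
      have h := B.coord_of_ccwAngle (r := u (j + 1))
        (norm_pos_iff.mpr (hne' j (by omega))) (ih (by omega))
      rw [hs_succ, ← add_assoc]
      exact h
  -- The directions return to the initial one after `m` steps, so the sum is a positive multiple of
  -- `2π`. It remains to exclude a second turn.
  have hexp : Complex.exp ((φ + s m : ℝ) * Complex.I) = Complex.exp (φ * Complex.I) := by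
    have h1 := hdir m le_rfl
    rw [hu] at h1
    have h2 := (Complex.norm_mul_exp_arg_mul_I (B.coord (u 0)))
    have h3 := norm_pos_iff.mpr (hne 0 hm)
    exact (exp_eq_of_mul_exp_eq h3 h3 (h1.symm.trans h2.symm)).2
  have hs_pos : 0 < s m := Finset.sum_pos (fun j hj => ha_pos j (Finset.mem_range.mp hj))
    ⟨0, Finset.mem_range.mpr hm⟩
  obtain ⟨n, hn⟩ := Complex.exp_eq_exp_iff_exists_int.mp hexp
  have hn' : s m = n * (2 * Real.pi) := by
    have := congrArg Complex.im hn
    simp at this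
    linarith
  change s m = 2 * Real.pi
  have hn1 : 0 < n := by
    have : (0 : ℝ) < n := by
      by_contra h
      push Not at h
      nlinarith
    exact_mod_cast this
  by_contra hcon
  have hn2 : 2 ≤ n := by
    by_contra h
    obtain rfl : n = 1 := by omega
    exact hcon (by rw [hn']; simp)
  have hbig : 2 * Real.pi < s m := by
    have : (2 : ℝ) ≤ n := by exact_mod_cast hn2
    nlinarith
  classical
  have hex : ∃ J, 2 * Real.pi < s J := ⟨m, hbig⟩
  -- `J` is the first index at which the partial sums pass `2π`; the sector of tile `J - 1` then
  -- overlaps that of tile `0`, one turn later.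
  obtain ⟨J, hJ, hJm, hJmin⟩ : ∃ J, 2 * Real.pi < s J ∧ J ≤ m ∧ ∀ j < J, s j ≤ 2 * Real.pi :=
    ⟨Nat.find hex, Nat.find_spec hex, Nat.find_min' hex hbig,
      fun j hj => not_lt.mp (Nat.find_min hex hj)⟩
  obtain ⟨j, rfl⟩ : ∃ j, J = j + 1 := Nat.exists_eq_succ_of_ne_zero (by
    rintro rfl
    rw [hs0] at hJ; linarith)
  have hj0 : j ≠ 0 := by
    rintro rfl
    rw [hs_succ, hs0, zero_add] at hJ
    exact absurd (ha_lt 0 hm) (by linarith)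
  have hjm : j < m := by omega
  have hsj := hJmin j (by omega)
  rw [hs_succ] at hJ
  -- With this `ε`, the direction `φ + ε` lies in the sector of tile `0` and `φ + ε + 2π` in that of
  -- tile `j`; they give the same points near `p`.
  obtain ⟨ε, hε, hε'⟩ := exists_between (lt_min (ha_pos 0 hm) (sub_pos.mpr hJ))
  have hε1 := hε'.trans_le (min_le_left _ _)
  have hε2 := hε'.trans_le (min_le_right _ _)
  have hd0 := hdir 0 (Nat.zero_le _)
  rw [hs0, add_zero] at hd0
  obtain ⟨r₁, hr₁, hin₁, -⟩ := SphQuadrangle.exists_sector_at B (hp 0 hm) (hnext 0 hm)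
    (norm_pos_iff.mpr (hne 0 hm)) hd0
  obtain ⟨r₂, hr₂, hin₂, -⟩ := SphQuadrangle.exists_sector_at B (hp j hjm) (hnext j hjm)
    (norm_pos_iff.mpr (hne j hjm)) (hdir j hjm.le)
  obtain ⟨r, hr, hr'⟩ := exists_between (lt_min hr₁ hr₂)
  have hx₁ := hin₁ r (φ + ε) hr (hr'.trans_le (min_le_left _ _)) (by linarith)
    (by rw [ha_eq 0 hm]; linarith)
  have hx₂ := hin₂ r (φ + ε + 2 * Real.pi) hr (hr'.trans_le (min_le_right _ _)) (by linarith)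
    (by rw [ha_eq j hjm]; linarith)
  rw [B.polarPoint_congr r (ψ := φ + ε) (by
    rw [Complex.exp_eq_exp_iff_exists_int]
    exact ⟨1, by push_cast; ring⟩)] at hx₂
  -- Distinct tiles have disjoint interiors. If the tiles coincide, so do their corners at `p`,
  -- whence `u 0 = u j` although `j ≠ 0`.
  by_cases hij : i 0 = i j
  · have hk : k 0 = k j := (T.tile (i j)).corner_injective (by
      rw [hp j hjm, ← hij, hp 0 hm])
    refine hj0 (hinj j hjm ?_)
    rw [← hnext 0 hm, ← hnext j hjm, hij, hk]
  · exact Set.disjoint_left.mp (T.interior_disjoint _ _ hij) hx₁ hx₂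

/-! ### Isometries and congruent quadrangles -/

theorem sq_triple (u v w : Space3) : inner ℝ u (cross3 v w) ^ 2 =
    inner ℝ u u * (inner ℝ v v * inner ℝ w w - inner ℝ v w ^ 2) -
      inner ℝ u v * (inner ℝ u v * inner ℝ w w - inner ℝ v w * inner ℝ u w) +
      inner ℝ u w * (inner ℝ u v * inner ℝ v w - inner ℝ v v * inner ℝ u w) := by
  simp only [inner_space3, cross3_zero, cross3_one, cross3_two]; ring

/-- The factor `d` is the determinant of `g`. Its square is `1` because the square of a triple
product is a Gram determinant, which `g` preserves. -/
theorem LinearIsometryEquiv.exists_triple (g : Space3 ≃ₗᵢ[ℝ] Space3) :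
    ∃ d : ℝ, (d = 1 ∨ d = -1) ∧
      ∀ u v w, inner ℝ (g u) (cross3 (g v) (g w)) = d * inner ℝ u (cross3 v w) := by
  have h : ∀ u v w : Space3, inner ℝ u (cross3 v w) =
      (EuclideanSpace.basisFun (Fin 3) ℝ).toBasis.det ![u, v, w] := by
    intro u v w
    rw [Module.Basis.det_apply, Matrix.det_fin_three]
    simp [Module.Basis.toMatrix_apply, inner_space3]
    ring
  have key : ∀ u v w, inner ℝ (g u) (cross3 (g v) (g w)) =
      LinearMap.det (g.toLinearEquiv : Space3 →ₗ[ℝ] Space3) * inner ℝ u (cross3 v w) := by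
    intro u v w
    rw [h, h, ← Module.Basis.det_comp]
    congr 1
    funext i
    fin_cases i <;> rfl
  refine ⟨_, ?_, key⟩
  rw [← sq_eq_one_iff]
  let e : Fin 3 → Space3 := fun i => EuclideanSpace.single i 1
  have h1 := key (e 0) (e 1) (e 2)
  have h2 : inner ℝ (e 0) (cross3 (e 1) (e 2)) = 1 := by simp [e, inner_space3]
  have h3 := sq_triple (g (e 0)) (g (e 1)) (g (e 2))
  simp only [g.inner_map_map] at h3
  rw [← sq_triple, h1, h2] at h3
  simpa using h3

theorem cross3_map {g : Space3 ≃ₗᵢ[ℝ] Space3} {d : ℝ}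
    (hg : ∀ u v w, inner ℝ (g u) (cross3 (g v) (g w)) = d * inner ℝ u (cross3 v w))
    (v w : Space3) : cross3 (g v) (g w) = d • g (cross3 v w) := by
  apply ext_inner_left ℝ
  intro u
  obtain ⟨u, rfl⟩ := g.surjective u
  rw [hg, inner_smul_right, g.inner_map_map]

/-- The image of a tangent frame under an isometry of determinant `d`. -/
def TangentFrame.map {p : Space3} (B : TangentFrame p) (g : Space3 ≃ₗᵢ[ℝ] Space3) {d : ℝ}
    (hd : d = 1 ∨ d = -1)
    (hg : ∀ u v w, inner ℝ (g u) (cross3 (g v) (g w)) = d * inner ℝ u (cross3 v w)) :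
    TangentFrame (g p) where
  e := g B.e
  f := d • g B.f
  inner_e_e := by rw [g.inner_map_map, B.inner_e_e]
  inner_f_f := by
    rw [real_inner_smul_left, real_inner_smul_right, g.inner_map_map, B.inner_f_f]
    rcases hd with rfl | rfl <;> norm_num
  inner_e_f := by rw [real_inner_smul_right, g.inner_map_map, B.inner_e_f, mul_zero]
  cross_e_f := by
    rw [cross3_smul_right, cross3_map hg, B.cross_e_f, smul_smul]
    rcases hd with rfl | rfl <;> norm_num

theorem TangentFrame.coord_map {p : Space3} (B : TangentFrame p) (g : Space3 ≃ₗᵢ[ℝ] Space3) {d : ℝ}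
    (hd : d = 1 ∨ d = -1)
    (hg : ∀ u v w, inner ℝ (g u) (cross3 (g v) (g w)) = d * inner ℝ u (cross3 v w))
    (x : Space3) {ρ φ : ℝ} (hx : B.coord x = ρ * Complex.exp (φ * Complex.I)) :
    (B.map g hd hg).coord (g x) = ρ * Complex.exp ((d * φ : ℝ) * Complex.I) := by
  have h1 := congrArg Complex.re hx
  have h2 := congrArg Complex.im hx
  simp only [TangentFrame.coord, Complex.re_ofReal_mul, Complex.im_ofReal_mul,
    Complex.exp_ofReal_mul_I_re, Complex.exp_ofReal_mul_I_im] at h1 h2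
  apply Complex.ext
  · simp only [TangentFrame.coord, TangentFrame.map, g.inner_map_map, h1, Complex.re_ofReal_mul,
      Complex.exp_ofReal_mul_I_re]
    rcases hd with rfl | rfl <;> simp
  · simp only [TangentFrame.coord, TangentFrame.map, real_inner_smul_left, g.inner_map_map, h2,
      Complex.im_ofReal_mul, Complex.exp_ofReal_mul_I_im]
    rcases hd with rfl | rfl <;> simp

theorem tangentProd_map {g : Space3 ≃ₗᵢ[ℝ] Space3} {d : ℝ}
    (hg : ∀ u v w, inner ℝ (g u) (cross3 (g v) (g w)) = d * inner ℝ u (cross3 v w))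
    (p q r : Space3) : tangentProd (g p) (g q) (g r) =
      ⟨(tangentProd p q r).re, d * (tangentProd p q r).im⟩ := by
  simp [tangentProd, hg]

namespace SphQuadrangle

theorem map_interior {Q Q' : SphQuadrangle} {g : Space3 ≃ₗᵢ[ℝ] Space3}
    (h : ∀ x y : Sphere2, g x = (y : Space3) → (x ∈ Q.region ↔ y ∈ Q'.region))
    {x y : Sphere2} (hxy : g x = (y : Space3)) (hx : x ∈ interior Q.region) :
    y ∈ interior Q'.region := by
  let g' : Sphere2 → Sphere2 := fun y => ⟨g.symm y, by
    rw [mem_sphere_zero_iff_norm, LinearIsometryEquiv.norm_map, norm_eq_of_mem_sphere]⟩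
  have hg' : Continuous g' := by
    apply Continuous.subtype_mk
    exact g.symm.continuous.comp continuous_subtype_val
  refine mem_interior.mpr ⟨g' ⁻¹' interior Q.region, fun z hz => ?_,
    isOpen_interior.preimage hg', ?_⟩
  · exact (h (g' z) z (by simp [g'])).mp (interior_subset hz)
  · have : g' y = x := Subtype.ext (by simp [g', ← hxy])
    rw [Set.mem_preimage, this]; exact hx

/-- An isometry between congruent quadrangles keeps the cyclic order of the corners if and only if
it keeps the orientation. -/
theorem det_eq_of_map {Q Q' : SphQuadrangle} {g : Space3 ≃ₗᵢ[ℝ] Space3} {d : ℝ}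
    (hd : d = 1 ∨ d = -1)
    (hg : ∀ u v w, inner ℝ (g u) (cross3 (g v) (g w)) = d * inner ℝ u (cross3 v w))
    (hreg : ∀ x y : Sphere2, g x = (y : Space3) → (x ∈ Q.region ↔ y ∈ Q'.region))
    {k₀ ε : Fin 4} (hε : ε = 1 ∨ ε = -1)
    (hcor : ∀ j, g (Q.corner j) = (Q'.corner (k₀ + ε * j) : Space3)) :
    (ε = 1 ∧ d = 1) ∨ (ε = -1 ∧ d = -1) := by
  obtain ⟨B⟩ := exists_tangentFrame (Q.corner 0).inner_self
  obtain ⟨ρ, φ, hρ, hq⟩ := coord_next B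
  obtain ⟨ρ', hρ', hw⟩ := coord_prev B hρ hq
  obtain ⟨r₁, hr₁, hin, -⟩ := exists_sector B hρ hq
  have hθ := Q.innerAngle_pos 0
  have hθ' := Q.innerAngle_lt 0
  set θ := Q.innerAngle 0
  have hp' : g (Q.corner 0) = (Q'.corner k₀ : Space3) := by rw [hcor, mul_zero, add_zero]
  obtain ⟨B', hB'⟩ : ∃ B' : TangentFrame (Q'.corner k₀ : Space3), ∀ (x : Space3) (ρ φ : ℝ),
      B.coord x = ρ * Complex.exp (φ * Complex.I) →
      B'.coord (g x) = ρ * Complex.exp ((d * φ : ℝ) * Complex.I) := by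
    rw [← hp']
    exact ⟨B.map g hd hg, fun x ρ φ h => B.coord_map g hd hg x h⟩
  have hq' := hB' _ _ _ hq
  have hw' := hB' _ _ _ hw
  rw [hcor] at hq' hw'
  have himage : ∀ r ψ, 0 < r → r < r₁ → φ < ψ → ψ < φ + θ →
      B'.polarPoint r (d * ψ) ∈ interior Q'.region := by
    intro r ψ h1 h2 h3 h4
    refine map_interior hreg (x := B.polarPoint r ψ) ?_ (hin r ψ h1 h2 h3 h4)
    have hn : ‖g (B.polarPoint r ψ)‖ = 1 := by
      rw [g.norm_map, norm_eq_of_mem_sphere]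
    have := B'.eq_polarPoint (x := ⟨g (B.polarPoint r ψ), mem_sphere_zero_iff_norm.mpr hn⟩)
      (r := r) (φ := d * ψ) ?_ ?_
    · exact congrArg Subtype.val this
    · rw [← hp', g.inner_map_map, B.inner_polarPoint]
    · exact hB' _ _ _ (B.coord_polarPoint r ψ)
  -- In the two mismatched cases the image of the inner sector at corner `0` would be the
  -- complementary sector at its image, which contains no interior points. The direction `φ + θ / 2`
  -- serves as witness.
  rcases hε with rfl | rfl <;> rcases hd with rfl | rfl
  · exact Or.inl ⟨rfl, rfl⟩
  · exfalso
    simp only [zero_add, zero_sub, mul_one, one_mul, ← sub_eq_add_neg] at hq' hw'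
    have hang : Q'.innerAngle k₀ = 2 * Real.pi - θ := by
      refine B'.ccwAngle_of_coord hρ hq' hρ' (hw'.trans ?_) (by linarith) (by linarith)
      congr 1
      rw [Complex.exp_eq_exp_iff_exists_int]
      exact ⟨-1, by push_cast; ring⟩
    obtain ⟨r₂, hr₂, -, hout⟩ := exists_sector B' hρ hq'
    obtain ⟨r, hr, hr'⟩ := exists_between (lt_min hr₁ hr₂)
    refine hout r (-1 * (φ + θ / 2)) hr (hr'.trans_le (min_le_right _ _)) ?_ (by linarith)
      (himage r (φ + θ / 2) hr (hr'.trans_le (min_le_left _ _)) (by linarith) (by linarith))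
    rw [hang]; linarith
  · exfalso
    simp only [zero_add, zero_sub, mul_one, one_mul, mul_neg, neg_neg, ← sub_eq_add_neg] at hq' hw'
    have hang : Q'.innerAngle k₀ = 2 * Real.pi - θ := by
      refine B'.ccwAngle_of_coord hρ' hw' hρ (hq'.trans ?_) (by linarith) (by linarith)
      congr 1
      rw [Complex.exp_eq_exp_iff_exists_int]
      exact ⟨-1, by push_cast; ring⟩
    obtain ⟨r₂, hr₂, -, hout⟩ := exists_sector B' hρ' hw'
    obtain ⟨r, hr, hr'⟩ := exists_between (lt_min hr₁ hr₂)
    refine hout r (1 * (φ + θ / 2)) hr (hr'.trans_le (min_le_right _ _)) ?_ (by linarith)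
      (himage r (φ + θ / 2) hr (hr'.trans_le (min_le_left _ _)) (by linarith) (by linarith))
    rw [hang]; linarith
  · exact Or.inr ⟨rfl, rfl⟩

/-- Congruent quadrangles have the same edge-lengths and inner angles. -/
theorem Congruent.exists_corner_map {Q Q' : SphQuadrangle} (h : Q.Congruent Q') :
    ∃ k₀ ε : Fin 4, (ε = 1 ∨ ε = -1) ∧
      (∀ i j, sphDist (Q'.corner (k₀ + ε * i)) (Q'.corner (k₀ + ε * j)) =
        sphDist (Q.corner i) (Q.corner j)) ∧
      ∀ j, Q'.innerAngle (k₀ + ε * j) = Q.innerAngle j := by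
  obtain ⟨g, ⟨k₀, ε, hε, hcor⟩, hreg⟩ := h
  obtain ⟨d, hd, hg⟩ := g.exists_triple
  refine ⟨k₀, ε, hε, fun i j => ?_, fun j => ?_⟩
  · rw [sphDist, sphDist, ← hcor, ← hcor]
    exact g.toLinearIsometry.angle_map _ _
  · rw [innerAngle, innerAngle, ccwAngle_eq, ccwAngle_eq]
    rcases det_eq_of_map hd hg hreg hε hcor with ⟨rfl, rfl⟩ | ⟨rfl, rfl⟩
    · congr 1
      rw [add_assoc, add_sub_assoc, show 1 * j + 1 = 1 * (j + 1) by simp,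
        show 1 * j - 1 = 1 * (j - 1) by simp, ← hcor, ← hcor, ← hcor, tangentProd_map hg]
      simp
    · congr 1
      rw [add_assoc, add_sub_assoc, (by decide : ∀ j : Fin 4, -1 * j + 1 = -1 * (j - 1)) j,
        (by decide : ∀ j : Fin 4, -1 * j - 1 = -1 * (j + 1)) j, ← hcor, ← hcor, ← hcor,
        tangentProd_map hg, tangentProd_swap]
      apply Complex.ext <;> simp

end SphQuadrangle

/-! ### Trigonometry of quadrangles with three equal sides -/

theorem inner_eq_cos_sphDist (p q : Sphere2) :
    inner ℝ (p : Space3) (q : Space3) = Real.cos (sphDist p q) := by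
  rw [sphDist, InnerProductGeometry.cos_angle]
  simp

theorem inner_lt_one {p q : Sphere2} (h : q ≠ p) : inner ℝ (p : Space3) (q : Space3) < 1 := by
  rw [inner_lt_one_iff_real_of_norm_eq_one (norm_eq_of_mem_sphere p) (norm_eq_of_mem_sphere q)]
  exact fun h0 => h (Subtype.ext h0.symm)

theorem neg_one_lt_inner {p q : Sphere2} (h : (q : Space3) ≠ -p) :
    -1 < inner ℝ (p : Space3) (q : Space3) := by
  have h1 := (inner_lt_one_iff_real_of_norm_eq_one (x := -(p : Space3)) (y := q)
    (by rw [norm_neg]; exact norm_eq_of_mem_sphere p) (norm_eq_of_mem_sphere q)).mpr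
    (fun h0 => h h0.symm)
  rw [inner_neg_left] at h1
  linarith

theorem exists_tangentProd_polar {p q r : Sphere2} (hq : q ≠ p) (hq' : (q : Space3) ≠ -p)
    (hr : r ≠ p) (hr' : (r : Space3) ≠ -p) :
    ∃ M : ℝ, 0 < M ∧ M ^ 2 = (1 - inner ℝ (p : Space3) (q : Space3) ^ 2) *
        (1 - inner ℝ (p : Space3) (r : Space3) ^ 2) ∧
      (tangentProd p q r).re = M * Real.cos (ccwAngle p q r) ∧
      (tangentProd p q r).im = M * Real.sin (ccwAngle p q r) := by
  obtain ⟨B⟩ := exists_tangentFrame p.inner_self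
  have h := norm_mul_exp_posArg (tangentProd p q r)
  rw [← ccwAngle_eq] at h
  refine ⟨‖tangentProd p q r‖, ?_, ?_, ?_, ?_⟩
  · rw [B.tangentProd_eq, norm_pos_iff]
    exact mul_ne_zero ((map_ne_zero _).mpr (B.coord_ne_zero hq hq')) (B.coord_ne_zero hr hr')
  · rw [Complex.sq_norm, B.tangentProd_eq, Complex.normSq_mul, Complex.normSq_conj,
      B.normSq_coord, B.normSq_coord, Sphere2.inner_self, Sphere2.inner_self]
  · conv_lhs => rw [← h]
    rw [Complex.re_ofReal_mul, Complex.exp_ofReal_mul_I_re]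
  · conv_lhs => rw [← h]
    rw [Complex.im_ofReal_mul, Complex.exp_ofReal_mul_I_im]

/-- A product of two determinants is the determinant of the matrix of mutual inner products. Thus
products of triple products become polynomials in the cosines of sides and diagonals. -/
theorem triple_mul_triple (u v w a b c : Space3) :
    inner ℝ u (cross3 v w) * inner ℝ a (cross3 b c) =
      inner ℝ u a * (inner ℝ v b * inner ℝ w c - inner ℝ v c * inner ℝ w b) -
      inner ℝ u b * (inner ℝ v a * inner ℝ w c - inner ℝ v c * inner ℝ w a) +
      inner ℝ u c * (inner ℝ v a * inner ℝ w b - inner ℝ v b * inner ℝ w a) := by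
  simp only [inner_space3, cross3_zero, cross3_one, cross3_two]; ring

/-- Cramer's rule for four vectors in 3-space, with the signs absorbed in the order of the factors.
-/
theorem triple_linear_relation (a b c d : Space3) :
    inner ℝ c (cross3 d b) • a - inner ℝ d (cross3 a c) • b + inner ℝ a (cross3 b d) • c -
      inner ℝ b (cross3 c a) • d = 0 := by
  simp only [inner_space3]
  apply space3_ext <;>
    simp only [PiLp.add_apply, PiLp.sub_apply, PiLp.smul_apply, PiLp.zero_apply, smul_eq_mul,
      cross3_zero, cross3_one, cross3_two] <;> ring

/-- The relation `2α + β = 2π` in terms of the inner products of the corners. -/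
theorem gram_relation_of_angle_relation {x y p q T U M α β : ℝ} (hx' : x < 1)
    (hTT : T * T = (1 - p) * (1 + p - 2 * x ^ 2))
    (hTU : T * U = (x - x * q) - x * (x ^ 2 - p * q) + y * (x ^ 2 - p)) (hT : T ≠ 0)
    (h1 : p - x * x = (1 - x ^ 2) * Real.cos β) (h2 : T = (1 - x ^ 2) * Real.sin β)
    (h3 : q - x * y = M * Real.cos α) (h4 : U = M * Real.sin α)
    (hαβ : 2 * α + β = 2 * Real.pi) : (q + x) * (1 + x) = (p + x) * (y + q) := by
  have hα : α = Real.pi - β / 2 := by linarith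
  rw [hα, Real.cos_pi_sub] at h3
  rw [hα, Real.sin_pi_sub] at h4
  have hc : Real.cos β = 2 * Real.cos (β / 2) ^ 2 - 1 := by
    rw [← Real.cos_two_mul]; ring_nf
  have hs : Real.sin β = 2 * Real.sin (β / 2) * Real.cos (β / 2) := by
    rw [← Real.sin_two_mul]; ring_nf
  -- Since `α = π - β / 2`, comparison of `tan α = -tan (β / 2)` with `tan (β / 2) = sin β / (1 +
  -- cos β)` gives a relation free of angles. Multiplication by `T` makes it polynomial in the
  -- cosines, and the factors `1 + p - 2 x ^ 2` (nonzero as `T ≠ 0`) and `1 - x` then cancel.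
  have h5 : (q - x * y) * T + U * (1 + p - 2 * x ^ 2) = 0 := by
    have e : 1 + p - 2 * x ^ 2 = (1 - x ^ 2) * (1 + Real.cos β) := by linear_combination h1
    rw [e, h2, h3, h4, hc, hs]; ring
  have h6 : (1 + p - 2 * x ^ 2) * ((q - x * y) * (1 - p) + T * U) = 0 := by
    linear_combination T * h5 - (q - x * y) * hTT
  have hne : 1 + p - 2 * x ^ 2 ≠ 0 := by
    intro h0
    rw [h0, mul_zero] at hTT
    exact hT (mul_self_eq_zero.mp hTT)
  have h7 := (mul_eq_zero.mp h6).resolve_left hne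
  rw [hTU] at h7
  have h8 : (1 - x) * ((q + x) * (1 + x) - (p + x) * (y + q)) = 0 := by linear_combination h7
  have h9 := (mul_eq_zero.mp h8).resolve_left (by linarith)
  linarith

namespace SphQuadrangle

variable (Q : SphQuadrangle) (k : Fin 4)

/-- Polar form of the inner angle at a corner. -/
theorem exists_polar (Q : SphQuadrangle) (k : Fin 4) {A B C : Sphere2} (hA : Q.corner k = A)
    (hB : Q.corner (k + 1) = B) (hC : Q.corner (k - 1) = C) :
    ∃ M : ℝ, 0 < M ∧ M ^ 2 = (1 - inner ℝ (A : Space3) (B : Space3) ^ 2) *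
        (1 - inner ℝ (A : Space3) (C : Space3) ^ 2) ∧
      inner ℝ (B : Space3) (C : Space3) - inner ℝ (A : Space3) (B : Space3) *
        inner ℝ (A : Space3) (C : Space3) = M * Real.cos (Q.innerAngle k) ∧
      inner ℝ (A : Space3) (cross3 B C) = M * Real.sin (Q.innerAngle k) := by
  subst hA hB hC
  exact exists_tangentProd_polar (Q.corner_next_ne k) (Q.not_antipodal k) (Q.corner_prev_ne k)
    (Q.prev_not_antipodal k)

/-- The polar form of the inner angle between two sides of the same length. -/
theorem polar_of_eq (Q : SphQuadrangle) (k : Fin 4) {A B C : Sphere2} {x : ℝ}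
    (hA : Q.corner k = A) (hB : Q.corner (k + 1) = B) (hC : Q.corner (k - 1) = C)
    (h1 : inner ℝ (A : Space3) (B : Space3) = x) (h2 : inner ℝ (A : Space3) (C : Space3) = x)
    (hx : -1 < x) (hx' : x < 1) :
      inner ℝ (B : Space3) (C : Space3) - x * x = (1 - x ^ 2) * Real.cos (Q.innerAngle k) ∧
      inner ℝ (A : Space3) (cross3 B C) = (1 - x ^ 2) * Real.sin (Q.innerAngle k) := by
  obtain ⟨M, hM, hM2, h3, h4⟩ := Q.exists_polar k hA hB hC
  rw [h1, h2] at hM2 h3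
  obtain rfl : M = 1 - x ^ 2 := by
    have : 0 < 1 - x ^ 2 := by nlinarith
    nlinarith
  exact ⟨h3, h4⟩

/-- In a quadrangle with three equal sides, if the diagonals are equal as well then it is
symmetric. -/
theorem triple_eq_of_symmetric {A B C D : Space3} {x p : ℝ}
    (hB : inner ℝ B B = 1) (hC : inner ℝ C C = 1)
    (hAB : inner ℝ A B = x) (hBC : inner ℝ B C = x) (hCD : inner ℝ C D = x)
    (hAC : inner ℝ A C = p) (hBD : inner ℝ B D = p) (hx : -1 < x)
    (hT : inner ℝ B (cross3 C A) = inner ℝ C (cross3 D B)) :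
    inner ℝ A (cross3 B D) = inner ℝ D (cross3 A C) := by
  -- `B + C` has the same inner product `x + p` with `A` and with `D`, so the terms with the two
  -- equal triple products cancel.
  have h := congrArg (inner ℝ (B + C)) (triple_linear_relation A B C D)
  simp only [inner_add_left, inner_add_right, inner_sub_right, real_inner_smul_right,
    inner_zero_right] at h
  have hBA : inner ℝ B A = x := by rw [real_inner_comm]; exact hAB
  have hCA : inner ℝ C A = p := by rw [real_inner_comm]; exact hAC
  have hCB : inner ℝ C B = x := by rw [real_inner_comm]; exact hBC
  rw [hB, hC, hBA, hCA, hBC, hCB, hCD, hBD, hT] at h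
  have h2 : (1 + x) * (inner ℝ A (cross3 B D) - inner ℝ D (cross3 A C)) = 0 := by
    linear_combination h
  have := (mul_eq_zero.mp h2).resolve_left (by linarith)
  linarith

/-- Equal middle angles between equal sides make the two diagonals equal, and the quadrangle is then
symmetric under the exchange of its two ends. Comparing the oriented triple products as well as the
cosines covers angles larger than `π`. -/
theorem innerAngle_eq_of_three_equal_sides
    (h1 : sphDist (Q.corner k) (Q.corner (k + 1)) = sphDist (Q.corner (k + 1)) (Q.corner (k + 2)))
    (h2 : sphDist (Q.corner (k + 1)) (Q.corner (k + 2)) =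
      sphDist (Q.corner (k + 2)) (Q.corner (k + 3)))
    (hβγ : Q.innerAngle (k + 1) = Q.innerAngle (k + 2)) :
    Q.innerAngle k = Q.innerAngle (k + 3) := by
  have e1 := (by decide : ∀ j : Fin 4, j + 1 + 1 = j + 2) k
  have e2 := (by decide : ∀ j : Fin 4, j + 2 + 1 = j + 3) k
  have e3 := (by decide : ∀ j : Fin 4, j + 3 + 1 = j) k
  have f0 := (by decide : ∀ j : Fin 4, j - 1 = j + 3) k
  have f1 := (by decide : ∀ j : Fin 4, j + 1 - 1 = j) k
  have f2 := (by decide : ∀ j : Fin 4, j + 2 - 1 = j + 1) k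
  have f3 := (by decide : ∀ j : Fin 4, j + 3 - 1 = j + 2) k
  obtain ⟨x, hAB⟩ : ∃ x, inner ℝ (Q.corner k : Space3) (Q.corner (k + 1)) = x := ⟨_, rfl⟩
  have hBC : inner ℝ (Q.corner (k + 1) : Space3) (Q.corner (k + 2)) = x := by
    rw [inner_eq_cos_sphDist, ← h1, ← inner_eq_cos_sphDist, hAB]
  have hCD : inner ℝ (Q.corner (k + 2) : Space3) (Q.corner (k + 3)) = x := by
    rw [inner_eq_cos_sphDist, ← h2, ← inner_eq_cos_sphDist, hBC]
  have hx' : x < 1 := hAB ▸ inner_lt_one (Q.corner_next_ne k)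
  have hx : -1 < x := hAB ▸ neg_one_lt_inner (Q.not_antipodal k)
  obtain ⟨g1, g2⟩ := Q.polar_of_eq (k + 1) rfl (congrArg _ e1) (congrArg _ f1) hBC
    (by rw [real_inner_comm, hAB]) hx hx'
  obtain ⟨g3, g4⟩ := Q.polar_of_eq (k + 2) rfl (congrArg _ e2) (congrArg _ f2) hCD
    (by rw [real_inner_comm, hBC]) hx hx'
  rw [hβγ, real_inner_comm] at g1
  rw [hβγ] at g2
  rw [real_inner_comm] at g3
  have hpq : inner ℝ (Q.corner k : Space3) (Q.corner (k + 2)) =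
      inner ℝ (Q.corner (k + 1) : Space3) (Q.corner (k + 3)) := by linarith
  have hU := triple_eq_of_symmetric (Sphere2.inner_self _) (Sphere2.inner_self _) hAB hBC hCD hpq
    rfl hx (g2.trans g4.symm)
  rw [innerAngle, innerAngle, ccwAngle_eq, ccwAngle_eq, e3, f0, f3]
  congr 1
  apply Complex.ext
  · have hDC : inner ℝ (Q.corner (k + 3) : Space3) (Q.corner (k + 2)) = x := by
      rw [real_inner_comm, hCD]
    simp only [tangentProd]
    rw [hAB, hDC, hpq, real_inner_comm (Q.corner k : Space3) (Q.corner (k + 3) : Space3)]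
    ring
  · exact hU

set_option maxHeartbeats 400000 in
/-- No quadrangle with three equal sides has angles subject to the vertex relations
`2α + β = 2δ + γ = 2π` with `β + γ ≤ π`. -/
theorem false_of_angle_relations
    (h1 : sphDist (Q.corner k) (Q.corner (k + 1)) = sphDist (Q.corner (k + 1)) (Q.corner (k + 2)))
    (h2 : sphDist (Q.corner (k + 1)) (Q.corner (k + 2)) =
      sphDist (Q.corner (k + 2)) (Q.corner (k + 3)))
    (hαβ : 2 * Q.innerAngle k + Q.innerAngle (k + 1) = 2 * Real.pi)
    (hδγ : 2 * Q.innerAngle (k + 3) + Q.innerAngle (k + 2) = 2 * Real.pi)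
    (hβγ : Q.innerAngle (k + 1) + Q.innerAngle (k + 2) ≤ Real.pi) : False := by
  have e1 := (by decide : ∀ j : Fin 4, j + 1 + 1 = j + 2) k
  have e2 := (by decide : ∀ j : Fin 4, j + 2 + 1 = j + 3) k
  have e3 := (by decide : ∀ j : Fin 4, j + 3 + 1 = j) k
  have f0 := (by decide : ∀ j : Fin 4, j - 1 = j + 3) k
  have f1 := (by decide : ∀ j : Fin 4, j + 1 - 1 = j) k
  have f2 := (by decide : ∀ j : Fin 4, j + 2 - 1 = j + 1) k
  have f3 := (by decide : ∀ j : Fin 4, j + 3 - 1 = j + 2) k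
  have hβ := Q.innerAngle_pos (k + 1)
  have hγ := Q.innerAngle_pos (k + 2)
  obtain ⟨x, hAB⟩ : ∃ x, inner ℝ (Q.corner k : Space3) (Q.corner (k + 1)) = x := ⟨_, rfl⟩
  have hBC : inner ℝ (Q.corner (k + 1) : Space3) (Q.corner (k + 2)) = x := by
    rw [inner_eq_cos_sphDist, ← h1, ← inner_eq_cos_sphDist, hAB]
  have hCD : inner ℝ (Q.corner (k + 2) : Space3) (Q.corner (k + 3)) = x := by
    rw [inner_eq_cos_sphDist, ← h2, ← inner_eq_cos_sphDist, hBC]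
  have hx' : x < 1 := hAB ▸ inner_lt_one (Q.corner_next_ne k)
  have hx : -1 < x := hAB ▸ neg_one_lt_inner (Q.not_antipodal k)
  have hy' := inner_lt_one (Q.corner_prev_ne k)
  have hy := neg_one_lt_inner (Q.prev_not_antipodal k)
  obtain ⟨g1, g2⟩ := Q.polar_of_eq (k + 1) rfl (congrArg _ e1) (congrArg _ f1) hBC
    (by rw [real_inner_comm, hAB]) hx hx'
  obtain ⟨g3, g4⟩ := Q.polar_of_eq (k + 2) rfl (congrArg _ e2) (congrArg _ f2) hCD
    (by rw [real_inner_comm, hBC]) hx hx'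
  obtain ⟨M, hM, -, g5, g6⟩ := Q.exists_polar k rfl rfl (congrArg _ f0)
  obtain ⟨N, hN, -, g7, g8⟩ := Q.exists_polar (k + 3) rfl (congrArg _ e3) (congrArg _ f3)
  rw [f0] at hy hy'
  set α := Q.innerAngle k
  set β := Q.innerAngle (k + 1)
  set γ := Q.innerAngle (k + 2)
  set δ := Q.innerAngle (k + 3)
  generalize (Q.corner (k + 1)) = B at *
  generalize (Q.corner (k + 2)) = C at *
  generalize (Q.corner (k + 3)) = D at *
  generalize (Q.corner k) = A at *
  obtain ⟨y, hAD⟩ : ∃ y, inner ℝ (A : Space3) (D : Space3) = y := ⟨_, rfl⟩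
  obtain ⟨p, hAC⟩ : ∃ p, inner ℝ (A : Space3) (C : Space3) = p := ⟨_, rfl⟩
  obtain ⟨q, hBD⟩ : ∃ q, inner ℝ (B : Space3) (D : Space3) = q := ⟨_, rfl⟩
  have hBA := hAB
  have hCB := hBC
  have hDC := hCD
  have hDA := hAD
  have hCA := hAC
  have hDB := hBD
  rw [real_inner_comm] at hBA hCB hDC hDA hCA hDB
  have hAA := A.inner_self
  have hBB := B.inner_self
  have hCC := C.inner_self
  have hDD := D.inner_self
  rw [hAD] at hy hy'
  rw [hCA] at g1
  rw [hDB] at g3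
  rw [hBD, hAB, hAD] at g5
  rw [hAC, hDA, hDC] at g7
  have hm : 0 < 1 - x ^ 2 := by nlinarith only [hx, hx']
  -- `β` and `γ` are positive with sum at most `π`, and `α = π - β / 2`; all three lie strictly
  -- between `0` and `π`, whence the signs of the triple products.
  have hT : 0 < inner ℝ (B : Space3) (cross3 C A) := by
    rw [g2]; exact mul_pos hm (Real.sin_pos_of_pos_of_lt_pi hβ (by linarith))
  have hT' : 0 < inner ℝ (C : Space3) (cross3 D B) := by
    rw [g4]; exact mul_pos hm (Real.sin_pos_of_pos_of_lt_pi hγ (by linarith))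
  have hU : 0 < inner ℝ (A : Space3) (cross3 B D) := by
    rw [g6]; exact mul_pos hM (Real.sin_pos_of_pos_of_lt_pi (by linarith) (by linarith))
  have t1 := triple_mul_triple (B : Space3) C A B C A
  have t2 := triple_mul_triple (B : Space3) C A A B D
  have t3 := triple_mul_triple (C : Space3) D B C D B
  have t4 := triple_mul_triple (C : Space3) D B D A C
  simp only [hAA, hBB, hCC, hDD, hAB, hBA, hBC, hCB, hCD, hDC, hAD, hDA, hAC, hCA, hBD, hDB]
    at t1 t2 t3 t4
  have r1 := gram_relation_of_angle_relation hx' (by rw [t1]; ring) (by rw [t2]; ring)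
    hT.ne' g1 g2 g5 g6 hαβ
  have r2 := gram_relation_of_angle_relation (p := q) (q := p) (y := y) hx' (by rw [t3]; ring)
    (by rw [t4]; ring) hT'.ne' g3 g4 (by linear_combination g7) g8 hδγ
  -- The difference of the two Gram relations factors as `(p - q) (1 + y) = 0`, and `y > -1`.
  have hpq : p = q := by
    have h3 : (p - q) * (1 + y) = 0 := by linear_combination r2 - r1
    have := (mul_eq_zero.mp h3).resolve_right (by linarith)
    linarith
  subst hpq
  have hTT : inner ℝ (B : Space3) (cross3 C A) = inner ℝ (C : Space3) (cross3 D B) :=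
    (mul_self_inj hT.le hT'.le).mp (t1.trans t3.symm)
  have hUU := triple_eq_of_symmetric hBB hCC hAB hBC hCD hAC hBD hx hTT
  -- With `T` for `[B, C, A] = [C, D, B]` and `U` for `[A, B, D] = [D, A, C]`, pairing with `B - C`
  -- gives `T (x - p) = U (1 - x)`, and hence `p < x`.
  have hlin := congrArg (inner ℝ ((B : Space3) - C)) (triple_linear_relation (A : Space3) B C D)
  simp only [inner_sub_left, inner_add_right, inner_sub_right, real_inner_smul_right,
    inner_zero_right, ← hTT, ← hUU, hBB, hCC, hBA, hCA, hBC, hCB, hCD, hBD] at hlin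
  have hxp : p < x := by
    have h4 : inner ℝ (B : Space3) (cross3 C A) * (x - p) =
        inner ℝ (A : Space3) (cross3 B D) * (1 - x) := by linear_combination hlin / 2
    have h5 : 0 < inner ℝ (B : Space3) (cross3 C A) * (x - p) := by
      rw [h4]; exact mul_pos hU (by linarith)
    have := (mul_pos_iff_of_pos_left hT).mp h5
    linarith
  -- If `p = -x`, the smaller of `β, γ` is at most `π / 2`, so `p ≥ x ^ 2 ≥ 0`, against `p < x =
  -- -p`. Otherwise `y = 1 + x - p > 1`, which no cosine allows.
  have hcases : (p + x) * (1 + x - y - p) = 0 := by linear_combination r1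
  rcases mul_eq_zero.mp hcases with h | h
  · have hcos : 0 ≤ p - x * x := by
      rcases le_total β (Real.pi / 2) with hb | hb
      · rw [g1]
        exact mul_nonneg hm.le (Real.cos_nonneg_of_mem_Icc ⟨by linarith, hb⟩)
      · rw [g3]
        exact mul_nonneg hm.le (Real.cos_nonneg_of_mem_Icc ⟨by linarith, by linarith⟩)
    linarith [mul_self_nonneg x]
  · linarith

theorem innerAngle_eq_of_three_equal_sides' (Q : SphQuadrangle) {k₀ ε : Fin 4}
    (hε : ε = 1 ∨ ε = -1)
    (h1 : sphDist (Q.corner k₀) (Q.corner (k₀ + ε)) =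
      sphDist (Q.corner (k₀ + ε)) (Q.corner (k₀ + ε * 2)))
    (h2 : sphDist (Q.corner (k₀ + ε)) (Q.corner (k₀ + ε * 2)) =
      sphDist (Q.corner (k₀ + ε * 2)) (Q.corner (k₀ + ε * 3)))
    (hβγ : Q.innerAngle (k₀ + ε) = Q.innerAngle (k₀ + ε * 2)) :
    Q.innerAngle k₀ = Q.innerAngle (k₀ + ε * 3) := by
  rcases hε with rfl | rfl
  · simp only [one_mul] at *
    exact Q.innerAngle_eq_of_three_equal_sides k₀ h1 h2 hβγ
  -- For `ε = -1` the corners are read backwards: the end angles change places, as do the middle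
  -- ones.
  · obtain ⟨k, rfl⟩ : ∃ k, k₀ = k + 3 := ⟨k₀ - 3, by simp⟩
    rw [(by decide : ∀ k : Fin 4, k + 3 + -1 = k + 2) k,
      (by decide : ∀ k : Fin 4, k + 3 + -1 * 2 = k + 1) k] at *
    rw [(by decide : ∀ k : Fin 4, k + 3 + -1 * 3 = k) k] at *
    have hc : ∀ p q, sphDist p q = sphDist q p := fun p q => InnerProductGeometry.angle_comm _ _
    exact (Q.innerAngle_eq_of_three_equal_sides k (by rw [hc, ← h2, hc])
      (by rw [hc, ← h1, hc]) hβγ.symm).symm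

theorem false_of_angle_relations' (Q : SphQuadrangle) {k₀ ε : Fin 4}
    (hε : ε = 1 ∨ ε = -1)
    (h1 : sphDist (Q.corner k₀) (Q.corner (k₀ + ε)) =
      sphDist (Q.corner (k₀ + ε)) (Q.corner (k₀ + ε * 2)))
    (h2 : sphDist (Q.corner (k₀ + ε)) (Q.corner (k₀ + ε * 2)) =
      sphDist (Q.corner (k₀ + ε * 2)) (Q.corner (k₀ + ε * 3)))
    (hαβ : 2 * Q.innerAngle k₀ + Q.innerAngle (k₀ + ε) = 2 * Real.pi)
    (hδγ : 2 * Q.innerAngle (k₀ + ε * 3) + Q.innerAngle (k₀ + ε * 2) = 2 * Real.pi)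
    (hβγ : Q.innerAngle (k₀ + ε) + Q.innerAngle (k₀ + ε * 2) ≤ Real.pi) : False := by
  rcases hε with rfl | rfl
  · simp only [one_mul] at *
    exact Q.false_of_angle_relations k₀ h1 h2 hαβ hδγ hβγ
  · obtain ⟨k, rfl⟩ : ∃ k, k₀ = k + 3 := ⟨k₀ - 3, by simp⟩
    rw [(by decide : ∀ k : Fin 4, k + 3 + -1 = k + 2) k,
      (by decide : ∀ k : Fin 4, k + 3 + -1 * 2 = k + 1) k] at *
    rw [(by decide : ∀ k : Fin 4, k + 3 + -1 * 3 = k) k] at *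
    have hc : ∀ p q, sphDist p q = sphDist q p := fun p q => InnerProductGeometry.angle_comm _ _
    exact Q.false_of_angle_relations k (by rw [hc, ← h2, hc])
      (by rw [hc, ← h1, hc]) hδγ hαβ (by linarith)

end SphQuadrangle

/-! ### Orientations of the tiles around the wheel when `a = c` -/

/-- The vertex relations of a pseudo-double wheel force a coherent choice of the orientations `x`
and `y` of the northern and southern tiles, unless the tile is symmetric. -/
theorem orientations_coherent {n : ℕ} [NeZero n] (hn : 3 ≤ n) {α β γ δ : ℝ}
    (x y : ZMod n → Bool) (base pole : Bool → ℝ)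
    (hbt : base true = δ) (hbf : base false = α) (hpt : pole true = γ) (hpf : pole false = β)
    (hev : ∀ i, base (!y i) + base (x i) + pole (!x (i - 1)) = 2 * Real.pi)
    (hod : ∀ i, base (!x i) + base (y i) + pole (!y (i + 1)) = 2 * Real.pi)
    (hN : ∑ i, pole (x i) = 2 * Real.pi) (hS : ∑ i, pole (y i) = 2 * Real.pi)
    (hsymm : β = γ → α = δ)
    (hexcl : 2 * α + β = 2 * Real.pi → 2 * δ + γ = 2 * Real.pi → β + γ ≤ Real.pi → False) :
    (α = δ ∧ β = γ) ∨ ∃ t, ∀ i, x i = t ∧ y i = t := by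
  have hpi := Real.pi_pos
  by_cases hβγ : β = γ
  · exact Or.inl ⟨hsymm hβγ, hβγ⟩
  have hpole : ∀ {s t : Bool}, pole s = pole t → s = t := by
    rintro (_ | _) (_ | _) h
    · rfl
    · rw [hpt, hpf] at h; exact absurd h hβγ
    · rw [hpt, hpf] at h; exact absurd h.symm hβγ
    · rfl
  have hpole_add : ∀ s, pole s + pole (!s) = β + γ := by
    rintro (_ | _) <;> simp [hpt, hpf, add_comm]
  have hbase_add : ∀ s, base (!s) + base s = α + δ := by
    rintro (_ | _) <;> simp [hbt, hbf, add_comm]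
  right
  -- if the base angles always add up to the same value then all orientations agree
  have hconst : ∀ c, (∀ i, base (!y i) + base (x i) = c) → (∀ i, base (!x i) + base (y i) = c) →
      ∃ t, ∀ i, x i = t ∧ y i = t := by
    intro c h1 h2
    have hx : ∀ i, pole (!x i) = 2 * Real.pi - c := fun i => by
      have := hev (i + 1)
      rw [h1, add_sub_cancel_right] at this
      linarith
    have hy : ∀ i, pole (!y i) = 2 * Real.pi - c := fun i => by
      have := hod (i - 1)
      rw [h2, sub_add_cancel] at this
      linarith
    refine ⟨x 0, fun i => ⟨?_, ?_⟩⟩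
    · exact Bool.not_inj (hpole ((hx i).trans (hx 0).symm))
    · exact Bool.not_inj (hpole ((hy i).trans (hx 0).symm))
  by_cases hαδ : α = δ
  · have hb : ∀ s, base s = α := by
      rintro (_ | _)
      · exact hbf
      · rw [hbt, hαδ]
    exact hconst (α + α) (fun i => by rw [hb, hb]) (fun i => by rw [hb, hb])
  have hbase : ∀ s, base s ≠ base (!s) := by
    rintro (_ | _)
    · simpa [hbt, hbf] using hαδ
    · simpa [hbt, hbf] using Ne.symm hαδ
  -- If `x = y` throughout, the two base angles coming from the same pair of tiles always add up to
  -- `α + δ`. Otherwise some pair is mixed, and the relations there are propagated to all pairs.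
  by_cases hxy : ∀ i, y i = x i
  · exact hconst (α + δ) (fun i => by rw [hxy, hbase_add]) (fun i => by rw [hxy, hbase_add])
  exfalso
  push Not at hxy
  obtain ⟨i, hi⟩ := hxy
  have hyi : y i = !x i := by
    revert hi; cases x i <;> cases y i <;> simp
  have h1 := hev i
  have h2 := hod i
  rw [hyi, Bool.not_not] at h1
  rw [hyi] at h2
  have h3 : y (i + 1) = !x (i - 1) := by
    by_contra h
    have h4 : y (i + 1) = x (i - 1) := by
      revert h; cases x (i - 1) <;> cases y (i + 1) <;> simp
    rw [h4] at h2
    exact hbase (x i) (by linarith)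
  rw [h3, Bool.not_not] at h2
  -- An unmixed pair would force a pole angle equal to `2π - (α + δ)`, by this relation the mean of
  -- `β` and `γ`; as `β ≠ γ`, every pair is mixed.
  have hsum : 2 * (α + δ) + (β + γ) = 4 * Real.pi := by
    rw [← hbase_add (x i), ← hpole_add (x (i - 1))]
    linarith
  have hmixed : ∀ j, y j = !x j := by
    intro j
    by_contra h
    have h4 : y j = x j := by
      revert h; cases x j <;> cases y j <;> simp
    have h5 := hev j
    rw [h4, hbase_add] at h5
    have h6 := hpole_add (x (j - 1))
    have h7 : pole (x (j - 1)) = pole (!x (j - 1)) := by linarith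
    exact absurd (hpole h7) (by cases x (j - 1) <;> simp)
  have hev' : ∀ j, 2 * base (x j) + pole (!x (j - 1)) = 2 * Real.pi := fun j => by
    have := hev j
    rw [hmixed, Bool.not_not] at this
    linarith
  have hcard : ∑ _i : ZMod n, (β + γ) = n * (β + γ) := by
    rw [Finset.sum_const, Finset.card_univ, ZMod.card, nsmul_eq_mul]
  -- Here `x` turns out constant and `y` its negation, so the sums at the two poles are `n` times
  -- different angles, though both are `2π`.
  by_cases hu : x (i - 1) = x i
  · rw [hu] at h1 h2
    have hrel : ∀ t, 2 * base t + pole (!t) = 2 * Real.pi := by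
      intro t
      by_cases ht : t = x i
      · rw [ht]; linarith
      · have : t = !x i := by revert ht; cases x i <;> cases t <;> simp
        rw [this, Bool.not_not]; linarith
    have hstep : ∀ j, x (j - 1) = x j := fun j => by
      have e1 := hev' j
      have e2 := hrel (x j)
      exact Bool.not_inj (hpole (by linarith))
    have hstep' : ∀ m : ℕ, x m = x 0 := by
      intro m
      induction m with
      | zero => simp
      | succ m ih => rw [← ih, ← hstep (m + 1 : ℕ)]; simp
    have hall : ∀ j, x j = x 0 := fun j => by
      have := hstep' j.val
      rwa [ZMod.natCast_zmod_val] at this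
    have hN' : n * pole (x 0) = 2 * Real.pi := by
      rw [← hN, Finset.sum_congr rfl (fun j _ => by rw [hall j])]
      simp [ZMod.card]
    have hS' : n * pole (!x 0) = 2 * Real.pi := by
      rw [← hS, Finset.sum_congr rfl (fun j _ => by rw [hmixed j, hall j])]
      simp [ZMod.card]
    have h7 : pole (x 0) = pole (!x 0) :=
      mul_left_cancel₀ (by positivity : (n : ℝ) ≠ 0) (hN'.trans hS'.symm)
    exact absurd (hpole h7) (by cases x 0 <;> simp)
  -- This is the pattern of `Q_F`: `x` alternates, so `n` is not `3`, and the sum at the pole gives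
  -- `n (β + γ) = 4π` with `n ≥ 4`.
  · have hu' : x (i - 1) = !x i := by
      revert hu; cases x (i - 1) <;> cases x i <;> simp
    rw [hu', Bool.not_not] at h1
    rw [hu'] at h2
    have hrel : ∀ t, 2 * base t + pole t = 2 * Real.pi := by
      intro t
      by_cases ht : t = x i
      · rw [ht]; linarith
      · have : t = !x i := by revert ht; cases x i <;> cases t <;> simp
        rw [this]; linarith
    have hstep : ∀ j, x (j + 1) = !x j := fun j => by
      have e1 := hev' (j + 1)
      have e2 := hrel (x (j + 1))
      rw [add_sub_cancel_right] at e1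
      exact hpole (by linarith)
    have hr1 := hrel true
    have hr2 := hrel false
    rw [hbt, hpt] at hr1
    rw [hbf, hpf] at hr2
    refine hexcl hr2 hr1 ?_
    have hn4 : 4 ≤ n := by
      by_contra h
      obtain rfl : n = 3 := by omega
      have e1 := hstep 0
      have e2 := hstep (0 + 1)
      have e3 := hstep (0 + 1 + 1)
      rw [e2, e1, (by decide : (0 + 1 + 1 + 1 : ZMod 3) = 0)] at e3
      revert e3; cases x 0 <;> simp
    have hdouble : n * (β + γ) = 4 * Real.pi := by
      rw [← hcard, ← Finset.sum_congr rfl (fun j _ => hpole_add (x j)), Finset.sum_add_distrib, hN]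
      have : ∑ j, pole (!x j) = ∑ j, pole (x (j + 1)) :=
        Finset.sum_congr rfl (fun j _ => by rw [hstep j])
      have hshift := Equiv.sum_comp (Equiv.addRight (1 : ZMod n)) (fun j => pole (x j))
      simp only [Equiv.coe_addRight] at hshift
      rw [this, hshift, hN]
      ring
    have hn4' : (4 : ℝ) ≤ n := by exact_mod_cast hn4
    by_contra hcon
    push Not at hcon
    nlinarith

/-! ### Positions of a tile relative to a pole -/

open PdwVertex AngleType

section Placement

variable {V : Type} (L : V → V → ℝ) (A : V → V → V → ℝ) (ℓ : SideLengths) (val : AngleType → ℝ)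

/-- The tile with corners `p₀ p₁ p₂ p₃` has its angle `γ` at `p₀` and its side `b` from `p₁` to
`p₂`. -/
structure Placed (p₀ p₁ p₂ p₃ : V) : Prop where
  len₀ : L p₀ p₁ = ℓ.a
  len₁ : L p₁ p₂ = ℓ.b
  len₂ : L p₂ p₃ = ℓ.c
  len₃ : L p₃ p₀ = ℓ.a
  ang₀ : A p₁ p₀ p₃ = val gamma
  ang₁ : A p₂ p₁ p₀ = val delta
  ang₂ : A p₃ p₂ p₁ = val alpha
  ang₃ : A p₀ p₃ p₂ = val beta

/-- The tile with corners `p₀ p₁ p₂ p₃` has its angle `β` at `p₀` and its side `b` from `p₁` to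
`p₂`. -/
structure Flipped (p₀ p₁ p₂ p₃ : V) : Prop where
  len₀ : L p₀ p₁ = ℓ.c
  len₁ : L p₁ p₂ = ℓ.b
  len₂ : L p₂ p₃ = ℓ.a
  len₃ : L p₃ p₀ = ℓ.a
  ang₀ : A p₁ p₀ p₃ = val beta
  ang₁ : A p₂ p₁ p₀ = val alpha
  ang₂ : A p₃ p₂ p₁ = val delta
  ang₃ : A p₀ p₃ p₂ = val gamma

/-- Exchange of `α` with `δ` and of `β` with `γ`. -/
def AngleType.swap : AngleType → AngleType
  | alpha => delta
  | beta => gamma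
  | gamma => beta
  | delta => alpha

variable {L A ℓ val}

theorem Flipped.placed_swap (hac : ℓ.a = ℓ.c) {p₀ p₁ p₂ p₃ : V}
    (h : Flipped L A ℓ val p₀ p₁ p₂ p₃) : Placed L A ℓ (val ∘ AngleType.swap) p₀ p₁ p₂ p₃ :=
  ⟨h.len₀.trans hac.symm, h.len₁, h.len₂.trans hac, h.len₃, h.ang₀, h.ang₁, h.ang₂, h.ang₃⟩

theorem Flipped.placed (hac : ℓ.a = ℓ.c) (h1 : val alpha = val delta) (h2 : val beta = val gamma)
    {p₀ p₁ p₂ p₃ : V} (h : Flipped L A ℓ val p₀ p₁ p₂ p₃) : Placed L A ℓ val p₀ p₁ p₂ p₃ :=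
  ⟨h.len₀.trans hac.symm, h.len₁, h.len₂.trans hac, h.len₃, h.ang₀.trans h2, h.ang₁.trans h1,
    h.ang₂.trans h1.symm, h.ang₃.trans h2.symm⟩

end Placement

/-- The possible positions of a tile whose side `b` is not incident with its corner `0`. -/
theorem tile_positions {D : Fin 4 → Fin 4 → ℝ} (hD : ∀ i j, D i j = D j i) {θ : Fin 4 → ℝ}
    {a b c α β γ δ : ℝ}
    (h : ∃ m ε : Fin 4, (ε = 1 ∨ ε = -1) ∧
      (∀ j, D (m + ε * j) (m + ε * (j + 1)) = ![c, a, a, b] j) ∧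
      ∀ j, θ (m + ε * j) = ![α, β, γ, δ] j)
    (h01 : D 0 1 ≠ b) (h30 : D 3 0 ≠ b) :
    (D 0 1 = a ∧ D 1 2 = b ∧ D 2 3 = c ∧ D 3 0 = a ∧ θ 0 = γ ∧ θ 1 = δ ∧ θ 2 = α ∧ θ 3 = β) ∨
    (D 0 1 = c ∧ D 1 2 = b ∧ D 2 3 = a ∧ D 3 0 = a ∧ θ 0 = β ∧ θ 1 = α ∧ θ 2 = δ ∧ θ 3 = γ) ∨
    (D 0 3 = a ∧ D 3 2 = b ∧ D 2 1 = c ∧ D 1 0 = a ∧ θ 0 = γ ∧ θ 3 = δ ∧ θ 2 = α ∧ θ 1 = β) ∨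
    (D 0 3 = c ∧ D 3 2 = b ∧ D 2 1 = a ∧ D 1 0 = a ∧ θ 0 = β ∧ θ 3 = α ∧ θ 2 = δ ∧ θ 1 = γ) := by
  obtain ⟨m, ε, hε, hlen, hang⟩ := h
  have l0 := hlen 0
  have l1 := hlen 1
  have l2 := hlen 2
  have l3 := hlen 3
  have a0 := hang 0
  have a1 := hang 1
  have a2 := hang 2
  have a3 := hang 3
  -- The side `b` joins the corners `m - ε` and `m`; for two of the four values of `m` one of these
  -- is corner `0`, which is excluded.
  rcases hε with rfl | rfl
  · fin_cases m
    · exact absurd l3 h30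
    · exact absurd l3 h01
    · exact Or.inl ⟨l2, l3, l0, l1, a2, a3, a0, a1⟩
    · refine Or.inr (Or.inr (Or.inr ⟨?_, ?_, ?_, ?_, a1, a0, a3, a2⟩)) <;> rw [hD]
      exacts [l0, l3, l2, l1]
  · fin_cases m
    · exact absurd ((hD _ _).trans l3) h01
    · refine Or.inr (Or.inl ⟨?_, ?_, ?_, ?_, a1, a0, a3, a2⟩) <;> rw [hD]
      exacts [l0, l3, l2, l1]
    · exact Or.inr (Or.inr (Or.inl ⟨l2, l3, l0, l1, a2, a3, a0, a1⟩))
    · exact absurd ((hD _ _).trans l3) h30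

/-- The angles around every vertex of the pseudo-double wheel add up to `2π`. -/
structure AngleSums {F : ℕ} [NeZero (F / 2)] (A : PdwVertex F → PdwVertex F → PdwVertex F → ℝ) :
    Prop where
  north : ∑ i, A (ev i) N (ev (i + 1)) = 2 * Real.pi
  south : ∑ i, A (od i) S (od (i - 1)) = 2 * Real.pi
  even : ∀ i, A (od (i - 1)) (ev i) (od i) + A (od i) (ev i) N + A N (ev i) (od (i - 1)) =
    2 * Real.pi
  odd : ∀ i, A (ev (i + 1)) (od i) (ev i) + A (ev i) (od i) S + A S (od i) (ev (i + 1)) =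
    2 * Real.pi

/-- Lengths and angles are those of the chart `P_F`. -/
structure Coherent {F : ℕ} (ℓ : SideLengths) (L : PdwVertex F → PdwVertex F → ℝ)
    (A : PdwVertex F → PdwVertex F → PdwVertex F → ℝ) (val : AngleType → ℝ) : Prop where
  len : ∀ u v, pdwAdj u v → L u v = pdwLen ℓ u v
  ang : ∀ u v w, pdwAngle u v w → A u v w = val (pAng u v w)

theorem coherent_of_placed {F : ℕ} (hF : 6 ≤ F) {ℓ : SideLengths}
    {L : PdwVertex F → PdwVertex F → ℝ} (hL : ∀ u v, L u v = L v u)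
    {A : PdwVertex F → PdwVertex F → PdwVertex F → ℝ} {val : AngleType → ℝ}
    (hN : ∀ i, Placed L A ℓ val N (ev i) (od i) (ev (i + 1)))
    (hS : ∀ i, Placed L A ℓ val S (od i) (ev i) (od (i - 1))) : Coherent ℓ L A val := by
  -- This gives `i - 1 ≠ i`, so that the edges of length `b` and those of length `c` are told apart
  -- by `pdwLen`.
  have : Fact (1 < F / 2) := ⟨by omega⟩
  have hN' : ∀ i, Placed L A ℓ val N (ev (i - 1)) (od (i - 1)) (ev i) := fun i => by
    have := hN (i - 1)
    rwa [sub_add_cancel] at this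
  have hS' : ∀ i, Placed L A ℓ val S (od (i + 1)) (ev (i + 1)) (od i) := fun i => by
    have := hS (i + 1)
    rwa [add_sub_cancel_right] at this
  constructor
  · rintro (_ | _ | i | i) (_ | _ | j | j) h <;> simp only [pdwAdj] at h <;> simp only [pdwLen]
    · exact (hN j).len₀
    · exact (hS j).len₀
    · rw [hL]; exact (hN i).len₀
    · rcases h with rfl | rfl
      · rw [if_pos rfl]; exact (hN _).len₁
      · rw [if_neg (by simp), hL]; exact (hN' _).len₂
    · rw [hL]; exact (hS i).len₀
    · rcases h with rfl | rfl
      · rw [if_pos rfl]; exact (hS _).len₁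
      · rw [if_neg (by simp)]; exact (hN' _).len₂
  · rintro (_ | _ | i | i) (_ | _ | j | j) (_ | _ | k | k) h <;> simp only [pdwAngle] at h <;>
      simp only [pAng]
    · subst h; exact (hN' _).ang₃
    · subst h; exact (hS' _).ang₃
    · subst h; exact (hN _).ang₀
    · subst h; exact (hS _).ang₁
    · obtain ⟨rfl, rfl⟩ := h; exact (hN _).ang₂
    · subst h; exact (hS _).ang₀
    · subst h; exact (hN _).ang₁
    · obtain ⟨rfl, rfl⟩ := h; exact (hS _).ang₂

/-- If all tiles have their side `b` on the edges `v_{2i} v_{2i+1}` then lengths and angles are those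
of the chart `P_F`. -/
theorem exists_coherent {F : ℕ} [NeZero (F / 2)] (hF : 6 ≤ F) {ℓ : SideLengths}
    {L : PdwVertex F → PdwVertex F → ℝ} (hL : ∀ u v, L u v = L v u)
    {A : PdwVertex F → PdwVertex F → PdwVertex F → ℝ} (hA : AngleSums A) {val : AngleType → ℝ}
    (hN : ∀ i, Placed L A ℓ val N (ev i) (od i) (ev (i + 1)) ∨
      Flipped L A ℓ val N (ev i) (od i) (ev (i + 1)))
    (hS : ∀ i, Placed L A ℓ val S (od i) (ev i) (od (i - 1)) ∨
      Flipped L A ℓ val S (od i) (ev i) (od (i - 1)))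
    (hsymm : ℓ.a = ℓ.c → val beta = val gamma → val alpha = val delta)
    (hexcl : ℓ.a = ℓ.c → 2 * val alpha + val beta = 2 * Real.pi →
      2 * val delta + val gamma = 2 * Real.pi → val beta + val gamma ≤ Real.pi → False) :
    ∃ val', Coherent ℓ L A val' := by
  by_cases hac : ℓ.a = ℓ.c
  · classical
    -- A tile may satisfy both `Placed` and `Flipped`; its bit is then `true`. Only the implications
    -- `hx` and `hy` are used later.
    let x : ZMod (F / 2) → Bool := fun i =>
      decide (Placed L A ℓ val N (ev i) (od i) (ev (i + 1)))
    let y : ZMod (F / 2) → Bool := fun i =>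
      decide (Placed L A ℓ val S (od i) (ev i) (od (i - 1)))
    have hx : ∀ i, (x i = true ∧ Placed L A ℓ val N (ev i) (od i) (ev (i + 1))) ∨
        (x i = false ∧ Flipped L A ℓ val N (ev i) (od i) (ev (i + 1))) := by
      intro i
      by_cases h : Placed L A ℓ val N (ev i) (od i) (ev (i + 1))
      · exact Or.inl ⟨decide_eq_true h, h⟩
      · exact Or.inr ⟨decide_eq_false h, (hN i).resolve_left h⟩
    have hy : ∀ i, (y i = true ∧ Placed L A ℓ val S (od i) (ev i) (od (i - 1))) ∨
        (y i = false ∧ Flipped L A ℓ val S (od i) (ev i) (od (i - 1))) := by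
      intro i
      by_cases h : Placed L A ℓ val S (od i) (ev i) (od (i - 1))
      · exact Or.inl ⟨decide_eq_true h, h⟩
      · exact Or.inr ⟨decide_eq_false h, (hS i).resolve_left h⟩
    clear_value x y
    -- For a tile with bit `s`, the ends of its side `b` have angles `base s` and `base (!s)`; the
    -- pole and the remaining corner have angles `pole s` and `pole (!s)`.
    let base : Bool → ℝ := fun s => if s then val delta else val alpha
    let pole : Bool → ℝ := fun s => if s then val gamma else val beta
    have hxang : ∀ i, A (ev i) N (ev (i + 1)) = pole (x i) ∧ A (od i) (ev i) N = base (x i) ∧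
        A (ev (i + 1)) (od i) (ev i) = base (!x i) ∧ A N (ev (i + 1)) (od i) = pole (!x i) := by
      intro i
      rcases hx i with ⟨h, h'⟩ | ⟨h, h'⟩ <;> rw [h] <;>
        exact ⟨h'.ang₀, h'.ang₁, h'.ang₂, h'.ang₃⟩
    have hyang : ∀ i, A (od i) S (od (i - 1)) = pole (y i) ∧ A (ev i) (od i) S = base (y i) ∧
        A (od (i - 1)) (ev i) (od i) = base (!y i) ∧ A S (od (i - 1)) (ev i) = pole (!y i) := by
      intro i
      rcases hy i with ⟨h, h'⟩ | ⟨h, h'⟩ <;> rw [h] <;>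
        exact ⟨h'.ang₀, h'.ang₁, h'.ang₂, h'.ang₃⟩
    rcases orientations_coherent (by omega) x y base pole rfl rfl rfl rfl
      (fun i => by
        have h := (hxang (i - 1)).2.2.2
        rw [sub_add_cancel] at h
        rw [← (hyang i).2.2.1, ← (hxang i).2.1, ← h]
        exact hA.even i)
      (fun i => by
        have h := (hyang (i + 1)).2.2.2
        rw [add_sub_cancel_right] at h
        rw [← (hxang i).2.2.1, ← (hyang i).2.1, ← h]
        exact hA.odd i)
      (by rw [← hA.north]; exact Finset.sum_congr rfl fun i _ => (hxang i).1.symm)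
      (by rw [← hA.south]; exact Finset.sum_congr rfl fun i _ => (hyang i).1.symm)
      (hsymm hac) (hexcl hac) with ⟨h1, h2⟩ | ⟨t, ht⟩
    · exact ⟨val, coherent_of_placed hF hL (fun i => (hN i).elim id (Flipped.placed hac h1 h2))
        (fun i => (hS i).elim id (Flipped.placed hac h1 h2))⟩
    · cases t
      -- All tiles are flipped; renaming the angles turns this into the chart `P_F`, the lengths
      -- being unaffected as `a = c`.
      · refine ⟨val ∘ AngleType.swap, coherent_of_placed hF hL (fun i => ?_) (fun i => ?_)⟩
        · rcases hx i with ⟨h, -⟩ | ⟨-, h⟩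
          · rw [(ht i).1] at h; exact absurd h (by simp)
          · exact h.placed_swap hac
        · rcases hy i with ⟨h, -⟩ | ⟨-, h⟩
          · rw [(ht i).2] at h; exact absurd h (by simp)
          · exact h.placed_swap hac
      · refine ⟨val, coherent_of_placed hF hL (fun i => ?_) (fun i => ?_)⟩
        · rcases hx i with ⟨-, h⟩ | ⟨h, -⟩
          · exact h
          · rw [(ht i).1] at h; exact absurd h (by simp)
        · rcases hy i with ⟨-, h⟩ | ⟨h, -⟩
          · exact h
          · rw [(ht i).2] at h; exact absurd h (by simp)
  · refine ⟨val, coherent_of_placed hF hL (fun i => ?_) (fun i => ?_)⟩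
    -- The edge from the pole to `v_{2i}` is also the last side of the previous northern tile, which
    -- has length `a` in either position; a flipped tile would give it length `c`.
    · refine (hN i).resolve_right fun h => hac ?_
      have h1 : L (ev i) N = ℓ.a := by
        have h2 := hN (i - 1)
        rw [sub_add_cancel] at h2
        exact h2.elim Placed.len₃ Flipped.len₃
      rw [← h1, hL, h.len₀]
    · refine (hS i).resolve_right fun h => hac ?_
      have h1 : L (od i) S = ℓ.a := by
        have h2 := hS (i + 1)
        rw [add_sub_cancel_right] at h2
        exact h2.elim Placed.len₃ Flipped.len₃
      rw [← h1, hL, h.len₀]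

/-! ### The reflection of the wheel -/

/-- The reflection of the pseudo-double wheel that maps `v_j` to `v_{-j}`. -/
def reflect {F : ℕ} : PdwVertex F → PdwVertex F
  | N => N
  | S => S
  | ev i => ev (-i)
  | od i => od (-i - 1)

theorem reflect_reflect {F : ℕ} (v : PdwVertex F) : reflect (reflect v) = v := by
  rcases v with _ | _ | i | i <;> simp [reflect]

theorem pdwAdj_reflect {F : ℕ} (u v : PdwVertex F) :
    pdwAdj (reflect u) (reflect v) ↔ pdwAdj u v := by
  rcases u with _ | _ | i | i <;> rcases v with _ | _ | j | j <;> simp only [reflect, pdwAdj]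
  · constructor <;> rintro (h | h)
    · right; linear_combination -h
    · left; linear_combination -h
    · right; linear_combination -h
    · left; linear_combination -h
  · constructor <;> rintro (h | h)
    · right; linear_combination -h
    · left; linear_combination -h
    · right; linear_combination -h
    · left; linear_combination -h

/-- The reflection reverses all cyclic orders, so the wheel is isomorphic to its mirror image. -/
theorem pdwAngle_reflect {F : ℕ} (u v w : PdwVertex F) :
    pdwAngle (reflect u) (reflect v) (reflect w) ↔ pdwAngle w v u := by
  rcases u with _ | _ | i | i <;> rcases v with _ | _ | j | j <;> rcases w with _ | _ | k | k <;>
    simp only [reflect, pdwAngle]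
  · constructor <;> intro h <;> linear_combination -h
  · constructor <;> intro h <;> linear_combination -h
  · constructor <;> intro h <;> linear_combination h
  · constructor <;> intro h <;> linear_combination -h
  · constructor
    · rintro ⟨h1, h2⟩; exact ⟨by linear_combination -h2, by linear_combination -h1⟩
    · rintro ⟨h1, h2⟩; exact ⟨by linear_combination -h2, by linear_combination -h1⟩
  · constructor <;> intro h <;> linear_combination h
  · constructor <;> intro h <;> linear_combination -h
  · constructor
    · rintro ⟨h1, h2⟩; exact ⟨by linear_combination -h2, by linear_combination -h1⟩
    · rintro ⟨h1, h2⟩; exact ⟨by linear_combination -h2, by linear_combination -h1⟩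

theorem AngleSums.reflect {F : ℕ} [NeZero (F / 2)]
    {A : PdwVertex F → PdwVertex F → PdwVertex F → ℝ} (hA : AngleSums A) :
    AngleSums fun u v w => A (reflect w) (reflect v) (reflect u) where
  north := by
    -- Reflection and reversal of the arguments send the northern angle with index `i` to the one
    -- with index `-1 - i`; for the southern angles below, `i` goes to `-i`.
    rw [← hA.north, ← Equiv.sum_comp (Equiv.subLeft (-1 : ZMod (F / 2)))]
    refine Finset.sum_congr rfl fun i _ => ?_
    simp only [_root_.reflect, Equiv.subLeft_apply]
    rw [show -(-1 - i + 1) = i by ring, show -(-1 - i) = i + 1 by ring]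
  south := by
    rw [← hA.south, ← Equiv.sum_comp (Equiv.neg (ZMod (F / 2)))]
    refine Finset.sum_congr rfl fun i _ => ?_
    simp only [_root_.reflect, Equiv.neg_apply]
    rw [show -(-i - 1) - 1 = i by ring, neg_neg]
  even i := by
    have h := hA.even (-i)
    simp only [_root_.reflect]
    rw [show -(i - 1) - 1 = -i by ring]
    linarith
  odd i := by
    have h := hA.odd (-i - 1)
    simp only [_root_.reflect]
    rw [sub_add_cancel] at h
    rw [show -(i + 1) = -i - 1 by ring]
    linarith

/-! ### Sums over the angles at a vertex -/

theorem finsum_mem_swap {V : Type} (R : V → V → Prop) (f : V → V → ℝ) :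
    ∑ᶠ p ∈ {p : V × V | R p.2 p.1}, f p.2 p.1 = ∑ᶠ p ∈ {p : V × V | R p.1 p.2}, f p.1 p.2 :=
  finsum_comp_equiv (Equiv.prodComm V V)
    (f := fun p : V × V => ∑ᶠ _ : p ∈ {p : V × V | R p.1 p.2}, f p.1 p.2)

theorem finsum_mem_three {ι : Type} {s : Set ι} {a b c : ι} (hs : ∀ x, x ∈ s ↔ x = a ∨ x = b ∨ x = c)
    (hab : a ≠ b) (hac : a ≠ c) (hbc : b ≠ c) (f : ι → ℝ) :
    ∑ᶠ x ∈ s, f x = f a + f b + f c := by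
  classical
  have : s = (({a, b, c} : Finset ι) : Set ι) := by
    ext x; simp [hs]
  rw [this, finsum_mem_coe_finset, Finset.sum_insert (by simp [hab, hac]),
    Finset.sum_insert (by simp [hbc]), Finset.sum_singleton, add_assoc]

section

variable {F : ℕ} (f : PdwVertex F → PdwVertex F → ℝ)

theorem finsum_angles_north [NeZero (F / 2)] :
    ∑ᶠ p ∈ {p : PdwVertex F × PdwVertex F | pdwAngle p.1 N p.2}, f p.1 p.2 =
      ∑ i, f (ev i) (ev (i + 1)) := by
  have h : {p : PdwVertex F × PdwVertex F | pdwAngle p.1 N p.2} =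
      Set.range fun i : ZMod (F / 2) => (ev i, ev (i + 1)) := by
    ext ⟨u, w⟩
    rcases u with _ | _ | i | i <;> rcases w with _ | _ | j | j <;>
      simp [pdwAngle, eq_comm]
  rw [h, finsum_mem_range (fun i j hij => by simpa using hij), finsum_eq_sum_of_fintype]

theorem finsum_angles_south [NeZero (F / 2)] :
    ∑ᶠ p ∈ {p : PdwVertex F × PdwVertex F | pdwAngle p.1 S p.2}, f p.1 p.2 =
      ∑ i, f (od i) (od (i - 1)) := by
  have h : {p : PdwVertex F × PdwVertex F | pdwAngle p.1 S p.2} =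
      Set.range fun i : ZMod (F / 2) => (od i, od (i - 1)) := by
    ext ⟨u, w⟩
    rcases u with _ | _ | i | i <;> rcases w with _ | _ | j | j <;>
      simp [pdwAngle, eq_comm]
  rw [h, finsum_mem_range (fun i j hij => by simpa using hij), finsum_eq_sum_of_fintype]

theorem finsum_angles_even (hF : 6 ≤ F) (k : ZMod (F / 2)) :
    ∑ᶠ p ∈ {p : PdwVertex F × PdwVertex F | pdwAngle p.1 (ev k) p.2}, f p.1 p.2 =
      f (od (k - 1)) (od k) + f (od k) N + f N (od (k - 1)) := by
  have : Fact (1 < F / 2) := ⟨by omega⟩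
  refine finsum_mem_three (a := (od (k - 1), od k)) (b := (od k, N)) (c := (N, od (k - 1)))
    (fun p => ?_) (by simp) (by simp) (by simp)
    fun p : PdwVertex F × PdwVertex F => f p.1 p.2
  obtain ⟨u, w⟩ := p
  rcases u with _ | _ | i | i <;> rcases w with _ | _ | j | j <;> simp [pdwAngle]

theorem finsum_angles_odd (hF : 6 ≤ F) (k : ZMod (F / 2)) :
    ∑ᶠ p ∈ {p : PdwVertex F × PdwVertex F | pdwAngle p.1 (od k) p.2}, f p.1 p.2 =
      f (ev (k + 1)) (ev k) + f (ev k) S + f S (ev (k + 1)) := by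
  have : Fact (1 < F / 2) := ⟨by omega⟩
  refine finsum_mem_three (a := (ev (k + 1), ev k)) (b := (ev k, S)) (c := (S, ev (k + 1)))
    (fun p => ?_) (by simp) (by simp) (by simp)
    fun p : PdwVertex F × PdwVertex F => f p.1 p.2
  obtain ⟨u, w⟩ := p
  rcases u with _ | _ | i | i <;> rcases w with _ | _ | j | j <;> simp [pdwAngle]

end

theorem vertexRelations_mirror {V : Type} (C : Chart V) (val : AngleType → ℝ) :
    C.mirror.VertexRelations val ↔ C.VertexRelations val :=
  forall_congr' fun v => by
    rw [← finsum_mem_swap (fun u w => C.angle u v w) (fun u w => val (C.ang u v w))]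
    rfl

theorem Coherent.vertexRelations {F : ℕ} [NeZero (F / 2)] (hF : 6 ≤ F) {ℓ : SideLengths}
    {L : PdwVertex F → PdwVertex F → ℝ} {A : PdwVertex F → PdwVertex F → PdwVertex F → ℝ}
    {val : AngleType → ℝ} (h : Coherent ℓ L A val) (hA : AngleSums A) :
    (chartP F hF ℓ).VertexRelations val := by
  intro v
  have h1 : ∑ᶠ p ∈ {p : PdwVertex F × PdwVertex F | pdwAngle p.1 v p.2}, val (pAng p.1 v p.2) =
      ∑ᶠ p ∈ {p : PdwVertex F × PdwVertex F | pdwAngle p.1 v p.2}, A p.1 v p.2 :=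
    finsum_mem_congr rfl fun p hp => (h.ang _ _ _ hp).symm
  refine Eq.trans h1 ?_
  rcases v with _ | _ | i | i
  · rw [finsum_angles_north fun u w => A u N w]; exact hA.north
  · rw [finsum_angles_south fun u w => A u S w]; exact hA.south
  · rw [finsum_angles_even (fun u w => A u (ev i) w) hF]; exact hA.even i
  · rw [finsum_angles_odd (fun u w => A u (od i) w) hF]; exact hA.odd i

theorem IsMapOf.comp_reflect {F : ℕ} {M M' : SphMap (PdwVertex F)} {T : QuadTiling F}
    {pos : PdwVertex F → Sphere2} (h : IsMapOf M T pos)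
    (hadj : ∀ u v, M.graph.Adj (reflect u) (reflect v) ↔ M'.graph.Adj u v)
    (hang : ∀ u v w, M.angle (reflect u) (reflect v) (reflect w) ↔ M'.angle u v w) :
    IsMapOf M' T (pos ∘ reflect) where
  pos_injective := h.pos_injective.comp
    (Function.LeftInverse.injective (g := reflect) reflect_reflect)
  vertex_iff x := by
    rw [← h.vertex_iff]
    constructor
    · rintro ⟨v, hv⟩; exact ⟨_, hv⟩
    · rintro ⟨v, hv⟩
      exact ⟨reflect v, by rw [Function.comp_apply, reflect_reflect, hv]⟩
  adj_iff u v := (hadj u v).symm.trans (h.adj_iff _ _)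
  angle_iff u v w := (hang u v w).symm.trans (h.angle_iff _ _ _)

theorem IsMapOf.mirror_of_pdw {F : ℕ} {hF : 6 ≤ F} {T : QuadTiling F}
    {pos : PdwVertex F → Sphere2} (h : IsMapOf (pdw F hF) T pos) :
    IsMapOf (pdw F hF).mirror T (pos ∘ reflect) :=
  h.comp_reflect pdwAdj_reflect pdwAngle_reflect

theorem IsMapOf.pdw_of_mirror {F : ℕ} {hF : 6 ≤ F} {T : QuadTiling F}
    {pos : PdwVertex F → Sphere2} (h : IsMapOf (pdw F hF).mirror T pos) :
    IsMapOf (pdw F hF) T (pos ∘ reflect) :=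
  h.comp_reflect pdwAdj_reflect fun u v w => pdwAngle_reflect w v u

/-! ### From the map of a tiling to faces and angle sums -/

section Tiling

variable {F : ℕ} {hF : 6 ≤ F} {T : QuadTiling F} {pos : PdwVertex F → Sphere2}

theorem ccwAngle_eq_innerAngle {Q : SphQuadrangle} {k : Fin 4} {p q r : Sphere2}
    (h1 : Q.corner (k + 1) = q) (h2 : Q.corner k = p) (h3 : Q.corner (k - 1) = r) :
    Q.innerAngle k = ccwAngle p q r := by
  rw [SphQuadrangle.innerAngle, h1, h2, h3]

theorem Coherent.isChartOf [NeZero (F / 2)] (h : IsMapOf (pdw F hF) T pos) {ℓ : SideLengths}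
    {val : AngleType → ℝ} (hA : AngleSums fun u v w => ccwAngle (pos v) (pos u) (pos w))
    (hc : Coherent ℓ (fun u v => sphDist (pos u) (pos v))
      (fun u v w => ccwAngle (pos v) (pos u) (pos w)) val) :
    IsChartOf (chartP F hF ℓ) T pos val where
  isMapOf := h
  len_eq := hc.len
  ang_eq u v w i k h1 h2 h3 := (ccwAngle_eq_innerAngle h1 h2 h3).trans
    (hc.ang u v w ((h.angle_iff u v w).mpr ⟨i, k, h1, h2, h3⟩))
  vertexRelations := hc.vertexRelations hF hA

/-- Serves the case where the sides `b` lie on the edges `v_{2i+1} v_{2i+2}`: the reflected data are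
then coherent, and the vertices of the mirror chart are located by `pos ∘ reflect`. -/
theorem Coherent.isChartOf_mirror [NeZero (F / 2)] (h : IsMapOf (pdw F hF) T pos) {ℓ : SideLengths}
    {val : AngleType → ℝ} (hA : AngleSums fun u v w => ccwAngle (pos v) (pos u) (pos w))
    (hc : Coherent ℓ (fun u v => sphDist (pos (reflect u)) (pos (reflect v)))
      (fun u v w => ccwAngle (pos (reflect v)) (pos (reflect w)) (pos (reflect u))) val) :
    IsChartOf (chartP F hF ℓ).mirror T (pos ∘ reflect) val where
  isMapOf := h.mirror_of_pdw
  len_eq := hc.len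
  ang_eq u v w i k h1 h2 h3 := (ccwAngle_eq_innerAngle h1 h2 h3).trans
    (hc.ang w v u ((h.mirror_of_pdw.angle_iff u v w).mpr ⟨i, k, h1, h2, h3⟩))
  vertexRelations := (vertexRelations_mirror _ _).mpr (hc.vertexRelations hF hA.reflect)

/-- The angle at the pole supplies a tile with three of its corners. The fourth is determined by the
angle of that tile at `v_{2i}`: only `v_{2i+1}` precedes the pole in the cyclic order there. -/
theorem IsMapOf.north_face (h : IsMapOf (pdw F hF) T pos) (i : ZMod (F / 2)) :
    ∃ t k, (T.tile t).corner k = pos N ∧ (T.tile t).corner (k + 1) = pos (ev i) ∧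
      (T.tile t).corner (k + 2) = pos (od i) ∧ (T.tile t).corner (k + 3) = pos (ev (i + 1)) := by
  obtain ⟨t, k, h1, h2, h3⟩ := (h.angle_iff (ev i) N (ev (i + 1))).mp rfl
  obtain ⟨v, hv⟩ := (h.vertex_iff ((T.tile t).corner (k + 2))).mpr ⟨t, k + 2, rfl⟩
  have h4 : pdwAngle v (ev i) N := (h.angle_iff v (ev i) N).mpr ⟨t, k + 1, by
    rw [hv, (by decide : ∀ k : Fin 4, k + 1 + 1 = k + 2) k], h1, by
    rw [← h2, (by decide : ∀ k : Fin 4, k + 1 - 1 = k) k]⟩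
  obtain rfl : v = od i := by
    rcases v with _ | _ | j | j <;> simp only [pdwAngle] at h4
    rw [h4]
  refine ⟨t, k, h2, h1, hv.symm, ?_⟩
  rw [← h3, (by decide : ∀ k : Fin 4, k - 1 = k + 3) k]

theorem IsMapOf.south_face (h : IsMapOf (pdw F hF) T pos) (i : ZMod (F / 2)) :
    ∃ t k, (T.tile t).corner k = pos S ∧ (T.tile t).corner (k + 1) = pos (od i) ∧
      (T.tile t).corner (k + 2) = pos (ev i) ∧ (T.tile t).corner (k + 3) = pos (od (i - 1)) := by
  obtain ⟨t, k, h1, h2, h3⟩ := (h.angle_iff (od i) S (od (i - 1))).mp rfl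
  obtain ⟨v, hv⟩ := (h.vertex_iff ((T.tile t).corner (k + 2))).mpr ⟨t, k + 2, rfl⟩
  have h4 : pdwAngle v (od i) S := (h.angle_iff v (od i) S).mpr ⟨t, k + 1, by
    rw [hv, (by decide : ∀ k : Fin 4, k + 1 + 1 = k + 2) k], h1, by
    rw [← h2, (by decide : ∀ k : Fin 4, k + 1 - 1 = k) k]⟩
  obtain rfl : v = ev i := by
    rcases v with _ | _ | j | j <;> simp only [pdwAngle] at h4
    rw [h4]
  refine ⟨t, k, h2, h1, hv.symm, ?_⟩
  rw [← h3, (by decide : ∀ k : Fin 4, k - 1 = k + 3) k]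

theorem IsMapOf.sum_three (h : IsMapOf (pdw F hF) T pos) {v u₀ u₁ u₂ : PdwVertex F}
    (h0 : pdwAngle u₀ v u₁) (h1 : pdwAngle u₁ v u₂) (h2 : pdwAngle u₂ v u₀) (h01 : u₀ ≠ u₁)
    (h02 : u₀ ≠ u₂) :
    ccwAngle (pos v) (pos u₀) (pos u₁) + ccwAngle (pos v) (pos u₁) (pos u₂) +
      ccwAngle (pos v) (pos u₂) (pos u₀) = 2 * Real.pi := by
  -- The default branch covers the initial index `0` and the closing index `3`.
  let u : ℕ → Sphere2 := fun j => if j = 1 then pos u₁ else if j = 2 then pos u₂ else pos u₀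
  have hsum := T.sum_ccwAngle (pos v) 3 (by norm_num) u (by simp [u])
    (fun j hj hju => by
      interval_cases j
      · rfl
      · exact absurd (h.pos_injective (by simpa [u] using hju)) h01
      · exact absurd (h.pos_injective (by simpa [u] using hju)) h02)
    (fun j hj => by
      have key : ∀ a b, pdwAngle a v b → ∃ i k, (T.tile i).corner k = pos v ∧
          (T.tile i).corner (k + 1) = pos a ∧ (T.tile i).corner (k - 1) = pos b := by
        intro a b hab
        obtain ⟨i, k, e1, e2, e3⟩ := (h.angle_iff a v b).mp hab
        exact ⟨i, k, e2, e1, e3⟩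
      interval_cases j
      · simpa [u] using key _ _ h0
      · simpa [u] using key _ _ h1
      · simpa [u] using key _ _ h2)
  simpa [Finset.sum_range_succ, u] using hsum

theorem ZMod.sum_eq_sum_range {n : ℕ} [NeZero n] (f : ZMod n → ℝ) :
    ∑ i, f i = ∑ j ∈ Finset.range n, f j := by
  refine Eq.symm
    (Finset.sum_bij (fun j _ => (j : ZMod n)) (fun _ _ => Finset.mem_univ _) ?_ ?_ ?_)
  · intro a ha b hb hab
    rw [ZMod.natCast_eq_natCast_iff'] at hab
    rwa [Nat.mod_eq_of_lt (Finset.mem_range.mp ha), Nat.mod_eq_of_lt (Finset.mem_range.mp hb)] at hab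
  · intro b _
    exact ⟨b.val, Finset.mem_range.mpr (ZMod.val_lt b), ZMod.natCast_zmod_val b⟩
  · intro a _; rfl

theorem IsMapOf.sum_cyclic (h : IsMapOf (pdw F hF) T pos) [NeZero (F / 2)] {v : PdwVertex F}
    (l : ZMod (F / 2) → PdwVertex F) (hl : Function.Injective l)
    (hang : ∀ i, pdwAngle (l i) v (l (i + 1))) :
    ∑ i, ccwAngle (pos v) (pos (l i)) (pos (l (i + 1))) = 2 * Real.pi := by
  rw [ZMod.sum_eq_sum_range fun i => ccwAngle (pos v) (pos (l i)) (pos (l (i + 1)))]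
  have hsum := T.sum_ccwAngle (pos v) (F / 2) (by omega) (fun j => pos (l (j : ZMod (F / 2))))
    (by simp) (fun j hj hju => by
      have h1 := hl (h.pos_injective hju)
      rw [eq_comm, Nat.cast_zero, ZMod.natCast_eq_zero_iff] at h1
      exact Nat.eq_zero_of_dvd_of_lt h1 hj)
    (fun j hj => by
      obtain ⟨i, k, e1, e2, e3⟩ := (h.angle_iff _ _ _).mp (hang j)
      exact ⟨i, k, e2, e1, by rw [e3]; push_cast; rfl⟩)
  simpa using hsum

theorem IsMapOf.angleSums [NeZero (F / 2)] (h : IsMapOf (pdw F hF) T pos) :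
    AngleSums fun u v w => ccwAngle (pos v) (pos u) (pos w) where
  north := h.sum_cyclic ev (fun i j hij => by simpa using hij) fun i => rfl
  south := by
    have hsum := h.sum_cyclic (v := S) (fun i => od (-i)) (fun i j hij => by simpa using hij)
      fun i => by simp only [pdwAngle]; ring
    refine Eq.trans ((Equiv.sum_comp (Equiv.neg (ZMod (F / 2)))
      fun i => ccwAngle (pos S) (pos (od i)) (pos (od (i - 1)))).symm.trans ?_) hsum
    refine Finset.sum_congr rfl fun i _ => ?_
    rw [Equiv.neg_apply, show -(i + 1) = -i - 1 by ring]
  even i := by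
    have : Fact (1 < F / 2) := ⟨by omega⟩
    exact h.sum_three (by simp [pdwAngle]) (by simp [pdwAngle]) (by simp [pdwAngle]) (by simp)
      (by simp)
  odd i := by
    have : Fact (1 < F / 2) := ⟨by omega⟩
    exact h.sum_three (by simp [pdwAngle]) (by simp [pdwAngle]) (by simp [pdwAngle]) (by simp)
      (by simp)

end Tiling

/-! ### The location of the sides `b` and the chart `P_F` -/

theorem sphDist_comm (p q : Sphere2) : sphDist p q = sphDist q p :=
  InnerProductGeometry.angle_comm _ _

/-- The angles of congruent tiles with sides `c, a, a, b` have common values. -/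
theorem QuadTiling.Monohedral.exists_angle_values {F : ℕ} {T : QuadTiling F} (hT : T.Monohedral)
    {ℓ : SideLengths} (i₀ : Fin F) (h : (T.tile i₀).HasSides ℓ) :
    ∃ val : AngleType → ℝ, ∀ i, ∃ k ε : Fin 4, (ε = 1 ∨ ε = -1) ∧
      (∀ j, sphDist ((T.tile i).corner (k + ε * j)) ((T.tile i).corner (k + ε * (j + 1))) =
        ![ℓ.c, ℓ.a, ℓ.a, ℓ.b] j) ∧
      ∀ j, (T.tile i).innerAngle (k + ε * j) =
        ![val alpha, val beta, val gamma, val delta] j := by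
  obtain ⟨k₀, ε₀, hε₀, hlen⟩ := h
  refine ⟨fun x => match x with
    | alpha => (T.tile i₀).innerAngle (k₀ + ε₀ * 0)
    | beta => (T.tile i₀).innerAngle (k₀ + ε₀ * 1)
    | gamma => (T.tile i₀).innerAngle (k₀ + ε₀ * 2)
    | delta => (T.tile i₀).innerAngle (k₀ + ε₀ * 3), fun i => ?_⟩
  obtain ⟨k₁, ε₁, hε₁, hdist, hang⟩ := (hT i₀ i).exists_corner_map
  -- Composition of two dihedral relabellings of the corners: that of the sides of the reference
  -- tile and that of the congruence.
  have e : ∀ j, k₁ + ε₁ * k₀ + ε₁ * ε₀ * j = k₁ + ε₁ * (k₀ + ε₀ * j) := by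
    clear hlen hdist hang hε₀ hε₁
    revert k₁ ε₁ k₀ ε₀
    decide
  refine ⟨k₁ + ε₁ * k₀, ε₁ * ε₀, ?_, fun j => ?_, fun j => ?_⟩
  · rcases hε₀ with rfl | rfl <;> rcases hε₁ with rfl | rfl <;> decide
  · rw [e, e, hdist, hlen]
  · rw [e, hang]
    fin_cases j <;> rfl

section

variable {F : ℕ} {ℓ : SideLengths} {L : PdwVertex F → PdwVertex F → ℝ}
  {A : PdwVertex F → PdwVertex F → PdwVertex F → ℝ} {val : AngleType → ℝ}

/-- The four positions of a tile of the pseudo-double wheel. -/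
theorem placed_or_flipped {Q : SphQuadrangle} {k : Fin 4} {pos : PdwVertex F → Sphere2}
    (hQ : ∃ k ε : Fin 4, (ε = 1 ∨ ε = -1) ∧
      (∀ j, sphDist (Q.corner (k + ε * j)) (Q.corner (k + ε * (j + 1))) =
        ![ℓ.c, ℓ.a, ℓ.a, ℓ.b] j) ∧
      ∀ j, Q.innerAngle (k + ε * j) = ![val alpha, val beta, val gamma, val delta] j)
    {p₀ p₁ p₂ p₃ : PdwVertex F} (h0 : Q.corner k = pos p₀) (h1 : Q.corner (k + 1) = pos p₁)
    (h2 : Q.corner (k + 2) = pos p₂) (h3 : Q.corner (k + 3) = pos p₃)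
    (hL : L = fun u v => sphDist (pos u) (pos v))
    (hA : A = fun u v w => ccwAngle (pos v) (pos u) (pos w))
    (h01 : L p₀ p₁ ≠ ℓ.b) (h30 : L p₃ p₀ ≠ ℓ.b) :
    (Placed L A ℓ val p₀ p₁ p₂ p₃ ∨ Flipped L A ℓ val p₀ p₁ p₂ p₃) ∨
    (Placed L (fun u v w => A w v u) ℓ val p₀ p₃ p₂ p₁ ∨
      Flipped L (fun u v w => A w v u) ℓ val p₀ p₃ p₂ p₁) := by
  subst hL hA
  obtain ⟨k₁, ε, hε, hlen, hang⟩ := hQ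
  have e : ∀ j, k + (k₁ - k + ε * j) = k₁ + ε * j := by
    clear hlen hang hε h0 h1 h2 h3
    revert k₁ ε k
    decide
  have h0' : Q.corner (k + 0) = pos p₀ := by rw [add_zero]; exact h0
  have t0 : Q.innerAngle (k + 0) = ccwAngle (pos p₀) (pos p₁) (pos p₃) := by
    rw [SphQuadrangle.innerAngle, h0', add_zero, h1,
      (by decide : ∀ k : Fin 4, k - 1 = k + 3) k, h3]
  have t1 : Q.innerAngle (k + 1) = ccwAngle (pos p₁) (pos p₂) (pos p₀) := by
    rw [SphQuadrangle.innerAngle, h1, (by decide : ∀ k : Fin 4, k + 1 + 1 = k + 2) k, h2,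
      (by decide : ∀ k : Fin 4, k + 1 - 1 = k) k, h0]
  have t2 : Q.innerAngle (k + 2) = ccwAngle (pos p₂) (pos p₃) (pos p₁) := by
    rw [SphQuadrangle.innerAngle, h2, (by decide : ∀ k : Fin 4, k + 2 + 1 = k + 3) k, h3,
      (by decide : ∀ k : Fin 4, k + 2 - 1 = k + 1) k, h1]
  have t3 : Q.innerAngle (k + 3) = ccwAngle (pos p₃) (pos p₀) (pos p₂) := by
    rw [SphQuadrangle.innerAngle, h3, (by decide : ∀ k : Fin 4, k + 3 + 1 = k) k, h0,
      (by decide : ∀ k : Fin 4, k + 3 - 1 = k + 2) k, h2]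
  have h := tile_positions (D := fun i j => sphDist (Q.corner (k + i)) (Q.corner (k + j)))
    (fun i j => sphDist_comm _ _) (θ := fun j => Q.innerAngle (k + j))
    (a := ℓ.a) (b := ℓ.b) (c := ℓ.c) (α := val alpha) (β := val beta) (γ := val gamma)
    (δ := val delta) ⟨k₁ - k, ε, hε, fun j => by rw [e, e, hlen], fun j => by rw [e, hang]⟩
    (by rw [h0', h1]; exact h01) (by rw [h0', h3]; exact h30)
  simp only [h0', h1, h2, h3, t0, t1, t2, t3] at h
  rcases h with ⟨a1, a2, a3, a4, a5, a6, a7, a8⟩ | ⟨a1, a2, a3, a4, a5, a6, a7, a8⟩ |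
    ⟨a1, a2, a3, a4, a5, a6, a7, a8⟩ | ⟨a1, a2, a3, a4, a5, a6, a7, a8⟩
  · exact Or.inl (Or.inl ⟨a1, a2, a3, a4, a5, a6, a7, a8⟩)
  · exact Or.inl (Or.inr ⟨a1, a2, a3, a4, a5, a6, a7, a8⟩)
  · exact Or.inr (Or.inl ⟨a1, a2, a3, a4, a5, a6, a7, a8⟩)
  · exact Or.inr (Or.inr ⟨a1, a2, a3, a4, a5, a6, a7, a8⟩)

theorem placed_or_flipped_len {V : Type} {L : V → V → ℝ} {A : V → V → V → ℝ} {p₀ p₁ p₂ p₃ : V}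
    (h : Placed L A ℓ val p₀ p₁ p₂ p₃ ∨ Flipped L A ℓ val p₀ p₁ p₂ p₃) (hab : ℓ.a ≠ ℓ.b)
    (hcb : ℓ.c ≠ ℓ.b) : L p₁ p₂ = ℓ.b ∧ L p₂ p₃ ≠ ℓ.b := by
  rcases h with h | h
  · exact ⟨h.len₁, by rw [h.len₂]; exact hcb⟩
  · exact ⟨h.len₁, by rw [h.len₂]; exact hab⟩

/-- The sides `b` are on all the edges `v_{2i} v_{2i+1}` or on all the edges
`v_{2i+1} v_{2i+2}`. -/
theorem left_or_right [NeZero (F / 2)] (hL : ∀ u v, L u v = L v u) (hab : ℓ.a ≠ ℓ.b)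
    (hcb : ℓ.c ≠ ℓ.b)
    {A' : PdwVertex F → PdwVertex F → PdwVertex F → ℝ}
    (hN : ∀ i, (Placed L A ℓ val N (ev i) (od i) (ev (i + 1)) ∨
      Flipped L A ℓ val N (ev i) (od i) (ev (i + 1))) ∨
      (Placed L A' ℓ val N (ev (i + 1)) (od i) (ev i) ∨
      Flipped L A' ℓ val N (ev (i + 1)) (od i) (ev i)))
    (hS : ∀ i, (Placed L A ℓ val S (od i) (ev i) (od (i - 1)) ∨
      Flipped L A ℓ val S (od i) (ev i) (od (i - 1))) ∨
      (Placed L A' ℓ val S (od (i - 1)) (ev i) (od i) ∨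
      Flipped L A' ℓ val S (od (i - 1)) (ev i) (od i))) :
    ((∀ i, Placed L A ℓ val N (ev i) (od i) (ev (i + 1)) ∨
      Flipped L A ℓ val N (ev i) (od i) (ev (i + 1))) ∧
      ∀ i, Placed L A ℓ val S (od i) (ev i) (od (i - 1)) ∨
      Flipped L A ℓ val S (od i) (ev i) (od (i - 1))) ∨
    ((∀ i, Placed L A' ℓ val N (ev (i + 1)) (od i) (ev i) ∨
      Flipped L A' ℓ val N (ev (i + 1)) (od i) (ev i)) ∧
      ∀ i, Placed L A' ℓ val S (od (i - 1)) (ev i) (od i) ∨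
      Flipped L A' ℓ val S (od (i - 1)) (ev i) (od i)) := by
  have hNl : ∀ i, L (ev i) (od i) = ℓ.b → (Placed L A ℓ val N (ev i) (od i) (ev (i + 1)) ∨
      Flipped L A ℓ val N (ev i) (od i) (ev (i + 1))) := fun i hi =>
    (hN i).resolve_right fun h => (placed_or_flipped_len h hab hcb).2 (by rw [hL, hi])
  have hNr : ∀ i, L (ev i) (od i) ≠ ℓ.b → (Placed L A' ℓ val N (ev (i + 1)) (od i) (ev i) ∨
      Flipped L A' ℓ val N (ev (i + 1)) (od i) (ev i)) := fun i hi =>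
    (hN i).resolve_left fun h => hi (placed_or_flipped_len h hab hcb).1
  have hSl : ∀ i, L (ev i) (od i) = ℓ.b → (Placed L A ℓ val S (od i) (ev i) (od (i - 1)) ∨
      Flipped L A ℓ val S (od i) (ev i) (od (i - 1))) := fun i hi =>
    (hS i).resolve_right fun h => (placed_or_flipped_len h hab hcb).2 hi
  have hSr : ∀ i, L (ev i) (od i) ≠ ℓ.b → (Placed L A' ℓ val S (od (i - 1)) (ev i) (od i) ∨
      Flipped L A' ℓ val S (od (i - 1)) (ev i) (od i)) := fun i hi =>
    (hS i).resolve_left fun h => hi (by rw [hL]; exact (placed_or_flipped_len h hab hcb).1)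
  -- The edge `v_{2i+1} v_{2i+2}` is shared by the northern tile at `i` and the southern tile at `i
  -- + 1`. Each has just one side `b` on the cycle, so both have it there or neither has.
  have hstep : ∀ i, L (ev i) (od i) = ℓ.b ↔ L (ev (i + 1)) (od (i + 1)) = ℓ.b := by
    intro i
    constructor
    · intro hi
      by_contra h
      have h1 := (placed_or_flipped_len (hSr _ h) hab hcb).1
      rw [add_sub_cancel_right] at h1
      exact (placed_or_flipped_len (hNl i hi) hab hcb).2 h1
    · intro hi
      by_contra h
      have h1 := (placed_or_flipped_len (hSl _ hi) hab hcb).2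
      rw [add_sub_cancel_right] at h1
      exact h1 (placed_or_flipped_len (hNr i h) hab hcb).1
  have hall : ∀ i, L (ev i) (od i) = ℓ.b ↔ L (ev 0) (od 0) = ℓ.b := by
    have hnat : ∀ m : ℕ, L (ev m) (od m) = ℓ.b ↔ L (ev 0) (od 0) = ℓ.b := by
      intro m
      induction m with
      | zero => rw [Nat.cast_zero]
      | succ m ih => rw [Nat.cast_succ, ← hstep, ih]
    intro i
    have := hnat i.val
    rwa [ZMod.natCast_zmod_val] at this
  by_cases h : L (ev 0) (od 0) = ℓ.b
  · exact Or.inl ⟨fun i => hNl i ((hall i).mpr h), fun i => hSl i ((hall i).mpr h)⟩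
  · exact Or.inr ⟨fun i => hNr i (fun h' => h ((hall i).mp h')),
      fun i => hSr i (fun h' => h ((hall i).mp h'))⟩

end

theorem placed_or_flipped_reflect {F : ℕ} {ℓ : SideLengths} {L : PdwVertex F → PdwVertex F → ℝ}
    {A : PdwVertex F → PdwVertex F → PdwVertex F → ℝ} {val : AngleType → ℝ}
    {p₀ p₁ p₂ p₃ q₀ q₁ q₂ q₃ : PdwVertex F} (h0 : reflect q₀ = p₀) (h1 : reflect q₁ = p₁)
    (h2 : reflect q₂ = p₂) (h3 : reflect q₃ = p₃)
    (h : Placed L (fun u v w => A w v u) ℓ val p₀ p₁ p₂ p₃ ∨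
      Flipped L (fun u v w => A w v u) ℓ val p₀ p₁ p₂ p₃) :
    Placed (fun u v => L (reflect u) (reflect v))
      (fun u v w => A (reflect w) (reflect v) (reflect u)) ℓ val q₀ q₁ q₂ q₃ ∨
    Flipped (fun u v => L (reflect u) (reflect v))
      (fun u v w => A (reflect w) (reflect v) (reflect u)) ℓ val q₀ q₁ q₂ q₃ := by
  subst h0 h1 h2 h3
  rcases h with ⟨a1, a2, a3, a4, a5, a6, a7, a8⟩ | ⟨a1, a2, a3, a4, a5, a6, a7, a8⟩
  · exact Or.inl ⟨a1, a2, a3, a4, a5, a6, a7, a8⟩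
  · exact Or.inr ⟨a1, a2, a3, a4, a5, a6, a7, a8⟩

theorem hasChart_chartP {F : ℕ} (hF : 6 ≤ F) {T : QuadTiling F} (hT : T.Monohedral) {t : TileType}
    {ℓ : SideLengths} (htype : ∀ i, (T.tile i).IsOfType t ℓ) {pos : PdwVertex F → Sphere2}
    (hmap : IsMapOf (pdw F hF) T pos)
    (hb : ∀ u v, (pdw F hF).graph.Adj u v → sphDist (pos u) (pos v) = ℓ.b → ¬ IsMeridian u v) :
    T.HasChart (chartP F hF ℓ) ∨ T.HasChart (chartP F hF ℓ).mirror := by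
  have : NeZero (F / 2) := ⟨by omega⟩
  obtain ⟨htype', hsides⟩ := htype ⟨0, by omega⟩
  have hab : ℓ.a ≠ ℓ.b := by
    cases t
    · exact htype'.2
    · exact htype'.1
  have hcb : ℓ.c ≠ ℓ.b := by
    cases t
    · exact htype'.1 ▸ htype'.2
    · exact htype'.2.2.symm
  obtain ⟨val, hval⟩ := hT.exists_angle_values _ hsides
  have hsums := hmap.angleSums
  set L : PdwVertex F → PdwVertex F → ℝ := fun u v => sphDist (pos u) (pos v) with hLdef
  set A : PdwVertex F → PdwVertex F → PdwVertex F → ℝ :=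
    fun u v w => ccwAngle (pos v) (pos u) (pos w) with hAdef
  have hL : ∀ u v, L u v = L v u := fun u v => sphDist_comm _ _
  have hN : ∀ i, (Placed L A ℓ val N (ev i) (od i) (ev (i + 1)) ∨
      Flipped L A ℓ val N (ev i) (od i) (ev (i + 1))) ∨
      (Placed L (fun u v w => A w v u) ℓ val N (ev (i + 1)) (od i) (ev i) ∨
      Flipped L (fun u v w => A w v u) ℓ val N (ev (i + 1)) (od i) (ev i)) := fun i => by
    obtain ⟨t, k, h0, h1, h2, h3⟩ := hmap.north_face i
    exact placed_or_flipped (hval t) h0 h1 h2 h3 hLdef hAdef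
      (fun h => hb N (ev i) trivial h trivial) (fun h => hb (ev (i + 1)) N trivial h trivial)
  have hS : ∀ i, (Placed L A ℓ val S (od i) (ev i) (od (i - 1)) ∨
      Flipped L A ℓ val S (od i) (ev i) (od (i - 1))) ∨
      (Placed L (fun u v w => A w v u) ℓ val S (od (i - 1)) (ev i) (od i) ∨
      Flipped L (fun u v w => A w v u) ℓ val S (od (i - 1)) (ev i) (od i)) := fun i => by
    obtain ⟨t, k, h0, h1, h2, h3⟩ := hmap.south_face i
    exact placed_or_flipped (hval t) h0 h1 h2 h3 hLdef hAdef
      (fun h => hb S (od i) trivial h trivial) (fun h => hb (od (i - 1)) S trivial h trivial)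
  -- Any single tile suffices to apply the two trigonometric facts to the common values of the
  -- angles.
  obtain ⟨k, ε, hε, hlen, hang⟩ := hval ⟨0, by omega⟩
  have l0 := hlen 0
  have l1 := hlen 1
  have l2 := hlen 2
  have a0 := hang 0
  have a1 := hang 1
  have a2 := hang 2
  have a3 := hang 3
  simp only [mul_zero, zero_add, add_zero, mul_one, (by decide : (1 + 1 : Fin 4) = 2),
    (by decide : (2 + 1 : Fin 4) = 3)] at l0 l1 l2 a0 a1 a2 a3
  change _ = ℓ.c at l0
  change _ = ℓ.a at l1
  change _ = ℓ.a at l2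
  change _ = val alpha at a0
  change _ = val beta at a1
  change _ = val gamma at a2
  change _ = val delta at a3
  have hsymm : ℓ.a = ℓ.c → val beta = val gamma → val alpha = val delta := fun hac h => by
    rw [← a0, ← a3]
    exact SphQuadrangle.innerAngle_eq_of_three_equal_sides' _ hε (by rw [l0, l1, hac])
      (by rw [l1, l2]) (by rw [a1, a2, h])
  have hexcl : ℓ.a = ℓ.c → 2 * val alpha + val beta = 2 * Real.pi →
      2 * val delta + val gamma = 2 * Real.pi → val beta + val gamma ≤ Real.pi → False :=
    fun hac h1 h2 h3 =>
    SphQuadrangle.false_of_angle_relations' _ hε (by rw [l0, l1, hac]) (by rw [l1, l2])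
      (by rw [a0, a1, h1]) (by rw [a3, a2, h2]) (by rw [a1, a2]; exact h3)
  rcases left_or_right hL hab hcb hN hS with ⟨hN, hS⟩ | ⟨hN, hS⟩
  · obtain ⟨val', hc⟩ := exists_coherent hF hL hsums hN hS hsymm hexcl
    exact Or.inl ⟨_, _, hc.isChartOf hmap hsums⟩
  -- After reflection the sides `b` lie on the edges `v_{2i} v_{2i+1}`; the northern face `i` comes
  -- from the face `-i - 1`, the southern face `i` from the face `-i`.
  · obtain ⟨val', hc⟩ := exists_coherent hF (L := fun u v => L (reflect u) (reflect v))
      (fun u v => hL _ _) hsums.reflect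
      (fun i => placed_or_flipped_reflect rfl (by simp [reflect]) rfl
        (by simp only [reflect]; congr 1; ring) (hN (-i - 1)))
      (fun i => placed_or_flipped_reflect rfl rfl rfl
        (by simp only [reflect]; congr 1; ring) (hS (-i)))
      hsymm hexcl
    exact Or.inr ⟨_, _, hc.isChartOf_mirror hmap hsums⟩

/-! ### Exclusion of the charts `Q_F` -/

/-- As `n` is even, the shift by `1` reverses the parity of representatives even where it wraps
around; adding the sum to its shift makes every term `b + c`. -/
theorem sum_alternating {n : ℕ} [NeZero n] (hn : Even n) (b c : ℝ) :
    2 * ∑ i : ZMod n, (if Even i.val then c else b) = n * (b + c) := by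
  have hn1 : 1 < n := by
    have := NeZero.ne n
    obtain ⟨m, hm⟩ := hn
    omega
  have : Fact (1 < n) := ⟨hn1⟩
  have hpar : ∀ i : ZMod n, Even (i + 1).val ↔ ¬ Even i.val := by
    intro i
    rw [ZMod.val_add, ZMod.val_one, ← Nat.even_add_one, Nat.even_iff, Nat.even_iff,
      Nat.mod_mod_of_dvd _ hn.two_dvd]
  have hshift : ∑ i : ZMod n, (if Even (i + 1).val then c else b) =
      ∑ i : ZMod n, (if Even i.val then c else b) :=
    Equiv.sum_comp (Equiv.addRight (1 : ZMod n)) (fun i => if Even i.val then c else b)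
  rw [two_mul]
  nth_rw 2 [← hshift]
  rw [← Finset.sum_add_distrib, Finset.sum_congr rfl (g := fun _ => b + c) fun i _ => ?_]
  · rw [Finset.sum_const, Finset.card_univ, ZMod.card, nsmul_eq_mul]
  · by_cases h : Even i.val
    · rw [if_pos h, if_neg (by rw [hpar]; exact not_not.mpr h), add_comm]
    · rw [if_neg h, if_pos ((hpar i).mpr h)]

/-- The values of the variables in the chart `Q_F`. -/
theorem chartQ_relations {F : ℕ} (hF : 6 ≤ F) (h4 : 4 ∣ F) {ℓ : SideLengths} {val : AngleType → ℝ}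
    (h : (chartQ F hF ℓ).VertexRelations val) :
    2 * val alpha + val beta = 2 * Real.pi ∧ 2 * val delta + val gamma = 2 * Real.pi ∧
      val beta + val gamma ≤ Real.pi := by
  have : NeZero (F / 2) := ⟨by omega⟩
  have : Fact (1 < F / 2) := ⟨by omega⟩
  have heven : Even (F / 2) := by
    obtain ⟨m, rfl⟩ := h4
    exact ⟨m, by omega⟩
  have hn4 : 4 ≤ F / 2 := by omega
  -- The angles at `v_0` are `δ, δ, γ` and those at `v_2` are `α, α, β`; at the pole, `β` and `γ`
  -- alternate. Since `4 ∣ F` and `F ≥ 6`, there are at least four angles at the pole.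
  have h0 := h (ev 0)
  have h1 := h (ev 1)
  have hN := h N
  change ∑ᶠ p ∈ {p : PdwVertex F × PdwVertex F | pdwAngle p.1 (ev 0) p.2},
    val (qAng p.1 (ev 0) p.2) = _ at h0
  change ∑ᶠ p ∈ {p : PdwVertex F × PdwVertex F | pdwAngle p.1 (ev 1) p.2},
    val (qAng p.1 (ev 1) p.2) = _ at h1
  change ∑ᶠ p ∈ {p : PdwVertex F × PdwVertex F | pdwAngle p.1 N p.2},
    val (qAng p.1 N p.2) = _ at hN
  rw [finsum_angles_even (fun u w => val (qAng u (ev 0) w)) hF] at h0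
  rw [finsum_angles_even (fun u w => val (qAng u (ev 1) w)) hF] at h1
  rw [finsum_angles_north (fun u w => val (qAng u N w))] at hN
  simp only [qAng, ZMod.val_zero, Even.zero, if_true] at h0
  simp only [qAng, ZMod.val_one, Nat.not_even_one, if_false] at h1
  simp only [qAng, apply_ite val] at hN
  have hsum := sum_alternating heven (val beta) (val gamma)
  rw [hN] at hsum
  refine ⟨by linarith, by linarith, ?_⟩
  have : (4 : ℝ) ≤ (F / 2 : ℕ) := by exact_mod_cast hn4
  have := Real.pi_pos
  by_contra hcon
  push Not at hcon
  nlinarith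

theorem not_hasChart_chartQ {F : ℕ} (hF : 6 ≤ F) (h4 : 4 ∣ F) (T : QuadTiling F)
    {ℓ : SideLengths} (hac : ℓ.a = ℓ.c) : ¬ T.HasChart (chartQ F hF ℓ) := by
  rintro ⟨pos, val, hc⟩
  have : Fact (1 < F / 2) := ⟨by omega⟩
  obtain ⟨r1, r2, r3⟩ := chartQ_relations hF h4 hc.vertexRelations
  have hmap : IsMapOf (pdw F hF) T pos := hc.isMapOf
  obtain ⟨t, k, h0, h1, h2, h3⟩ := hmap.north_face 0
  rw [zero_add] at h3
  -- The face `N v_0 v_1 v_2` is read counterclockwise from `v_1`: its angles are then `α, β, γ, δ`,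
  -- and its first three sides `c, a, a` are equal.
  obtain ⟨k, rfl⟩ : ∃ j, k = j + 2 := ⟨k - 2, by simp⟩
  rw [(by decide : ∀ k : Fin 4, k + 2 + 1 = k + 3) k] at h1
  rw [(by decide : ∀ k : Fin 4, k + 2 + 2 = k) k] at h2
  rw [(by decide : ∀ k : Fin 4, k + 2 + 3 = k + 1) k] at h3
  have e1 := (by decide : ∀ j : Fin 4, j + 1 + 1 = j + 2) k
  have e2 := (by decide : ∀ j : Fin 4, j + 2 + 1 = j + 3) k
  have e3 := (by decide : ∀ j : Fin 4, j + 3 + 1 = j) k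
  have f0 := (by decide : ∀ j : Fin 4, j - 1 = j + 3) k
  have f1 := (by decide : ∀ j : Fin 4, j + 1 - 1 = j) k
  have f2 := (by decide : ∀ j : Fin 4, j + 2 - 1 = j + 1) k
  have f3 := (by decide : ∀ j : Fin 4, j + 3 - 1 = j + 2) k
  have l1 : sphDist (pos (od 0)) (pos (ev 1)) = ℓ.c := by
    rw [hc.len_eq (od 0) (ev 1) (by simp [chartQ, pdw, pdwAdj])]
    simp [chartQ, pdwLen]
  have l2 : sphDist (pos (ev 1)) (pos N) = ℓ.a := hc.len_eq (ev 1) N trivial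
  have l3 : sphDist (pos N) (pos (ev 0)) = ℓ.a := hc.len_eq N (ev 0) trivial
  have g0 := hc.ang_eq (ev 1) (od 0) (ev 0) t k h3 h2 (by rw [f0]; exact h1)
  have g1 := hc.ang_eq N (ev 1) (od 0) t (k + 1) (by rw [e1]; exact h0) h3 (by rw [f1]; exact h2)
  have g2 := hc.ang_eq (ev 0) N (ev 1) t (k + 2) (by rw [e2]; exact h1) h0 (by rw [f2]; exact h3)
  have g3 := hc.ang_eq (od 0) (ev 0) N t (k + 3) (by rw [e3]; exact h2) h1 (by rw [f3]; exact h0)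
  simp only [chartQ, qAng, ZMod.val_zero, ZMod.val_one, Even.zero, Nat.not_even_one, if_true,
    if_false] at g0 g1 g2 g3
  refine (T.tile t).false_of_angle_relations k ?_ ?_ ?_ ?_ ?_
  · rw [h2, h3, h0, l1, l2, hac]
  · rw [h3, h0, h1, l2, l3]
  · rw [g0, g1]; exact r1
  · rw [g3, g2]; exact r2
  · rw [g1, g2]; exact r3

theorem not_hasChart_chartQ_mirror {F : ℕ} (hF : 6 ≤ F) (h4 : 4 ∣ F) (T : QuadTiling F)
    {ℓ : SideLengths} (hac : ℓ.a = ℓ.c) : ¬ T.HasChart (chartQ F hF ℓ).mirror := by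
  rintro ⟨pos, val, hc⟩
  have : Fact (1 < F / 2) := ⟨by omega⟩
  obtain ⟨r1, r2, r3⟩ := chartQ_relations hF h4
    ((vertexRelations_mirror _ _).mp hc.vertexRelations)
  have hmap : IsMapOf (pdw F hF) T (pos ∘ reflect) := hc.isMapOf.pdw_of_mirror
  -- In the reflected map this is the face `N v_2 v_1 v_0`. Read from `v_0`, its angles are `δ, γ,
  -- β, α`, so the two relations change places.
  obtain ⟨t, k, h0, h1, h2, h3⟩ := hmap.north_face (-1)
  simp only [Function.comp_apply, reflect, neg_neg, neg_add_cancel, neg_zero, sub_self]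
    at h0 h1 h2 h3
  obtain ⟨k, rfl⟩ : ∃ j, k = j + 1 := ⟨k - 1, by simp⟩
  rw [(by decide : ∀ k : Fin 4, k + 1 + 1 = k + 2) k] at h1
  rw [(by decide : ∀ k : Fin 4, k + 1 + 2 = k + 3) k] at h2
  rw [(by decide : ∀ k : Fin 4, k + 1 + 3 = k) k] at h3
  have e1 := (by decide : ∀ j : Fin 4, j + 1 + 1 = j + 2) k
  have e2 := (by decide : ∀ j : Fin 4, j + 2 + 1 = j + 3) k
  have e3 := (by decide : ∀ j : Fin 4, j + 3 + 1 = j) k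
  have f0 := (by decide : ∀ j : Fin 4, j - 1 = j + 3) k
  have f1 := (by decide : ∀ j : Fin 4, j + 1 - 1 = j) k
  have f2 := (by decide : ∀ j : Fin 4, j + 2 - 1 = j + 1) k
  have f3 := (by decide : ∀ j : Fin 4, j + 3 - 1 = j + 2) k
  have l1 : sphDist (pos (ev 1)) (pos (od 0)) = ℓ.c := by
    rw [hc.len_eq (ev 1) (od 0) (by simp [Chart.mirror, SphMap.mirror, chartQ, pdw, pdwAdj])]
    simp [Chart.mirror, chartQ, pdwLen]
  have l2 : sphDist (pos N) (pos (ev 1)) = ℓ.a := hc.len_eq N (ev 1) trivial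
  have l3 : sphDist (pos (ev 0)) (pos N) = ℓ.a := hc.len_eq (ev 0) N trivial
  have g3 := hc.ang_eq (ev 0) (od 0) (ev 1) t (k + 3) (by rw [e3]; exact h3) h2
    (by rw [f3]; exact h1)
  have g2 := hc.ang_eq (od 0) (ev 1) N t (k + 2) (by rw [e2]; exact h2) h1 (by rw [f2]; exact h0)
  have g1 := hc.ang_eq (ev 1) N (ev 0) t (k + 1) (by rw [e1]; exact h1) h0 (by rw [f1]; exact h3)
  have g0 := hc.ang_eq N (ev 0) (od 0) t k h0 h3 (by rw [f0]; exact h2)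
  simp only [Chart.mirror, chartQ, qAng, ZMod.val_zero, ZMod.val_one, Even.zero, Nat.not_even_one,
    if_true, if_false] at g0 g1 g2 g3
  refine (T.tile t).false_of_angle_relations k ?_ ?_ ?_ ?_ ?_
  · rw [h3, h0, h1, l3, l2]
  · rw [h0, h1, h2, l2, l1, hac]
  · rw [g0, g1]; exact r2
  · rw [g3, g2]; exact r1
  · rw [g1, g2, add_comm]; exact r3

end

theorem theorem5 (F : ℕ) (hF : 6 ≤ F) (hFeven : Even F)
    (T : QuadTiling F) (hT : T.Monohedral)
    (t : TileType) (ℓ : SideLengths) (htype : ∀ i, (T.tile i).IsOfType t ℓ)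
    (pos : PdwVertex F → Sphere2) (hmap : IsMapOf (pdw F hF) T pos)
    (hb : ∀ u v, (pdw F hF).graph.Adj u v → sphDist (pos u) (pos v) = ℓ.b → ¬ IsMeridian u v) :
    (T.HasChart (chartP F hF ℓ) ∨ T.HasChart (chartP F hF ℓ).mirror) ∧
    (4 ∣ F → ∀ ℓ' : SideLengths, ℓ'.OfType .two →
      ¬ T.HasChart (chartQ F hF ℓ') ∧ ¬ T.HasChart (chartQ F hF ℓ').mirror) :=
  ⟨hasChart_chartP hF hT htype hmap hb, fun h4 _ h =>
    ⟨not_hasChart_chartQ hF h4 T h.1, not_hasChart_chartQ_mirror hF h4 T h.1⟩⟩
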